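/- **Setting.** There are $m\ge 1$ related machines with private speeds $s_1,\dots,s_m>0$ and jobs with private sizes $p_1,\dots,p_n>0$ ($n$ is not known in advance). Machines first report their speeds; then jobs arrive one by one. Each job, having observed the speeds and the sizes and machines of all earlier jobs, reports a size, and is immediately and irrevocably assigned to a machine (using fresh randomness) and charged a fee; after the last job every machine receives a payment. If machine $i$ is assigned total size $L_i$, its completion time is $C_i=L_i/s_i$ and its utility is its payment minus $C_i$. A job of size $p$ assigned to machine $i$ with current load $L_i$ has cost $(L_i+p)/s_i$ plus its fee. The mechanism is *two-sided truthful* if, when all other reports are fixed (and truthful), reporting the true speed maximizes every machine's expected utility, and, for every observed history, reporting the true size minimizes every job's expected cost. The objective is the $\ell_q$ norm $\|(C_1,\dots,C_m)\|_q$, and $\mathrm{OPT}_q$ is its minimum over all (offline) assignments of the jobs to the machines. **Theorem.** There is an absolute constant $C>0$ such that for every $q\in[1,\infty]$ (with $1/\infty=0$) there is a randomized online mechanism (for all $m$) with the following properties. It is two-sided truthful. It runs in polynomial time: uniform real-RAM programs (with finitely many real constants, arithmetic operations, real powers and comparisons as unit-cost steps, and one uniform random number in $[0,1]$ per job) compute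 each assignment, each fee and the payments to all machines in a number of steps polynomial in $m$, the number of jobs and the absolute values of the binary logarithms of the speeds and sizes. For every $m\ge 2$ and every instance with $m$ machines, its objective value $\mathrm{ALG}$ under truthful reports satisfies $$\mathbb E[\mathrm{ALG}]\le R\cdot \mathrm{OPT}_q\qquad\text{and}\qquad \Pr[\mathrm{ALG}\le R\cdot\mathrm{OPT}_q]\ge 1-\frac1{m^2},\qquad R=C\, m^{\frac1q\left(1-\frac1q\right)}(\log m)^{1+\frac1{q^2}} .$$ -/

import Mathlib

open scoped ENNReal

/-! ## Real RAM with a step count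

A uniform, deterministic random access machine over the reals, presented as a small structured
programming language.  Integer memory and real memory are organised in arrays of unbounded length;
the array names are fixed by the program, the indices may be computed (indirect addressing). -/

namespace RealRAM

/-- Memory contents: `nat a i` and `real a i` are the `i`-th cells of the `a`-th integer array and
of the `a`-th real array. -/
structure State where
  nat : ℕ → ℕ → ℕ
  real : ℕ → ℕ → ℝ

/-- Integer expressions (subtraction is truncated at `0`). -/
inductive NExpr where
  | const (n : ℕ)
  | get (a : ℕ) (i : NExpr)
  | add (x y : NExpr)
  | sub (x y : NExpr)

def NExpr.eval (σ : State) : NExpr → ℕ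
  | .const n => n
  | .get a i => σ.nat a (i.eval σ)
  | .add x y => x.eval σ + y.eval σ
  | .sub x y => x.eval σ - y.eval σ

/-- Real expressions: finitely many real constants may be built into a program, and the
operations are the four arithmetic operations and real powers. -/
inductive RExpr where
  | const (c : ℝ)
  | get (a : ℕ) (i : NExpr)
  | ofNat (n : NExpr)
  | add (x y : RExpr)
  | sub (x y : RExpr)
  | mul (x y : RExpr)
  | div (x y : RExpr)
  | pow (x y : RExpr)

noncomputable def RExpr.eval (σ : State) : RExpr → ℝ
  | .const c => c
  | .get a i => σ.real a (i.eval σ)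
  | .ofNat n => (n.eval σ : ℝ)
  | .add x y => x.eval σ + y.eval σ
  | .sub x y => x.eval σ - y.eval σ
  | .mul x y => x.eval σ * y.eval σ
  | .div x y => x.eval σ / y.eval σ
  | .pow x y => x.eval σ ^ y.eval σ

/-- Tests: comparisons of integers or of reals, and their Boolean combinations. -/
inductive Test where
  | natLt (x y : NExpr)
  | realLt (x y : RExpr)
  | not (b : Test)
  | and (b c : Test)

def Test.Holds (σ : State) : Test → Prop
  | .natLt x y => x.eval σ < y.eval σ
  | .realLt x y => x.eval σ < y.eval σ
  | .not b => ¬ b.Holds σ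
  | .and b c => b.Holds σ ∧ c.Holds σ

/-- Programs. -/
inductive Prog where
  | setNat (a : ℕ) (i : NExpr) (e : NExpr)
  | setReal (a : ℕ) (i : NExpr) (e : RExpr)
  | seq (c d : Prog)
  | cond (b : Test) (c d : Prog)
  | loop (b : Test) (c : Prog)

/-- Write `v` into cell `i` of integer array `a`. -/
def State.writeNat (σ : State) (a i v : ℕ) : State :=
  { σ with nat := Function.update σ.nat a (Function.update (σ.nat a) i v) }

/-- Write `v` into cell `i` of real array `a`. -/
def State.writeReal (σ : State) (a i : ℕ) (v : ℝ) : State :=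
  { σ with real := Function.update σ.real a (Function.update (σ.real a) i v) }

/-- `Runs c σ t τ`: started in `σ`, the program `c` halts in `τ` after `t` steps.  Every executed
assignment and every evaluated test is one step; the expressions occurring in a program have a
fixed size, so this is the number of elementary operations up to a constant factor. -/
inductive Runs : Prog → State → ℕ → State → Prop where
  | setNat (a : ℕ) (i e : NExpr) (σ : State) :
      Runs (.setNat a i e) σ 1 (σ.writeNat a (i.eval σ) (e.eval σ))
  | setReal (a : ℕ) (i : NExpr) (e : RExpr) (σ : State) :
      Runs (.setReal a i e) σ 1 (σ.writeReal a (i.eval σ) (e.eval σ))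
  | seq {c d : Prog} {σ τ υ : State} {t u : ℕ} :
      Runs c σ t τ → Runs d τ u υ → Runs (.seq c d) σ (t + u) υ
  | condTrue {b : Test} {c d : Prog} {σ τ : State} {t : ℕ} :
      b.Holds σ → Runs c σ t τ → Runs (.cond b c d) σ (t + 1) τ
  | condFalse {b : Test} {c d : Prog} {σ τ : State} {t : ℕ} :
      ¬ b.Holds σ → Runs d σ t τ → Runs (.cond b c d) σ (t + 1) τ
  | loopStep {b : Test} {c : Prog} {σ τ υ : State} {t u : ℕ} :
      b.Holds σ → Runs c σ t τ → Runs (.loop b c) τ u υ → Runs (.loop b c) σ (t + u + 1) υ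
  | loopEnd {b : Test} {c : Prog} {σ : State} :
      ¬ b.Holds σ → Runs (.loop b c) σ 1 σ

end RealRAM

/-! ## Online scheduling with selfish machines and selfish jobs -/

namespace Scheduling

/-- What has happened so far: for each job that has arrived, in order of arrival, its size and the
machine to which it was assigned. -/
abbrev History (m : ℕ) := List (ℝ × Fin m)

/-- Total size of the jobs assigned to machine `i`. -/
noncomputable def load {m : ℕ} (h : History m) (i : Fin m) : ℝ :=
  (h.map fun x => if x.2 = i then x.1 else 0).sum

/-- The `ℓ_q` norm of the vector of machine completion times `load i / s i`. -/
noncomputable def objective {m : ℕ} (q : ℝ≥0∞) (s : Fin m → ℝ) (h : History m) : ℝ :=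
  ‖WithLp.toLp q (fun i => load h i / s i)‖

/-- The offline optimum for speeds `s` and job sizes `ps`: the least objective value over all
assignments of the jobs to the machines. -/
noncomputable def opt {m : ℕ} (q : ℝ≥0∞) (s : Fin m → ℝ) (ps : List ℝ) : ℝ :=
  ⨅ σ : Fin ps.length → Fin m, objective q s (List.ofFn fun j => (ps.get j, σ j))

/-- A randomized online mechanism for `m` machines.  It sees the reported speeds `s`.  When a job
reports size `p` after history `h`, it draws a fresh seed `u`, uniform on `[0, 1]` and independent
of everything before, assigns the job to machine `assign s h p u`, and charges it
`fee s h p i`, where `i` is the machine to which it has been assigned.  When there are no more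
jobs, it pays `pay s h i` to machine `i`, `h` being the complete history. -/
structure Mechanism (m : ℕ) where
  assign : (Fin m → ℝ) → History m → ℝ → ℝ → Fin m
  measurable_assign : ∀ s h p, Measurable (assign s h p)
  fee : (Fin m → ℝ) → History m → ℝ → Fin m → ℝ
  pay : (Fin m → ℝ) → History m → Fin m → ℝ

namespace Mechanism

variable {m : ℕ} (M : Mechanism m)

/-- Conditional probability, given the history `h`, that a job reporting `p` is assigned to `i`. -/
noncomputable def prob (s : Fin m → ℝ) (h : History m) (p : ℝ) (i : Fin m) : ℝ :=
  MeasureTheory.volume.real {u : ℝ | u ∈ Set.Icc 0 1 ∧ M.assign s h p u = i}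

/-- Expected value of `f` at the final history, when the history so far is `h` and the jobs still
to come report the sizes `ps`, in this order. -/
noncomputable def expect (s : Fin m → ℝ) : List ℝ → History m → (History m → ℝ) → ℝ
  | [], h, f => f h
  | p :: ps, h, f => ∑ i, M.prob s h p i * expect s ps (h ++ [(p, i)]) f

/-- Probability that the final history lies in `E`. -/
noncomputable def probability (s : Fin m → ℝ) (ps : List ℝ) (E : Set (History m)) : ℝ :=
  M.expect s ps [] (E.indicator 1)

/-- Expected utility (payment minus completion time) of machine `i` of true speed `s i` when it
reports the speed `b`; the other machines report `s`, and the job sizes are `ps`. -/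
noncomputable def machineUtility (s : Fin m → ℝ) (ps : List ℝ) (i : Fin m) (b : ℝ) : ℝ :=
  M.expect (Function.update s i b) ps []
    (fun h => M.pay (Function.update s i b) h i - load h i / s i)

/-- Expected cost (completion time plus fee) of a job of true size `p` that arrives after the
observed history `h` and reports the size `r`. -/
noncomputable def jobCost (s : Fin m → ℝ) (h : History m) (p r : ℝ) : ℝ :=
  ∑ i, M.prob s h r i * ((load h i + p) / s i + M.fee s h r i)

def MachineSideTruthful : Prop :=
  ∀ s : Fin m → ℝ, (∀ i, 0 < s i) → ∀ ps : List ℝ, (∀ p ∈ ps, 0 < p) →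
    ∀ (i : Fin m) (b : ℝ), 0 < b →
      M.machineUtility s ps i b ≤ M.machineUtility s ps i (s i)

def JobSideTruthful : Prop :=
  ∀ s : Fin m → ℝ, (∀ i, 0 < s i) → ∀ h : History m, (∀ x ∈ h, 0 < x.1) →
    ∀ p r : ℝ, 0 < p → 0 < r → M.jobCost s h p p ≤ M.jobCost s h p r

def TwoSidedTruthful : Prop :=
  M.MachineSideTruthful ∧ M.JobSideTruthful

/-- Expected objective at most `R` times the optimum, on every instance. -/
def CompetitiveInExpectation (q : ℝ≥0∞) (R : ℝ) : Prop :=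
  ∀ s : Fin m → ℝ, (∀ i, 0 < s i) → ∀ ps : List ℝ, (∀ p ∈ ps, 0 < p) →
    M.expect s ps [] (objective q s) ≤ R * opt q s ps

/-- With probability at least `1 - 1 / m ^ 2`, the objective is at most `R` times the optimum, on
every instance. -/
def CompetitiveWithHighProbability (q : ℝ≥0∞) (R : ℝ) : Prop :=
  ∀ s : Fin m → ℝ, (∀ i, 0 < s i) → ∀ ps : List ℝ, (∀ p ∈ ps, 0 < p) →
    1 - 1 / (m : ℝ) ^ 2 ≤ M.probability s ps {h | objective q s h ≤ R * opt q s ps}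

end Mechanism

/-- Memory at the start of a computation.  Integer array `0` holds the number of machines, the
number of past jobs and the integer `k`; integer array `1` the machines of the past jobs; real
array `0` the speeds; real array `1` the sizes of the past jobs; real array `2` the reals `x` and
`y`.  All other cells are `0`. -/
noncomputable def input {m : ℕ} (s : Fin m → ℝ) (h : History m) (k : ℕ) (x y : ℝ) :
    RealRAM.State where
  nat
    | 0, 0 => m
    | 0, 1 => h.length
    | 0, 2 => k
    | 1, i => if hi : i < h.length then (h[i].2 : ℕ) else 0
    | _, _ => 0
  real
    | 0, i => if hi : i < m then s ⟨i, hi⟩ else 0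
    | 1, i => if hi : i < h.length then h[i].1 else 0
    | 2, 0 => x
    | 2, 1 => y
    | _, _ => 0

/-- Size of an instance: the number of machines, the number of jobs, and the absolute values of
the binary logarithms of all speeds and sizes. -/
noncomputable def inputSize {m : ℕ} (s : Fin m → ℝ) (ps : List ℝ) : ℝ :=
  1 + m + ps.length + ∑ i, |Real.logb 2 (s i)| + (ps.map fun p => |Real.logb 2 p|).sum

/-- A family of mechanisms, one for each number of machines, runs in polynomial time: there are
three programs, the same for all numbers of machines and jobs, which compute from the reported
data and the past (and the seed) the machine to which the current job is assigned, the fee of the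
current job, and the payments to all machines, in a number of steps polynomial in the input
size. -/
def PolynomialTime (M : ∀ (m : ℕ) [NeZero m], Mechanism m) : Prop :=
  ∃ (cAssign cFee cPay : RealRAM.Prog) (d : ℕ), ∀ (m : ℕ) [NeZero m],
    ∀ s : Fin m → ℝ, (∀ i, 0 < s i) → ∀ h : History m, (∀ x ∈ h, 0 < x.1) →
      (∀ p : ℝ, 0 < p → ∀ u ∈ Set.Icc (0 : ℝ) 1, ∃ (t : ℕ) (τ : RealRAM.State),
        RealRAM.Runs cAssign (input s h 0 p u) t τ ∧
        τ.nat 0 0 = ((M m).assign s h p u : ℕ) ∧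
        (t : ℝ) ≤ d * inputSize s (p :: h.map Prod.fst) ^ d) ∧
      (∀ p : ℝ, 0 < p → ∀ i : Fin m, ∃ (t : ℕ) (τ : RealRAM.State),
        RealRAM.Runs cFee (input s h i p 0) t τ ∧
        τ.real 0 0 = (M m).fee s h p i ∧
        (t : ℝ) ≤ d * inputSize s (p :: h.map Prod.fst) ^ d) ∧
      (∃ (t : ℕ) (τ : RealRAM.State),
        RealRAM.Runs cPay (input s h 0 0 0) t τ ∧
        (∀ i : Fin m, τ.real 0 i = (M m).pay s h i) ∧
        (t : ℝ) ≤ d * inputSize s (h.map Prod.fst) ^ d)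

/-- The ratio `m ^ ((1/q) (1 - 1/q)) * (log m) ^ (1 + 1/q ^ 2)`, with `1/q = 0` for `q = ∞`. -/
noncomputable def ratio (q : ℝ≥0∞) (m : ℕ) : ℝ :=
  (m : ℝ) ^ ((q⁻¹).toReal * (1 - (q⁻¹).toReal)) * Real.log m ^ (1 + (q⁻¹).toReal ^ 2)

end Scheduling

namespace Scheduling

open Finset

/-! ## Powers of two -/

/-! Write v = 1/q and, for q > 1, let α be the exponent conjugate to q. Speeds a_i and sizes are
rounded down to powers of two. The mechanism estimates OPT by the `level` T: the least power of two
such that, for every size x of an arrived job, the jobs of size at least x have total size at most T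
times the ℓ_α norm of the speeds of those machines that can process x within time T. Hölder's
inequality, applied to any assignment, gives T = O(OPT) (`level_le_objective`). A new job goes to a
machine that is fast enough at the current level and within a factor m of the fastest one, with
probability proportional to a_i^α.

Truthfulness is monotonicity plus critical-value pricing. Changing a speed or a size by a factor two
moves the level by at most a factor two. Hence a machine that doubles its speed gains in its share
of every job (`share_le_share_double`), and a job that doubles its size moves to machines that are
faster on average (`sum_share_double_le`). The prices are sums over powers of two up to the report
(`signedSum`), so expected cost, as a function of the reported exponent, decreases up to the true
exponent and increases after it.

For competitiveness, the machines open to a job are all those above a speed threshold, and only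
about Λ = log₂ m + 1 thresholds occur (`exists_class`). Levels grow geometrically and every level is
feasible, so the jobs of one class have volume O(T V^(1/α)), where V is the total weight of the
class's machines (`sum_class_le`). Summing over classes, the expected completion time of machine i
is O(T Λ ρ_i^v), with ρ_i = `relWeight` at most 1 and of total at most Λ. So each expected
completion time is O(TΛ), and by Jensen their sum is O(T m^(1-v) Λ^(1+v)). After division by twice
the level and the speed, one job adds at most 1 to a completion time, so exponential moments
(`expect_exp_le`) carry both bounds over to the random loads. Interpolating, ‖x‖_q ≤ max^(1-v) ·
sum^v (`norm_toLp_le`), yields m^(v(1-v)) Λ^(1+v²).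

For q = 1 the conjugate exponent is infinite. There only machines of maximal rounded speed are used,
and the objective is within a factor 2 of the optimum for every outcome of positive probability.

Polynomial time is shown by a small Hoare logic for the real RAM: every loop has an exact iteration
count bounded by the input size, and memory is layered by array number so that subroutines leave
lower-numbered arrays alone. -/

/-- Integer powers of two. -/
def IsDyadic (x : ℝ) : Prop := ∃ k : ℤ, x = 2 ^ k

/-- The largest power of two that is at most `x`, for `x > 0`. -/
noncomputable def dyadicFloor (x : ℝ) : ℝ := 2 ^ Int.log 2 x

lemma isDyadic_zpow (k : ℤ) : IsDyadic (2 ^ k) := ⟨k, rfl⟩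

lemma isDyadic_dyadicFloor (x : ℝ) : IsDyadic (dyadicFloor x) := ⟨_, rfl⟩

lemma dyadicFloor_le {x : ℝ} (hx : 0 < x) : dyadicFloor x ≤ x := by
  simpa [dyadicFloor] using Int.zpow_log_le_self (b := 2) one_lt_two hx

lemma lt_two_mul_dyadicFloor (x : ℝ) : x < 2 * dyadicFloor x := by
  have h := Int.lt_zpow_succ_log_self (b := 2) one_lt_two x
  rw [dyadicFloor, ← zpow_one_add₀ two_ne_zero, add_comm]
  simpa using h

namespace IsDyadic

variable {x y : ℝ}

lemma pos (hx : IsDyadic x) : 0 < x := by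
  obtain ⟨k, rfl⟩ := hx; positivity

/-- The gain from rounding: a strict inequality between powers of two is already a factor two, which
is the resolution at which levels and reports are compared. -/
lemma two_mul_le (hx : IsDyadic x) (hy : IsDyadic y) (h : x < y) : 2 * x ≤ y := by
  obtain ⟨k, rfl⟩ := hx
  obtain ⟨l, rfl⟩ := hy
  have hkl : k < l := (zpow_lt_zpow_iff_right₀ one_lt_two).1 h
  rw [← zpow_one_add₀ two_ne_zero]
  exact zpow_le_zpow_right₀ one_le_two (by omega)

lemma mul (hx : IsDyadic x) (hy : IsDyadic y) : IsDyadic (x * y) := by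
  obtain ⟨k, rfl⟩ := hx
  obtain ⟨l, rfl⟩ := hy
  exact ⟨k + l, (zpow_add₀ two_ne_zero _ _).symm⟩

lemma div (hx : IsDyadic x) (hy : IsDyadic y) : IsDyadic (x / y) := by
  obtain ⟨k, rfl⟩ := hx
  obtain ⟨l, rfl⟩ := hy
  exact ⟨k - l, (zpow_sub₀ two_ne_zero _ _).symm⟩

lemma two_mul (hx : IsDyadic x) : IsDyadic (2 * x) :=
  IsDyadic.mul ⟨1, by simp⟩ hx

end IsDyadic

/-! ## Running maxima -/

/-- Maximum of `0` and the first `n` values of `f`. -/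
noncomputable def runMax (f : ℕ → ℝ) : ℕ → ℝ
  | 0 => 0
  | n + 1 => max (runMax f n) (f n)

lemma le_runMax {f : ℕ → ℝ} {n k : ℕ} (hk : k < n) : f k ≤ runMax f n := by
  induction n with
  | zero => omega
  | succ n ih =>
    rcases Nat.lt_succ_iff_lt_or_eq.1 hk with h | rfl
    · exact (ih h).trans (le_max_left _ _)
    · exact le_max_right _ _

lemma runMax_le {f : ℕ → ℝ} {n : ℕ} {B : ℝ} (hB : 0 ≤ B) (h : ∀ k < n, f k ≤ B) :
    runMax f n ≤ B := by
  induction n with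
  | zero => exact hB
  | succ n ih => exact max_le (ih fun k hk => h k (by omega)) (h n (by omega))

lemma exists_runMax_eq {f : ℕ → ℝ} {n : ℕ} (hn : 0 < n) (h : ∀ k < n, 0 < f k) :
    ∃ k < n, runMax f n = f k := by
  induction n with
  | zero => omega
  | succ n ih =>
    rcases Nat.eq_zero_or_pos n with rfl | hn'
    · exact ⟨0, by omega, max_eq_right (h 0 (by omega)).le⟩
    · obtain ⟨k, hk, e⟩ := ih hn' fun k hk => h k (by omega)
      rcases le_total (runMax f n) (f n) with hle | hle
      · exact ⟨n, by omega, max_eq_right hle⟩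
      · exact ⟨k, by omega, (max_eq_left hle).trans e⟩

lemma runMax_congr {f g : ℕ → ℝ} {n : ℕ} (h : ∀ k < n, f k = g k) : runMax f n = runMax g n := by
  induction n with
  | zero => rfl
  | succ n ih => simp only [runMax]; rw [ih fun k hk => h k (by omega), h n (by omega)]

/-! ## The load level -/

/-- Sum of `a i ^ α` over the machines that process a job of size `x` within time `T`. -/
noncomputable def capacity (α : ℝ) (a : ℕ → ℝ) (m : ℕ) (T x : ℝ) : ℝ :=
  ∑ i ∈ range m, if x ≤ a i * T then a i ^ α else 0

/-- The level `T` passes the volume test for the first `n` jobs: for every size, the jobs of at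
least that size fit, as a whole, on the machines that are fast enough for it. -/
def Feasible (α : ℝ) (a : ℕ → ℝ) (m : ℕ) (P : ℕ → ℝ) (n : ℕ) (T : ℝ) : Prop :=
  ∀ l < n, ∑ k ∈ range n, (if P l ≤ P k then P k else 0) ≤ T * capacity α a m T (P l) ^ α⁻¹

open Classical in
/-- The level is doubled until it is feasible. -/
noncomputable def raise (α : ℝ) (a : ℕ → ℝ) (m : ℕ) (P : ℕ → ℝ) (n : ℕ) (T : ℝ) : ℝ :=
  if Feasible α a m P n T then T else 2 * T

/-- The least feasible power of two. -/
noncomputable def level (α : ℝ) (a : ℕ → ℝ) (m : ℕ) (P : ℕ → ℝ) (n : ℕ) : ℝ :=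
  (raise α a m P n)^[n] (runMax P n / runMax a m)

section Level

variable {α : ℝ} {a a' : ℕ → ℝ} {m : ℕ} {P P' : ℕ → ℝ} {n : ℕ} {T T' : ℝ}

lemma capacity_nonneg (ha : ∀ i < m, 0 ≤ a i) (T x : ℝ) : 0 ≤ capacity α a m T x := by
  refine sum_nonneg fun i hi => ?_
  split_ifs
  · exact Real.rpow_nonneg (ha i (mem_range.1 hi)) _
  · exact le_rfl

lemma capacity_anti (ha : ∀ i < m, 0 ≤ a i) {x y : ℝ} (h : x ≤ y) :
    capacity α a m T y ≤ capacity α a m T x := by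
  refine sum_le_sum fun i hi => ?_
  split_ifs with h1 h2
  · exact le_rfl
  · exact absurd (h.trans h1) h2
  · exact Real.rpow_nonneg (ha i (mem_range.1 hi)) _
  · exact le_rfl

/-- In a feasible level, jobs of at least any given size fit on the machines fast enough. -/
lemma Feasible.sum_le (hα : 0 < α) (ha : ∀ i < m, 0 ≤ a i) (hT : 0 ≤ T)
    (h : Feasible α a m P n T) (x : ℝ) :
    ∑ k ∈ range n, (if x ≤ P k then P k else 0) ≤ T * capacity α a m T x ^ α⁻¹ := by
  by_cases hx : ∃ l < n, x ≤ P l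
  · have hne : ((range n).filter fun l => x ≤ P l).Nonempty := by
      obtain ⟨l, hl, hxl⟩ := hx
      exact ⟨l, by simp [hl, hxl]⟩
    obtain ⟨l, hl, hmin⟩ := exists_min_image _ P hne
    simp only [mem_filter, mem_range] at hl hmin
    have e : ∑ k ∈ range n, (if x ≤ P k then P k else 0)
        = ∑ k ∈ range n, (if P l ≤ P k then P k else 0) := by
      refine sum_congr rfl fun k hk => ?_
      have : x ≤ P k ↔ P l ≤ P k :=
        ⟨fun hk' => hmin k ⟨mem_range.1 hk, hk'⟩, fun hk' => hl.2.trans hk'⟩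
      simp only [this]
    rw [e]
    refine (h l hl.1).trans (mul_le_mul_of_nonneg_left ?_ hT)
    exact Real.rpow_le_rpow (capacity_nonneg ha _ _) (capacity_anti ha hl.2)
      (inv_nonneg.2 hα.le)
  · push Not at hx
    rw [sum_eq_zero fun k hk => if_neg (not_le.2 (hx k (mem_range.1 hk)))]
    exact mul_nonneg hT (Real.rpow_nonneg (capacity_nonneg ha _ _) _)

/-- If sizes grow by at most c and speeds shrink by at most d, time stretched by cd absorbs both:
every machine that was fast enough still is, and capacities lose at most d^α, hence d after the
power α⁻¹. With factors 1 and 2 this bounds how far one changed report can move the level. -/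
lemma Feasible.scale (hα : 0 < α) (ha : ∀ i < m, 0 ≤ a i) (ha' : ∀ i < m, 0 ≤ a' i)
    (hP : ∀ k < n, 0 ≤ P k) (hT : 0 ≤ T) {c d : ℝ} (hc : 0 < c) (hd : 0 < d)
    (hPP : ∀ k < n, P' k ≤ c * P k) (haa : ∀ i < m, a i ≤ d * a' i)
    (h : Feasible α a m P n T) : Feasible α a' m P' n (c * d * T) := by
  intro l hl
  have hcap : capacity α a m T (P' l / c) ≤ d ^ α * capacity α a' m (c * d * T) (P' l) := by
    unfold capacity
    rw [mul_sum]
    refine sum_le_sum fun i hi => ?_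
    have hi := mem_range.1 hi
    split_ifs with h1 h2
    · rw [← Real.mul_rpow hd.le (ha' i hi)]
      exact Real.rpow_le_rpow (ha i hi) (haa i hi) hα.le
    · refine absurd ?_ h2
      rw [div_le_iff₀ hc] at h1
      have := mul_le_mul_of_nonneg_right (haa i hi) (mul_nonneg hT hc.le)
      nlinarith
    · exact mul_nonneg (Real.rpow_nonneg hd.le _) (Real.rpow_nonneg (ha' i hi) _)
    · simp
  calc ∑ k ∈ range n, (if P' l ≤ P' k then P' k else 0)
      ≤ ∑ k ∈ range n, c * (if P' l / c ≤ P k then P k else 0) := by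
        refine sum_le_sum fun k hk => ?_
        have hk := mem_range.1 hk
        split_ifs with h1 h2
        · exact hPP k hk
        · refine absurd ?_ h2
          rw [div_le_iff₀ hc, mul_comm]
          exact h1.trans (hPP k hk)
        · exact mul_nonneg hc.le (hP k hk)
        · simp
    _ = c * ∑ k ∈ range n, (if P' l / c ≤ P k then P k else 0) := (mul_sum _ _ _).symm
    _ ≤ c * (T * capacity α a m T (P' l / c) ^ α⁻¹) :=
        mul_le_mul_of_nonneg_left (h.sum_le hα ha hT _) hc.le
    _ ≤ c * (T * (d ^ α * capacity α a' m (c * d * T) (P' l)) ^ α⁻¹) := by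
        gcongr
        exact capacity_nonneg ha _ _
    _ = c * d * T * capacity α a' m (c * d * T) (P' l) ^ α⁻¹ := by
        rw [Real.mul_rpow (Real.rpow_nonneg hd.le _) (capacity_nonneg ha' _ _),
          Real.rpow_rpow_inv hd.le hα.ne']
        ring

lemma Feasible.mono_jobs (hP : ∀ k < n, 0 ≤ P k) {n' : ℕ} (hn : n' ≤ n)
    (h : Feasible α a m P n T) : Feasible α a m P n' T := by
  intro l hl
  refine le_trans ?_ (h l (hl.trans_le hn))
  refine sum_le_sum_of_subset_of_nonneg (range_subset_range.2 hn) fun k hk _ => ?_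
  split_ifs
  · exact hP k (mem_range.1 hk)
  · exact le_rfl

variable (hα : 0 < α) (ha : ∀ i < m, IsDyadic (a i)) (hP : ∀ k < n, IsDyadic (P k))
  (hm : 0 < m) (hn : 0 < n)

lemma isDyadic_runMax (ha : ∀ i < m, IsDyadic (a i)) (hm : 0 < m) : IsDyadic (runMax a m) := by
  obtain ⟨i, hi, e⟩ := exists_runMax_eq hm fun i hi => (ha i hi).pos
  exact e ▸ ha i hi

include hα ha hP hm hn

/-- Below this value even the fastest machine is too slow for the largest job, so its capacity is 0
and the volume test fails. The doubling search may therefore start here. -/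
lemma Feasible.base_le (hT : 0 ≤ T) (h : Feasible α a m P n T) : runMax P n / runMax a m ≤ T := by
  obtain ⟨l, hl, e⟩ := exists_runMax_eq hn fun k hk => (hP k hk).pos
  rw [div_le_iff₀ (isDyadic_runMax ha hm).pos, e]
  by_contra! hlt
  have hcap : capacity α a m T (P l) = 0 := by
    refine sum_eq_zero fun i hi => if_neg ?_
    have : a i * T ≤ runMax a m * T :=
      mul_le_mul_of_nonneg_right (le_runMax (mem_range.1 hi)) hT
    linarith
  have h1 := h l hl
  rw [hcap, Real.zero_rpow (inv_ne_zero hα.ne'), mul_zero] at h1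
  have h2 : P l ≤ ∑ k ∈ range n, (if P l ≤ P k then P k else 0) := by
    refine le_trans (by simp) (single_le_sum (f := fun k => if P l ≤ P k then P k else 0)
      (fun k hk => ?_) (mem_range.2 hl))
    split_ifs
    · exact (hP k (mem_range.1 hk)).pos.le
    · exact le_rfl
  exact absurd (h2.trans h1) (not_le.2 (hP l hl).pos)

/-- The fastest machine alone can take n jobs of maximal size, since n ≤ 2^n. So n doublings always
suffice, and the search needs no more iterations than there are jobs. -/
lemma feasible_base_mul : Feasible α a m P n (runMax P n / runMax a m * 2 ^ n) := by
  have hA := isDyadic_runMax ha hm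
  have hQ := isDyadic_runMax hP hn
  intro l hl
  obtain ⟨i, hi, e⟩ := exists_runMax_eq hm fun i hi => (ha i hi).pos
  have h1 : ∑ k ∈ range n, (if P l ≤ P k then P k else 0) ≤ 2 ^ n * runMax P n := by
    calc ∑ k ∈ range n, (if P l ≤ P k then P k else 0)
        ≤ ∑ k ∈ range n, runMax P n := by
          refine sum_le_sum fun k hk => ?_
          split_ifs
          · exact le_runMax (mem_range.1 hk)
          · exact hQ.pos.le
      _ = n * runMax P n := by simp
      _ ≤ 2 ^ n * runMax P n := by
          refine mul_le_mul_of_nonneg_right ?_ hQ.pos.le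
          exact_mod_cast (Nat.lt_two_pow_self).le
  set T := runMax P n / runMax a m * 2 ^ n with hT
  have hTa : runMax a m * T = 2 ^ n * runMax P n := by
    rw [hT]; field_simp [hA.pos.ne']
  have h2 : runMax a m ^ α ≤ capacity α a m T (P l) := by
    rw [e]
    refine le_trans (le_of_eq ?_) (single_le_sum
      (f := fun i => if P l ≤ a i * T then a i ^ α else 0) (fun k hk => ?_) (mem_range.2 hi))
    · rw [if_pos]
      rw [← e, hTa]
      exact (le_runMax hl).trans (le_mul_of_one_le_left hQ.pos.le (one_le_pow₀ one_le_two))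
    · split_ifs
      · exact Real.rpow_nonneg (ha k (mem_range.1 hk)).pos.le _
      · exact le_rfl
  have h3 : runMax a m ≤ capacity α a m T (P l) ^ α⁻¹ := by
    rw [← Real.rpow_rpow_inv hA.pos.le hα.ne']
    exact Real.rpow_le_rpow (Real.rpow_nonneg hA.pos.le _) h2 (inv_nonneg.2 hα.le)
  refine h1.trans (hTa.symm.le.trans ?_)
  rw [mul_comm]
  refine mul_le_mul_of_nonneg_left h3 ?_
  have := hA.pos; have := hQ.pos
  positivity

/-- `level` is the least feasible power of two. -/
lemma level_spec : IsDyadic (level α a m P n) ∧ Feasible α a m P n (level α a m P n) ∧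
    ∀ T', IsDyadic T' → Feasible α a m P n T' → level α a m P n ≤ T' := by
  have ha0 : ∀ i < m, 0 ≤ a i := fun i hi => (ha i hi).pos.le
  have hP0 : ∀ i < n, 0 ≤ P i := fun i hi => (hP i hi).pos.le
  -- After k rounds the search has either stopped at a feasible value or doubled every time, and it
  -- never passes a feasible power of two: such a power differs from an infeasible U, so it is at
  -- least 2U.
  have key : ∀ k : ℕ, IsDyadic ((raise α a m P n)^[k] (runMax P n / runMax a m)) ∧
      (Feasible α a m P n ((raise α a m P n)^[k] (runMax P n / runMax a m)) ∨
        (raise α a m P n)^[k] (runMax P n / runMax a m) = runMax P n / runMax a m * 2 ^ k) ∧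
      ∀ T', IsDyadic T' → Feasible α a m P n T' →
        (raise α a m P n)^[k] (runMax P n / runMax a m) ≤ T' := by
    intro k
    induction k with
    | zero =>
      refine ⟨(isDyadic_runMax hP hn).div (isDyadic_runMax ha hm), Or.inr (by simp), ?_⟩
      intro T' hT' hf
      exact hf.base_le hα ha hP hm hn hT'.pos.le
    | succ k ih =>
      rw [Function.iterate_succ_apply']
      set U := (raise α a m P n)^[k] (runMax P n / runMax a m)
      obtain ⟨h1, h2, h3⟩ := ih
      by_cases hf : Feasible α a m P n U
      · simp only [raise, if_pos hf]
        exact ⟨h1, Or.inl hf, h3⟩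
      · simp only [raise, if_neg hf]
        refine ⟨h1.two_mul, Or.inr ?_, fun T' hT' hf' => h1.two_mul_le hT' ?_⟩
        · rw [h2.resolve_left hf, pow_succ]; ring
        · refine lt_of_le_of_ne (h3 T' hT' hf') fun e => hf (e ▸ hf')
  obtain ⟨h1, h2, h3⟩ := key n
  refine ⟨h1, ?_, h3⟩
  rcases h2 with h2 | h2
  · exact h2
  · change Feasible α a m P n ((raise α a m P n)^[n] _)
    rw [h2]
    exact feasible_base_mul hα ha hP hm hn

lemma isDyadic_level : IsDyadic (level α a m P n) := (level_spec hα ha hP hm hn).1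

lemma feasible_level : Feasible α a m P n (level α a m P n) := (level_spec hα ha hP hm hn).2.1

lemma level_le (hT : IsDyadic T) (h : Feasible α a m P n T) : level α a m P n ≤ T :=
  (level_spec hα ha hP hm hn).2.2 T hT h

lemma size_le_max_mul_level {k : ℕ} (hk : k < n) : P k ≤ runMax a m * level α a m P n := by
  have h := (feasible_level hα ha hP hm hn).base_le hα ha hP hm hn
    (isDyadic_level hα ha hP hm hn).pos.le
  rw [div_le_iff₀' (isDyadic_runMax ha hm).pos] at h
  exact (le_runMax hk).trans h

end Level

/-! ## Assignment probabilities -/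

open Classical in
/-- Unnormalised probability of machine `i` for job `j`: the machine must be fast enough for the
job at the current level, and must not be slower than the fastest machine by a factor of more
than `κ`. -/
noncomputable def weight (α κ : ℝ) (a : ℕ → ℝ) (m : ℕ) (P : ℕ → ℝ) (j i : ℕ) : ℝ :=
  if P j ≤ a i * level α a m P (j + 1) ∧ runMax a m ≤ κ * a i then a i ^ α else 0

/-- Sum of the weights of all machines. -/
noncomputable def totalWeight (α κ : ℝ) (a : ℕ → ℝ) (m : ℕ) (P : ℕ → ℝ) (j : ℕ) : ℝ :=
  ∑ i ∈ range m, weight α κ a m P j i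

/-- Probability that job `j` is assigned to machine `i`. -/
noncomputable def share (α κ : ℝ) (a : ℕ → ℝ) (m : ℕ) (P : ℕ → ℝ) (j i : ℕ) : ℝ :=
  weight α κ a m P j i / totalWeight α κ a m P j

/-! ### Dependence on the relevant array entries only -/

section Congr

variable {α κ : ℝ} {a a' : ℕ → ℝ} {m : ℕ} {P P' : ℕ → ℝ} {n : ℕ}

/-- Arrays are functions on ℕ, but only the first m speeds and n sizes matter. The congruences from
here on exchange a partial history for the full list of sizes, and machine memory for the
mathematical arrays. -/
lemma feasible_congr (ha : ∀ i < m, a i = a' i) (hP : ∀ k < n, P k = P' k) (T : ℝ) :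
    Feasible α a m P n T ↔ Feasible α a' m P' n T := by
  have hcap : ∀ x, capacity α a m T x = capacity α a' m T x := fun x =>
    sum_congr rfl fun i hi => by rw [ha i (mem_range.1 hi)]
  refine forall₂_congr fun l hl => ?_
  rw [hcap, hP l hl]
  have : ∑ k ∈ range n, (if P' l ≤ P k then P k else 0)
      = ∑ k ∈ range n, (if P' l ≤ P' k then P' k else 0) :=
    sum_congr rfl fun k hk => by rw [hP k (mem_range.1 hk)]
  rw [this]

lemma level_congr (ha : ∀ i < m, a i = a' i) (hP : ∀ k < n, P k = P' k) :
    level α a m P n = level α a' m P' n := by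
  have : raise α a m P n = raise α a' m P' n := by
    funext T
    by_cases h : Feasible α a m P n T
    · rw [raise, raise, if_pos h, if_pos ((feasible_congr ha hP T).1 h)]
    · rw [raise, raise, if_neg h, if_neg (mt (feasible_congr ha hP T).2 h)]
  rw [level, level, this, runMax_congr ha, runMax_congr hP]

lemma weight_congr (ha : ∀ i < m, a i = a' i) (hP : ∀ k < n + 1, P k = P' k) {i : ℕ}
    (hi : i < m) : weight α κ a m P n i = weight α κ a' m P' n i := by
  rw [weight, weight, level_congr ha hP, ha i hi, hP n (by omega), runMax_congr ha]

lemma totalWeight_congr (ha : ∀ i < m, a i = a' i) (hP : ∀ k < n + 1, P k = P' k) :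
    totalWeight α κ a m P n = totalWeight α κ a' m P' n :=
  sum_congr rfl fun _ hi => weight_congr ha hP (mem_range.1 hi)

lemma share_congr (ha : ∀ i < m, a i = a' i) (hP : ∀ k < n + 1, P k = P' k) {i : ℕ}
    (hi : i < m) : share α κ a m P n i = share α κ a' m P' n i := by
  rw [share, share, weight_congr ha hP hi, totalWeight_congr ha hP]

end Congr

/-! ### Monotonicity of the assignment probabilities -/

section Share

variable {α κ : ℝ} {a : ℕ → ℝ} {m : ℕ} {P : ℕ → ℝ} {j : ℕ}

lemma weight_nonneg (ha : ∀ i < m, IsDyadic (a i)) {i : ℕ} (hi : i < m) :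
    0 ≤ weight α κ a m P j i := by
  unfold weight
  split_ifs
  · exact Real.rpow_nonneg (ha i hi).pos.le _
  · exact le_rfl

lemma weight_pos_iff (ha : ∀ i < m, IsDyadic (a i)) {i : ℕ} (hi : i < m) :
    0 < weight α κ a m P j i ↔
      P j ≤ a i * level α a m P (j + 1) ∧ runMax a m ≤ κ * a i := by
  unfold weight
  split_ifs with h
  · exact ⟨fun _ => h, fun _ => Real.rpow_pos_of_pos (ha i hi).pos _⟩
  · simp [h]

lemma weight_eq_of_pos {i : ℕ} (h : 0 < weight α κ a m P j i) :
    weight α κ a m P j i = a i ^ α := by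
  unfold weight at h ⊢
  split_ifs at h ⊢
  · rfl
  · exact absurd h (lt_irrefl _)

variable (hα : 0 < α) (hκ : 1 ≤ κ) (ha : ∀ i < m, IsDyadic (a i))
  (hP : ∀ k < j + 1, IsDyadic (P k)) (hm : 0 < m)

include hα hκ ha hP hm

/-- The fastest machine is always admissible: feasibility of the level makes it fast enough for the
job, and κ ≥ 1 keeps it inside the speed window. -/
lemma totalWeight_pos : 0 < totalWeight α κ a m P j := by
  obtain ⟨i, hi, e⟩ := exists_runMax_eq hm fun i hi => (ha i hi).pos
  refine lt_of_lt_of_le ((weight_pos_iff ha hi).2 ⟨?_, ?_⟩)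
    (single_le_sum (f := fun i => weight α κ a m P j i)
      (fun k hk => weight_nonneg ha (mem_range.1 hk)) (mem_range.2 hi))
  · rw [← e]
    exact size_le_max_mul_level hα ha hP hm (Nat.succ_pos j) (Nat.lt_succ_self j)
  · rw [e]
    exact le_mul_of_one_le_left (ha i hi).pos.le hκ

lemma share_nonneg {i : ℕ} (hi : i < m) : 0 ≤ share α κ a m P j i :=
  div_nonneg (weight_nonneg ha hi) (totalWeight_pos hα hκ ha hP hm).le

lemma sum_share : ∑ i ∈ range m, share α κ a m P j i = 1 := by
  simp only [share]
  rw [← sum_div]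
  exact div_self (totalWeight_pos hα hκ ha hP hm).ne'

lemma share_pos_iff {i : ℕ} (hi : i < m) : 0 < share α κ a m P j i ↔
      P j ≤ a i * level α a m P (j + 1) ∧ runMax a m ≤ κ * a i := by
  rw [← weight_pos_iff ha hi, share, div_pos_iff_of_pos_right (totalWeight_pos hα hκ ha hP hm)]

/-- A machine that becomes twice as fast receives every job with at least the same probability. -/
lemma share_le_share_double {a' : ℕ → ℝ} {i : ℕ} (hi : i < m) (hai : a' i = 2 * a i)
    (hak : ∀ k, k ≠ i → a' k = a k) : share α κ a m P j i ≤ share α κ a' m P j i := by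
  have ha' : ∀ k < m, IsDyadic (a' k) := by
    intro k hk
    by_cases h : k = i
    · subst h; rw [hai]; exact (ha k hk).two_mul
    · rw [hak k h]; exact ha k hk
  have hle : ∀ k < m, a k ≤ a' k := by
    intro k hk
    by_cases h : k = i
    · subst h; rw [hai]; linarith [(ha k hk).pos]
    · rw [hak k h]
  have hle2 : ∀ k < m, a' k ≤ 2 * a k := by
    intro k hk
    by_cases h : k = i
    · subst h; rw [hai]
    · rw [hak k h]; linarith [(ha k hk).pos]
  have ha0 : ∀ k < m, 0 ≤ a k := fun k hk => (ha k hk).pos.le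
  have ha0' : ∀ k < m, 0 ≤ a' k := fun k hk => (ha' k hk).pos.le
  have hP0 : ∀ k < j + 1, 0 ≤ P k := fun k hk => (hP k hk).pos.le
  have hW := totalWeight_pos hα hκ ha hP hm
  have hW' := totalWeight_pos hα hκ ha' hP hm
  by_cases hs : 0 < weight α κ a m P j i
  swap
  · have : weight α κ a m P j i = 0 := le_antisymm (not_lt.1 hs) (weight_nonneg ha hi)
    rw [share, this, zero_div]
    exact share_nonneg hα hκ ha' hP hm hi
  have hn := Nat.succ_pos j
  set T := level α a m P (j + 1) with hT
  set T' := level α a' m P (j + 1) with hT'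
  have hTd : IsDyadic T := isDyadic_level hα ha hP hm hn
  have hTd' : IsDyadic T' := isDyadic_level hα ha' hP hm hn
  -- Both inequalities follow from minimality of the level: the faster machine can only lower it,
  -- and by at most a factor two.
  have h1 : T' ≤ T := by
    refine level_le hα ha' hP hm hn hTd ?_
    have := (feasible_level hα ha hP hm hn).scale hα ha0 ha0' hP0 hTd.pos.le one_pos one_pos
      (P' := P) (fun k _ => (one_mul _).ge) (fun k hk => by rw [one_mul]; exact hle k hk)
    simpa using this
  have h2 : T ≤ 2 * T' := by
    refine level_le hα ha hP hm hn hTd'.two_mul ?_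
    have := (feasible_level hα ha' hP hm hn).scale hα ha0' ha0 hP0 hTd'.pos.le one_pos two_pos
      (P' := P) (fun k _ => (one_mul _).ge) hle2
    simpa using this
  have hmax : runMax a m ≤ runMax a' m :=
    runMax_le (isDyadic_runMax ha' hm).pos.le fun k hk => (hle k hk).trans (le_runMax hk)
  obtain ⟨hs1, hs2⟩ := (weight_pos_iff ha hi).1 hs
  -- The doubled speed compensates for the level, which at most halves, so machine i stays
  -- admissible.
  have hpos' : 0 < weight α κ a' m P j i := by
    refine (weight_pos_iff ha' hi).2 ⟨?_, ?_⟩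
    · rw [hai]
      have := mul_le_mul_of_nonneg_left h2 (ha0 i hi)
      linarith
    · refine runMax_le (mul_nonneg (by linarith) (ha0' i hi)) fun k hk => ?_
      by_cases h : k = i
      · subst h; exact le_mul_of_one_le_left (ha0' k hk) hκ
      · rw [hak k h, hai]
        have := (le_runMax hk).trans hs2
        have h0 : 0 ≤ κ * a i := mul_nonneg (by linarith) (ha0 i hi)
        linarith
  have hwi : weight α κ a m P j i ≤ weight α κ a' m P j i := by
    rw [weight_eq_of_pos hs, weight_eq_of_pos hpos']
    exact Real.rpow_le_rpow (ha0 i hi) (hle i hi) hα.le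
  -- For the other machines the level has not risen and the maximal speed has not fallen, so they
  -- can only drop out; those that stay keep their weight.
  have hwk : ∀ k ∈ (range m).erase i, weight α κ a' m P j k ≤ weight α κ a m P j k := by
    intro k hk
    obtain ⟨hki, hk⟩ := mem_erase.1 hk
    have hk := mem_range.1 hk
    by_cases h0 : 0 < weight α κ a' m P j k
    swap
    · exact (not_lt.1 h0).trans (weight_nonneg ha hk)
    obtain ⟨h3, h4⟩ := (weight_pos_iff ha' hk).1 h0
    have h5 : 0 < weight α κ a m P j k := by
      refine (weight_pos_iff ha hk).2 ⟨?_, ?_⟩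
      · rw [← hak k hki]
        exact h3.trans (mul_le_mul_of_nonneg_left h1 (ha0' k hk))
      · rw [← hak k hki]
        exact hmax.trans h4
    rw [weight_eq_of_pos h0, weight_eq_of_pos h5, hak k hki]
  have hsum := sum_le_sum hwk
  have e1 : totalWeight α κ a m P j
      = weight α κ a m P j i + ∑ k ∈ (range m).erase i, weight α κ a m P j k :=
    (add_sum_erase _ _ (mem_range.2 hi)).symm
  have e2 : totalWeight α κ a' m P j
      = weight α κ a' m P j i + ∑ k ∈ (range m).erase i, weight α κ a' m P j k :=
    (add_sum_erase _ _ (mem_range.2 hi)).symm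
  have h6 : 0 ≤ ∑ k ∈ (range m).erase i, weight α κ a m P j k :=
    sum_nonneg fun k hk => weight_nonneg ha (mem_range.1 (mem_erase.1 hk).2)
  rw [share, share, div_le_div_iff₀ hW hW', e1, e2]
  nlinarith

/-- A job of twice the size receives machines that are faster on average. -/
lemma sum_share_double_le {P' : ℕ → ℝ} (hPj : P' j = 2 * P j) (hPk : ∀ k, k < j → P' k = P k)
    {b : ℕ → ℝ} (hb : ∀ i < m, ∀ k < m, 2 * a k ≤ a i → b i ≤ b k) :
    ∑ i ∈ range m, share α κ a m P' j i * b i ≤ ∑ i ∈ range m, share α κ a m P j i * b i := by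
  have hP' : ∀ k < j + 1, IsDyadic (P' k) := by
    intro k hk
    by_cases h : k = j
    · subst h; rw [hPj]; exact (hP k hk).two_mul
    · rw [hPk k (by omega)]; exact hP k hk
  have hle2 : ∀ k < j + 1, P' k ≤ 2 * P k := by
    intro k hk
    by_cases h : k = j
    · subst h; rw [hPj]
    · rw [hPk k (by omega)]; linarith [(hP k hk).pos]
  have ha0 : ∀ k < m, 0 ≤ a k := fun k hk => (ha k hk).pos.le
  have hn := Nat.succ_pos j
  have hW := totalWeight_pos hα hκ ha hP hm
  have hW' := totalWeight_pos hα hκ ha hP' hm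
  set T := level α a m P (j + 1) with hT
  set T' := level α a m P' (j + 1) with hT'
  have hTd : IsDyadic T := isDyadic_level hα ha hP hm hn
  have hTd' : IsDyadic T' := isDyadic_level hα ha hP' hm hn
  have h2 : T' ≤ 2 * T := by
    refine level_le hα ha hP' hm hn hTd.two_mul ?_
    have := (feasible_level hα ha hP hm hn).scale hα ha0 ha0 (fun k hk => (hP k hk).pos.le)
      hTd.pos.le two_pos one_pos (P' := P') hle2 (fun i _ => (one_mul _).ge)
    simpa using this
  -- The size doubles while the level at most doubles, so the set of admissible machines can only
  -- shrink.
  have hsub : ∀ i < m, 0 < weight α κ a m P' j i → 0 < weight α κ a m P j i := by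
    intro i hi h
    obtain ⟨h3, h4⟩ := (weight_pos_iff ha hi).1 h
    refine (weight_pos_iff ha hi).2 ⟨?_, h4⟩
    rw [hPj] at h3
    have := mul_le_mul_of_nonneg_left h2 (ha0 i hi)
    linarith
  set F := (range m).filter fun i => 0 < weight α κ a m P' j i with hF
  set G := (range m).filter fun i => ¬ 0 < weight α κ a m P' j i with hG
  set w := fun i => weight α κ a m P j i with hw
  have hF' : ∀ i ∈ F, weight α κ a m P' j i = w i := by
    intro i hi
    obtain ⟨hi, h⟩ := mem_filter.1 hi
    exact (weight_eq_of_pos h).trans (weight_eq_of_pos (hsub i (mem_range.1 hi) h)).symm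
  have hG' : ∀ i ∈ G, weight α κ a m P' j i = 0 := by
    intro i hi
    obtain ⟨hi, h⟩ := mem_filter.1 hi
    exact le_antisymm (not_lt.1 h) (weight_nonneg ha (mem_range.1 hi))
  have split : ∀ f : ℕ → ℝ, ∑ i ∈ range m, f i = ∑ i ∈ F, f i + ∑ i ∈ G, f i :=
    fun f => (sum_filter_add_sum_filter_not _ _ _).symm
  have eW' : totalWeight α κ a m P' j = ∑ i ∈ F, w i := by
    rw [totalWeight, split, sum_congr rfl hF', sum_eq_zero hG', add_zero]
  have eW : totalWeight α κ a m P j = ∑ i ∈ F, w i + ∑ i ∈ G, w i := split _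
  have eX' : ∑ i ∈ range m, share α κ a m P' j i * b i
      = (∑ i ∈ F, w i * b i) / totalWeight α κ a m P' j := by
    rw [sum_div, split, sum_eq_zero (s := G), add_zero]
    · refine sum_congr rfl fun i hi => ?_
      rw [share, hF' i hi]; ring
    · intro i hi
      rw [share, hG' i hi, zero_div, zero_mul]
  have eX : ∑ i ∈ range m, share α κ a m P j i * b i
      = (∑ i ∈ F, w i * b i + ∑ i ∈ G, w i * b i) / totalWeight α κ a m P j := by
    rw [← split fun i => w i * b i, sum_div]
    refine sum_congr rfl fun i hi => ?_
    rw [share]; ring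
  -- The machines in G that lose the job have smaller rounded speed than those in F that keep it, by
  -- a factor of at least two, so their values of `b` are no smaller. The weighted average over F is
  -- thus at most that over G, and removing G cannot raise the overall average.
  have hcross : (∑ i ∈ F, w i * b i) * ∑ k ∈ G, w k ≤ (∑ k ∈ G, w k * b k) * ∑ i ∈ F, w i := by
    rw [sum_mul_sum, sum_mul_sum, sum_comm]
    refine sum_le_sum fun k hk => sum_le_sum fun i hi => ?_
    obtain ⟨hk, hkw⟩ := mem_filter.1 hk
    obtain ⟨hi, hiw⟩ := mem_filter.1 hi
    have hk := mem_range.1 hk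
    have hi := mem_range.1 hi
    have hwi : 0 ≤ w i := weight_nonneg ha hi
    have hwk : 0 ≤ w k := weight_nonneg ha hk
    by_cases h0 : w k = 0
    · rw [h0]; simp
    have hwk' : 0 < w k := lt_of_le_of_ne hwk (Ne.symm h0)
    obtain ⟨h3, h4⟩ := (weight_pos_iff ha hi).1 hiw
    have h5 := ((weight_pos_iff ha hk).1 hwk').2
    have h6 : a k * T' < P' j := by
      by_contra! h7
      exact hkw ((weight_pos_iff ha hk).2 ⟨h7, h5⟩)
    have h7 : a k < a i := lt_of_mul_lt_mul_right (h6.trans_le h3) hTd'.pos.le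
    have h8 := hb i hi k hk ((ha k hk).two_mul_le (ha i hi) h7)
    have h9 := mul_le_mul_of_nonneg_left h8 (mul_nonneg hwi hwk)
    nlinarith
  rw [eX, eX', div_le_div_iff₀ hW' hW, eW, eW']
  nlinarith

end Share

/-! ## Summation along powers of two -/

/-- The sum of `F y` over the powers of two `y` with `1 ≤ y < 2 ^ k`, or minus the sum over those
with `2 ^ k ≤ y < 1`. -/
noncomputable def signedSum (F : ℝ → ℝ) (k : ℤ) : ℝ :=
  (if (2 : ℝ) ^ k < 1 then -1 else 1) * ∑ i ∈ range k.natAbs, F (min 1 (2 ^ k) * 2 ^ i)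

/-- The signed sum is a discrete integral based at 1, and this is its telescoping rule, valid on
both sides of 1. -/
lemma signedSum_succ (F : ℝ → ℝ) (k : ℤ) : signedSum F (k + 1) = signedSum F k + F (2 ^ k) := by
  have hlt : ∀ l : ℤ, (2 : ℝ) ^ l < 1 ↔ l < 0 := fun l => by
    rw [← zpow_zero (2 : ℝ)]; exact zpow_lt_zpow_iff_right₀ one_lt_two
  have hle : ∀ l : ℤ, (2 : ℝ) ^ l ≤ 1 ↔ l ≤ 0 := fun l => by
    rw [← zpow_zero (2 : ℝ)]; exact zpow_le_zpow_iff_right₀ one_lt_two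
  unfold signedSum
  rcases lt_or_ge k 0 with hk | hk
  · obtain ⟨n, rfl⟩ : ∃ n : ℕ, k = -(n + 1 : ℕ) := ⟨(-k).toNat - 1, by omega⟩
    have e1 : (-((n + 1 : ℕ) : ℤ) + 1) = -(n : ℤ) := by push_cast; ring
    rw [e1, if_pos ((hlt _).2 hk), min_eq_right ((hle _).2 hk.le),
      min_eq_right ((hle _).2 (by omega)), Int.natAbs_neg, Int.natAbs_neg, Int.natAbs_natCast,
      Int.natAbs_natCast, sum_range_succ' _ n, pow_zero, mul_one]
    have e2 : ∀ i : ℕ, (2 : ℝ) ^ (-((n + 1 : ℕ) : ℤ)) * 2 ^ (i + 1)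
        = 2 ^ (-(n : ℤ)) * 2 ^ i := by
      intro i
      rw [← e1, zpow_add₀ two_ne_zero, pow_succ, zpow_one]; ring
    simp only [e2]
    -- For n = 0 the new exponent is 0, where the sign has already switched to +1; this is harmless
    -- because the sum is empty.
    rcases Nat.eq_zero_or_pos n with rfl | hn
    · norm_num
    · rw [if_pos ((hlt _).2 (by omega))]; ring
  · obtain ⟨n, rfl⟩ := Int.eq_ofNat_of_zero_le hk
    rw [if_neg (by rw [hlt]; omega), if_neg (by rw [hlt]; omega),
      min_eq_left (one_le_zpow₀ one_le_two (by omega)),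
      min_eq_left (one_le_zpow₀ one_le_two (by omega))]
    have e : ((n : ℤ) + 1).natAbs = n + 1 := by omega
    rw [e, sum_range_succ, Int.natAbs_natCast]
    simp

/-- Both truthfulness proofs end here, with c the expected cost as a function of the reported
exponent and k₀ the true exponent. -/
lemma le_of_unimodal {c : ℤ → ℝ} {k₀ : ℤ} (hr : ∀ k, k₀ ≤ k → c k ≤ c (k + 1))
    (hl : ∀ k, k < k₀ → c (k + 1) ≤ c k) (k : ℤ) : c k₀ ≤ c k := by
  rcases le_total k₀ k with h | h
  · induction k, h using Int.leInduction with
    | base => exact le_rfl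
    | succ n hn ih => exact ih.trans (hr n hn)
  · induction k, h using Int.leInductionDown with
    | base => exact le_rfl
    | pred n hn ih =>
      have := hl (n - 1) (by omega)
      rw [sub_add_cancel] at this
      exact ih.trans this

/-! ## Sampling -/

/-- Index of the machine obtained by inverting the distribution function of the weights `w` at
`u`. -/
noncomputable def sampleIndex (w : ℕ → ℝ) (m : ℕ) (u : ℝ) : ℕ :=
  ∑ i ∈ range (m - 1),
    if ∑ k ∈ range (i + 1), w k ≤ u * ∑ k ∈ range m, w k then 1 else 0

lemma sampleIndex_lt (w : ℕ → ℝ) {m : ℕ} (hm : 0 < m) (u : ℝ) : sampleIndex w m u < m := by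
  have : sampleIndex w m u ≤ ∑ i ∈ range (m - 1), 1 :=
    sum_le_sum fun i _ => by split_ifs <;> omega
  simp only [sum_const, card_range, smul_eq_mul, mul_one] at this
  omega

lemma measurable_sampleIndex (w : ℕ → ℝ) (m : ℕ) : Measurable (sampleIndex w m) := by
  refine Finset.measurable_sum _ fun i _ => Measurable.ite ?_ measurable_const measurable_const
  exact measurableSet_le measurable_const (measurable_id.mul_const _)

/-- With partial sums c and total W, the index equals i exactly for u in [c_i/W, c_{i+1}/W), up to
the single point u = 1. -/
lemma volume_sampleIndex {w : ℕ → ℝ} {m : ℕ} (hw : ∀ i < m, 0 ≤ w i)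
    (hW : 0 < ∑ k ∈ range m, w k) {i : ℕ} (hi : i < m) :
    MeasureTheory.volume.real {u : ℝ | u ∈ Set.Icc 0 1 ∧ sampleIndex w m u = i}
      = w i / ∑ k ∈ range m, w k := by
  set W := ∑ k ∈ range m, w k with hWdef
  set c : ℕ → ℝ := fun i => ∑ k ∈ range i, w k with hc
  have hmono : ∀ k l, k ≤ l → l ≤ m → c k ≤ c l := fun k l hkl hl =>
    sum_le_sum_of_subset_of_nonneg (range_subset_range.2 hkl)
      fun x hx _ => hw x ((mem_range.1 hx).trans_le hl)
  have hc0 : ∀ k ≤ m, 0 ≤ c k := fun k hk => by simpa [hc] using hmono 0 k (Nat.zero_le _) hk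
  have hcm : c m = W := rfl
  have hsi : ∀ u, sampleIndex w m u
      = ∑ i ∈ range (m - 1), if c (i + 1) ≤ u * W then 1 else 0 := fun u => rfl
  have hsub1 : Set.Ico (c i / W) (c (i + 1) / W)
      ⊆ {u : ℝ | u ∈ Set.Icc 0 1 ∧ sampleIndex w m u = i} := by
    rintro u ⟨h1, h2⟩
    have h0 := div_nonneg (hc0 i hi.le) hW.le
    have h3 : c (i + 1) / W ≤ 1 := (div_le_one hW).2 (hmono _ _ hi le_rfl)
    refine ⟨⟨by linarith, by linarith⟩, ?_⟩
    rw [div_le_iff₀ hW] at h1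
    rw [lt_div_iff₀ hW] at h2
    rw [hsi]
    have : ∀ k ∈ range (m - 1), (if c (k + 1) ≤ u * W then 1 else 0)
        = if k ∈ range i then 1 else 0 := by
      intro k hk
      have hk := mem_range.1 hk
      by_cases hki : k < i
      · rw [if_pos ((hmono (k + 1) i hki hi.le).trans h1), if_pos (mem_range.2 hki)]
      · rw [if_neg (not_le.2 (h2.trans_le (hmono (i + 1) (k + 1) (by omega) (by omega)))),
          if_neg (by simpa using hki)]
    rw [sum_congr rfl this, sum_ite_mem, inter_eq_right.2 (range_subset_range.2 (by omega))]
    simp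
  -- The closed endpoint u = 1 lies in none of the half-open intervals and is added as a null set.
  have hsub2 : {u : ℝ | u ∈ Set.Icc 0 1 ∧ sampleIndex w m u = i}
      ⊆ Set.Ico (c i / W) (c (i + 1) / W) ∪ {1} := by
    rintro u ⟨⟨h0, h1⟩, hu⟩
    rcases h1.lt_or_eq with h1 | h1
    swap
    · exact Or.inr h1
    left
    rw [hsi] at hu
    constructor
    · rw [div_le_iff₀ hW]
      by_contra! hlt
      have hi0 : i ≠ 0 := by
        rintro rfl
        have : 0 ≤ u * W := mul_nonneg h0 hW.le
        simp [hc] at hlt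
        linarith
      have : ∑ k ∈ range (m - 1), (if c (k + 1) ≤ u * W then 1 else 0)
          ≤ ∑ k ∈ range (m - 1), if k ∈ range (i - 1) then 1 else 0 := by
        refine sum_le_sum fun k hk => ?_
        have hk := mem_range.1 hk
        by_cases hki : k < i - 1
        · rw [if_pos (mem_range.2 hki)]; split_ifs <;> omega
        · rw [if_neg (not_le.2 (hlt.trans_le (hmono i (k + 1) (by omega) (by omega))))]
          omega
      rw [sum_ite_mem, inter_eq_right.2 (range_subset_range.2 (by omega))] at this
      simp only [sum_const, card_range, smul_eq_mul, mul_one] at this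
      omega
    · rw [lt_div_iff₀ hW]
      by_contra! hle
      have him : i + 1 < m := by
        rcases Nat.lt_or_ge (i + 1) m with h | h
        · exact h
        · have e : i + 1 = m := by omega
          rw [e, hcm] at hle
          nlinarith
      have : ∑ k ∈ range (m - 1), (if k ∈ range (i + 1) then 1 else 0)
          ≤ ∑ k ∈ range (m - 1), if c (k + 1) ≤ u * W then 1 else 0 := by
        refine sum_le_sum fun k hk => ?_
        by_cases hki : k < i + 1
        · rw [if_pos ((hmono (k + 1) (i + 1) (by omega) (by omega)).trans hle)]
          split_ifs <;> omega
        · rw [if_neg (by simpa using hki)]; omega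
      rw [sum_ite_mem, inter_eq_right.2 (range_subset_range.2 (by omega))] at this
      simp only [sum_const, card_range, smul_eq_mul, mul_one] at this
      omega
  have hvol : MeasureTheory.volume.real (Set.Ico (c i / W) (c (i + 1) / W)) = w i / W := by
    rw [Real.volume_real_Ico_of_le
      (div_le_div_of_nonneg_right (hmono i (i + 1) (by omega) hi) hW.le), ← sub_div]
    simp [hc, sum_range_succ]
  have hfin : MeasureTheory.volume (Set.Ico (c i / W) (c (i + 1) / W) ∪ {1}) ≠ ⊤ :=
    ((Metric.isBounded_Ico _ _).union Bornology.isBounded_singleton).measure_lt_top.ne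
  refine le_antisymm ?_ ?_
  · refine (MeasureTheory.measureReal_mono hsub2 hfin).trans ?_
    refine (MeasureTheory.measureReal_union_le _ _).trans ?_
    rw [hvol]
    simp [MeasureTheory.measureReal_def]
  · rw [← hvol]
    exact MeasureTheory.measureReal_mono hsub1 (ne_top_of_le_ne_top hfin
      (MeasureTheory.measure_mono hsub2))

/-! ## The mechanism -/

/-- Speeds rounded down to powers of two. -/
noncomputable def speedArray {m : ℕ} (s : Fin m → ℝ) (i : ℕ) : ℝ :=
  if hi : i < m then dyadicFloor (s ⟨i, hi⟩) else 1

/-- Sizes rounded down to powers of two. -/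
noncomputable def sizeArray (l : List ℝ) (k : ℕ) : ℝ := dyadicFloor (l.getD k 0)

/-- Expected reciprocal speed of the machine that a job of rounded size `y` receives after `h`. -/
noncomputable def slowness (α κ : ℝ) {m : ℕ} (s : Fin m → ℝ) (h : History m) (y : ℝ) : ℝ :=
  ∑ i : Fin m, share α κ (speedArray s) m
    (Function.update (sizeArray (h.map Prod.fst)) h.length y) h.length i * (s i)⁻¹

/-- Expected load of machine `i` if its rounded speed is `y` and the jobs have sizes `l`. -/
noncomputable def meanLoad (α κ : ℝ) {m : ℕ} (s : Fin m → ℝ) (l : List ℝ) (i : Fin m) (y : ℝ) :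
    ℝ :=
  ∑ j ∈ range l.length,
    l.getD j 0 * share α κ (Function.update (speedArray s) i y) m (sizeArray l) j i

/-- Each job is assigned at random, with probabilities that depend on the rounded speeds and
sizes only; fees and payments are the critical-value prices of these allocations. -/
noncomputable def mechanism (α κ : ℝ) (m : ℕ) [NeZero m] : Mechanism m where
  assign s h p u := ⟨sampleIndex (weight α κ (speedArray s) m
    (Function.update (sizeArray (h.map Prod.fst)) h.length (dyadicFloor p)) h.length) m u,
    sampleIndex_lt _ (NeZero.pos m) _⟩
  measurable_assign s h p := by
    refine measurable_to_countable' fun i => ?_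
    have : MeasurableSet (sampleIndex (weight α κ (speedArray s) m (Function.update
      (sizeArray (h.map Prod.fst)) h.length (dyadicFloor p)) h.length) m ⁻¹' {(i : ℕ)}) :=
      measurable_sampleIndex _ _ (MeasurableSet.singleton _)
    convert this using 1
    ext u
    simp [Fin.ext_iff]
  fee s h p i := signedSum (fun y => y * slowness α κ s h y) (Int.log 2 p)
    - dyadicFloor p * slowness α κ s h (dyadicFloor p) - load h i / s i
  pay s h i := signedSum (fun y => meanLoad α κ s (h.map Prod.fst) i y / (2 * y))
      (Int.log 2 (s i))
    + meanLoad α κ s (h.map Prod.fst) i (dyadicFloor (s i)) / dyadicFloor (s i)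

lemma isDyadic_speedArray {m : ℕ} (s : Fin m → ℝ) (i : ℕ) : IsDyadic (speedArray s i) := by
  unfold speedArray
  split_ifs
  · exact isDyadic_dyadicFloor _
  · exact ⟨0, by simp⟩

lemma isDyadic_sizeArray (l : List ℝ) (k : ℕ) : IsDyadic (sizeArray l k) :=
  isDyadic_dyadicFloor _

lemma isDyadic_update {f : ℕ → ℝ} (hf : ∀ k, IsDyadic (f k)) {y : ℝ} (hy : IsDyadic y) (n k : ℕ) :
    IsDyadic (Function.update f n y k) := by
  by_cases h : k = n
  · subst h; simpa using hy
  · simpa [Function.update_of_ne h] using hf k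

lemma speedArray_fin {m : ℕ} (s : Fin m → ℝ) (i : Fin m) :
    speedArray s i = dyadicFloor (s i) := by
  simp [speedArray]

lemma speedArray_update {m : ℕ} (s : Fin m → ℝ) (i : Fin m) (b : ℝ) :
    speedArray (Function.update s i b) = Function.update (speedArray s) i (dyadicFloor b) := by
  funext k
  by_cases hk : k < m
  · by_cases h : k = i
    · subst h; simp [speedArray]
    · have : (⟨k, hk⟩ : Fin m) ≠ i := fun e => h (by rw [← e])
      simp [speedArray, hk, h, this]
  · have : k ≠ i := fun e => hk (e ▸ i.2)
    simp [speedArray, hk, this]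

/-! ### The probabilities realised by the mechanism -/

section Probability

variable {m : ℕ} {α κ : ℝ} (hα : 0 < α) (hκ : 1 ≤ κ)

include hα hκ

lemma prob_mechanism [NeZero m] (s : Fin m → ℝ) (h : History m) (p : ℝ) (i : Fin m) :
    (mechanism α κ m).prob s h p i = share α κ (speedArray s) m
      (Function.update (sizeArray (h.map Prod.fst)) h.length (dyadicFloor p)) h.length i := by
  have ha := fun k (_ : k < m) => isDyadic_speedArray s k
  have hP := fun k (_ : k < h.length + 1) => isDyadic_update
    (isDyadic_sizeArray (h.map Prod.fst)) (isDyadic_dyadicFloor p) h.length k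
  have := volume_sampleIndex (fun k hk => weight_nonneg (κ := κ) ha hk)
    (totalWeight_pos hα hκ ha hP (NeZero.pos m)) i.2
  rw [share, totalWeight, ← this, Mechanism.prob]
  simp [mechanism, Fin.ext_iff]

lemma sum_prob_mechanism [NeZero m] (s : Fin m → ℝ) (h : History m) (p : ℝ) :
    ∑ i, (mechanism α κ m).prob s h p i = 1 := by
  simp only [prob_mechanism hα hκ]
  rw [Fin.sum_univ_eq_sum_range (fun i => share α κ (speedArray s) m _ h.length i)]
  exact sum_share hα hκ (fun k _ => isDyadic_speedArray s k) (fun k _ => isDyadic_update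
    (isDyadic_sizeArray _) (isDyadic_dyadicFloor p) h.length k) (NeZero.pos m)

/-- The assignment probabilities in terms of the complete list of sizes. -/
lemma prob_mechanism_of_append [NeZero m] (s : Fin m → ℝ) {h : History m} {p : ℝ}
    {ps l : List ℝ} (hl : h.map Prod.fst ++ p :: ps = l) (i : Fin m) :
    (mechanism α κ m).prob s h p i = share α κ (speedArray s) m (sizeArray l) h.length i := by
  rw [prob_mechanism hα hκ]
  refine share_congr (fun _ _ => rfl) (fun k hk => ?_) i.2
  subst hl
  rcases Nat.lt_succ_iff_lt_or_eq.1 hk with hk | rfl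
  · rw [Function.update_of_ne hk.ne, sizeArray, sizeArray,
      List.getD_append _ _ _ _ (by simpa using hk)]
  · rw [Function.update_self, sizeArray, List.getD_append_right _ _ _ _ (by simp)]
    simp

end Probability

/-! ## Expectations -/

namespace Mechanism

variable {m : ℕ} (M : Mechanism m) (s : Fin m → ℝ)

lemma prob_nonneg (h : History m) (p : ℝ) (i : Fin m) : 0 ≤ M.prob s h p i :=
  MeasureTheory.measureReal_nonneg

/-- Only branches of positive probability contribute, so a pointwise comparison is needed just on
histories satisfying an invariant of such branches. It serves to fix the list of sizes, and for q =
1 also to confine all jobs to fastest machines. -/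
lemma expect_le_of_invariant (I : List ℝ → History m → Prop)
    (hI : ∀ p ps h i, I (p :: ps) h → 0 < M.prob s h p i → I ps (h ++ [(p, i)]))
    {f g : History m → ℝ} (hfg : ∀ h, I [] h → f h ≤ g h) (ps : List ℝ) (h : History m)
    (hh : I ps h) : M.expect s ps h f ≤ M.expect s ps h g := by
  induction ps generalizing h with
  | nil => exact hfg h hh
  | cons p ps ih =>
    refine sum_le_sum fun i _ => ?_
    rcases (M.prob_nonneg s h p i).eq_or_lt with e | hpos
    · rw [← e, zero_mul, zero_mul]
    · exact mul_le_mul_of_nonneg_left (ih _ (hI p ps h i hh hpos)) hpos.le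

lemma expect_le_of_sizes {f g : History m → ℝ} (ps : List ℝ)
    (hfg : ∀ h : History m, h.map Prod.fst = ps → f h ≤ g h) :
    M.expect s ps [] f ≤ M.expect s ps [] g :=
  M.expect_le_of_invariant s (fun qs h => h.map Prod.fst ++ qs = ps)
    (fun p qs h i e _ => by simpa using e) (fun h e => hfg h (by simpa using e)) ps [] rfl

lemma expect_congr_of_sizes {f g : History m → ℝ} (ps : List ℝ)
    (hfg : ∀ h : History m, h.map Prod.fst = ps → f h = g h) :
    M.expect s ps [] f = M.expect s ps [] g :=
  le_antisymm (M.expect_le_of_sizes s ps fun h e => (hfg h e).le)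
    (M.expect_le_of_sizes s ps fun h e => (hfg h e).ge)

lemma expect_add (f g : History m → ℝ) (ps : List ℝ) (h : History m) :
    M.expect s ps h (fun x => f x + g x) = M.expect s ps h f + M.expect s ps h g := by
  induction ps generalizing h with
  | nil => rfl
  | cons p ps ih => simp only [expect, ih, mul_add, sum_add_distrib]

lemma expect_const_mul (c : ℝ) (f : History m → ℝ) (ps : List ℝ) (h : History m) :
    M.expect s ps h (fun x => c * f x) = c * M.expect s ps h f := by
  induction ps generalizing h with
  | nil => rfl
  | cons p ps ih =>
    simp only [expect, ih, mul_sum]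
    exact sum_congr rfl fun i _ => by ring

lemma expect_const (hM : ∀ h p, ∑ i, M.prob s h p i = 1) (c : ℝ) (ps : List ℝ)
    (h : History m) : M.expect s ps h (fun _ => c) = c := by
  induction ps generalizing h with
  | nil => rfl
  | cons p ps ih => simp only [expect, ih, ← sum_mul, hM, one_mul]

lemma expect_sum {ι : Type*} (t : Finset ι) (hM : ∀ h p, ∑ i, M.prob s h p i = 1)
    (f : ι → History m → ℝ) (ps : List ℝ) (h : History m) :
    M.expect s ps h (fun x => ∑ i ∈ t, f i x) = ∑ i ∈ t, M.expect s ps h (f i) := by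
  classical
  induction t using Finset.induction_on with
  | empty => simpa using M.expect_const s hM 0 ps h
  | insert i t hi ih => simp only [sum_insert hi, expect_add, ih]

end Mechanism

lemma load_append {m : ℕ} (h : History m) (p : ℝ) (i k : Fin m) :
    load (h ++ [(p, i)]) k = load h k + if i = k then p else 0 := by
  simp [load]

lemma sum_mul_load_append {m : ℕ} (c : Fin m → ℝ) (h : History m) (p : ℝ) (i : Fin m) :
    ∑ k, c k * load (h ++ [(p, i)]) k = ∑ k, c k * load h k + p * c i := by
  simp only [load_append, mul_add, sum_add_distrib, mul_ite, mul_zero]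
  simp [mul_comm]

/-- Expected value of a linear functional of the loads. -/
lemma expect_sum_mul_load {m : ℕ} [NeZero m] {α κ : ℝ} (hα : 0 < α) (hκ : 1 ≤ κ)
    (s : Fin m → ℝ) (c : Fin m → ℝ) {l : List ℝ} (ps : List ℝ) (h : History m)
    (hl : h.map Prod.fst ++ ps = l) :
    (mechanism α κ m).expect s ps h (fun x => ∑ i, c i * load x i)
      = ∑ i, c i * load h i + ∑ j ∈ Ico h.length l.length,
          l.getD j 0 * ∑ i : Fin m, share α κ (speedArray s) m (sizeArray l) j i * c i := by
  induction ps generalizing h with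
  | nil =>
    have : l.length = h.length := by simp [← hl]
    simp [Mechanism.expect, this]
  | cons p ps ih =>
    have hlen : h.length < l.length := by simp [← hl]
    have hp : l.getD h.length 0 = p := by
      rw [← hl, List.getD_append_right _ _ _ _ (by simp)]; simp
    have e : ∀ i, (mechanism α κ m).expect s ps (h ++ [(p, i)]) (fun x => ∑ i, c i * load x i)
        = (∑ i, c i * load h i + ∑ j ∈ Ico (h.length + 1) l.length,
          l.getD j 0 * ∑ i : Fin m, share α κ (speedArray s) m (sizeArray l) j i * c i)
          + p * c i := by
      intro i
      rw [ih (h ++ [(p, i)]) (by simpa using hl), sum_mul_load_append]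
      simp only [List.length_append, List.length_singleton]
      ring
    simp only [Mechanism.expect, e, mul_add, sum_add_distrib]
    rw [← sum_mul, ← sum_mul, sum_prob_mechanism hα hκ, one_mul, one_mul,
      sum_eq_sum_Ico_succ_bot hlen, hp, mul_sum]
    simp only [prob_mechanism_of_append hα hκ s hl]
    rw [add_assoc, add_comm (∑ j ∈ Ico _ _, _)]
    congr 2
    exact sum_congr rfl fun i _ => by ring

/-! ## Truthfulness -/

section Truthful

variable {m : ℕ} [NeZero m] {α κ : ℝ} (hα : 0 < α) (hκ : 1 ≤ κ)

include hα hκ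

/-- The factor-two gap between rounded speeds survives unrounding: s_k < 2a_k ≤ a_i ≤ s_i. So true
reciprocal speeds satisfy the hypothesis of `sum_share_double_le`. -/
lemma slowness_double_le {s : Fin m → ℝ} (hs : ∀ i, 0 < s i) (h : History m) (k : ℤ) :
    slowness α κ s h (2 ^ (k + 1)) ≤ slowness α κ s h (2 ^ k) := by
  set b : ℕ → ℝ := fun i => if hi : i < m then (s ⟨i, hi⟩)⁻¹ else 0 with hb
  have hbf : ∀ i : Fin m, (s i)⁻¹ = b i := fun i => by simp [hb]
  simp only [slowness, hbf]
  rw [Fin.sum_univ_eq_sum_range (fun i => share α κ (speedArray s) m _ h.length i * b i),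
    Fin.sum_univ_eq_sum_range (fun i => share α κ (speedArray s) m _ h.length i * b i)]
  refine sum_share_double_le hα hκ (fun k _ => isDyadic_speedArray s k) (fun k _ =>
    isDyadic_update (isDyadic_sizeArray _) (isDyadic_zpow _) h.length k) (NeZero.pos m) ?_ ?_ ?_
  · rw [Function.update_self, Function.update_self, zpow_add₀ two_ne_zero]; simp [mul_comm]
  · intro k hk
    rw [Function.update_of_ne hk.ne, Function.update_of_ne hk.ne]
  · intro i hi k hk hle
    simp only [hb, hi, hk, dite_true]
    simp only [speedArray, hi, hk, dite_true] at hle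
    refine inv_anti₀ (hs _) ?_
    exact (lt_two_mul_dyadicFloor _).le.trans (hle.trans (dyadicFloor_le (hs _)))

/-- The fee refunds the waiting time load/s, so only the job's own processing time and the price
remain. With A_k the slowness at report 2^k, the cost increment telescopes to (A_k −
A_{k+1})(2^{k+1} − p). The first factor is nonnegative by monotonicity, and the second changes sign
at the true exponent. -/
lemma jobSideTruthful_mechanism : (mechanism α κ m).JobSideTruthful := by
  intro s hs h _ p r hp hr
  have hcost : ∀ t, (mechanism α κ m).jobCost s h p t
      = p * slowness α κ s h (2 ^ Int.log 2 t)
        + (signedSum (fun y => y * slowness α κ s h y) (Int.log 2 t)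
          - 2 ^ Int.log 2 t * slowness α κ s h (2 ^ Int.log 2 t)) := by
    intro t
    have e : ∀ i, (load h i + p) / s i + (mechanism α κ m).fee s h t i
        = p * (s i)⁻¹ + (signedSum (fun y => y * slowness α κ s h y) (Int.log 2 t)
          - 2 ^ Int.log 2 t * slowness α κ s h (2 ^ Int.log 2 t)) := by
      intro i
      simp only [mechanism, dyadicFloor]
      ring
    simp only [Mechanism.jobCost, e, mul_add, sum_add_distrib]
    rw [← sum_mul, sum_prob_mechanism hα hκ, one_mul]
    congr 1
    simp only [prob_mechanism hα hκ]
    rw [slowness, mul_sum]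
    refine sum_congr rfl fun i _ => ?_
    rw [dyadicFloor]
    ring
  rw [hcost, hcost]
  set A : ℤ → ℝ := fun k => slowness α κ s h (2 ^ k) with hA
  set c : ℤ → ℝ := fun k => p * A k
    + (signedSum (fun y => y * slowness α κ s h y) k - 2 ^ k * A k) with hc
  have hstep : ∀ k, c (k + 1) - c k = (A k - A (k + 1)) * (2 ^ (k + 1) - p) := by
    intro k
    simp only [hc, signedSum_succ, zpow_add₀ (two_ne_zero (α := ℝ)), zpow_one, hA]
    ring
  have hanti : ∀ k, 0 ≤ A k - A (k + 1) := fun k => sub_nonneg.2 (slowness_double_le hα hκ hs h k)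
  refine le_of_unimodal (c := c) (k₀ := Int.log 2 p) (fun k hk => ?_) (fun k hk => ?_) _
  · have h1 : p ≤ 2 ^ (k + 1) := by
      have := Int.lt_zpow_succ_log_self (b := 2) one_lt_two p
      simp only [Nat.cast_ofNat] at this
      exact this.le.trans (zpow_le_zpow_right₀ one_le_two (by omega))
    have := mul_nonneg (hanti k) (sub_nonneg.2 h1)
    linarith [hstep k]
  · have h1 : (2 : ℝ) ^ (k + 1) ≤ p := by
      have := Int.zpow_log_le_self (b := 2) one_lt_two hp
      simp only [Nat.cast_ofNat] at this
      exact (zpow_le_zpow_right₀ one_le_two (by omega)).trans this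
    have := mul_nonneg (hanti k) (sub_nonneg.2 h1)
    linarith [hstep k]

/-- The monotonicity of `share_le_share_double` holds job by job, and the sizes are positive. -/
lemma meanLoad_le_double (s : Fin m → ℝ) {l : List ℝ} (hl : ∀ p ∈ l, 0 < p) (i : Fin m) (k : ℤ) :
    meanLoad α κ s l i (2 ^ k) ≤ meanLoad α κ s l i (2 ^ (k + 1)) := by
  refine sum_le_sum fun j hj => ?_
  refine mul_le_mul_of_nonneg_left ?_ ?_
  · refine share_le_share_double hα hκ (fun k _ => isDyadic_update (isDyadic_speedArray s)
      (isDyadic_zpow _) _ _) (fun k _ => isDyadic_sizeArray _ _) (NeZero.pos m) i.2 ?_ ?_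
    · rw [Function.update_self, Function.update_self, zpow_add₀ two_ne_zero]; simp [mul_comm]
    · intro k hk
      rw [Function.update_of_ne hk, Function.update_of_ne hk]
  · have hj := mem_range.1 hj
    rw [List.getD_eq_getElem _ _ hj]
    exact (hl _ (List.getElem_mem hj)).le

lemma expect_load (s : Fin m → ℝ) (ps : List ℝ) (i : Fin m) :
    (mechanism α κ m).expect s ps [] (fun h => load h i)
      = meanLoad α κ s ps i (dyadicFloor (s i)) := by
  have h1 := expect_sum_mul_load hα hκ s (Pi.single i 1) ps [] (l := ps) rfl
  have h2 : ∀ x : History m, ∑ k, (Pi.single i 1 : Fin m → ℝ) k * load x k = load x i := by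
    intro x
    rw [sum_eq_single i (fun k _ hk => by simp [hk]) (by simp)]
    simp
  simp only [h2] at h1
  rw [h1, meanLoad, ← speedArray_update, Function.update_eq_self]
  simp only [load, List.map_nil, List.sum_nil, zero_add, List.length_nil, range_eq_Ico]
  refine sum_congr rfl fun j _ => ?_
  congr 1
  rw [sum_eq_single i (fun k _ hk => by simp [hk]) (by simp)]
  simp

/-- With f_k the mean load at rounded speed 2^k, expected load cost minus payment has increments
(f_{k+1} − f_k)(1/s_i − 2^{-(k+1)}). The first factor is nonnegative and the second changes sign at
the true exponent. -/
lemma machineSideTruthful_mechanism : (mechanism α κ m).MachineSideTruthful := by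
  intro s hs ps hps i b hb
  set f : ℤ → ℝ := fun k => meanLoad α κ s ps i (2 ^ k) with hf
  set c : ℤ → ℝ := fun k => f k / s i
    - (signedSum (fun y => meanLoad α κ s ps i y / (2 * y)) k + f k / 2 ^ k) with hc
  have hu : ∀ b, (mechanism α κ m).machineUtility s ps i b = -c (Int.log 2 b) := by
    intro b
    -- `meanLoad` overwrites entry i of the speeds, so the machine's own report enters the payment
    -- only through its rounded value.
    have hml : ∀ l y, meanLoad α κ (Function.update s i b) l i y = meanLoad α κ s l i y := by
      intro l y
      simp only [meanLoad, speedArray_update, Function.update_idem]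
    have e : ∀ h : History m, h.map Prod.fst = ps →
        (mechanism α κ m).pay (Function.update s i b) h i - load h i / s i
          = (signedSum (fun y => meanLoad α κ s ps i y / (2 * y)) (Int.log 2 b)
            + f (Int.log 2 b) / 2 ^ Int.log 2 b) + (-(s i)⁻¹) * load h i := by
      intro h hh
      simp only [mechanism, hh, hml, Function.update_self, hf, dyadicFloor]
      ring
    rw [Mechanism.machineUtility, Mechanism.expect_congr_of_sizes _ _ _ e, Mechanism.expect_add,
      Mechanism.expect_const_mul, expect_load hα hκ,
      Mechanism.expect_const _ _ (sum_prob_mechanism hα hκ _), hml, Function.update_self]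
    simp only [hc, hf, dyadicFloor]
    ring
  rw [hu, hu, neg_le_neg_iff]
  have hstep : ∀ k, c (k + 1) - c k = (f (k + 1) - f k) * ((s i)⁻¹ - (2 ^ (k + 1))⁻¹) := by
    intro k
    simp only [hc, signedSum_succ, zpow_add₀ (two_ne_zero (α := ℝ)), zpow_one, hf]
    have : (2 : ℝ) ^ k ≠ 0 := by positivity
    field_simp
    ring
  have hmono : ∀ k, 0 ≤ f (k + 1) - f k := fun k =>
    sub_nonneg.2 (meanLoad_le_double hα hκ s hps i k)
  refine le_of_unimodal (c := c) (k₀ := Int.log 2 (s i)) (fun k hk => ?_) (fun k hk => ?_) _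
  · have h1 : s i ≤ 2 ^ (k + 1) := by
      have := Int.lt_zpow_succ_log_self (b := 2) one_lt_two (s i)
      simp only [Nat.cast_ofNat] at this
      exact this.le.trans (zpow_le_zpow_right₀ one_le_two (by omega))
    have := mul_nonneg (hmono k) (sub_nonneg.2 (inv_anti₀ (hs i) h1))
    linarith [hstep k]
  · have h1 : (2 : ℝ) ^ (k + 1) ≤ s i := by
      have := Int.zpow_log_le_self (b := 2) one_lt_two (hs i)
      simp only [Nat.cast_ofNat] at this
      exact (zpow_le_zpow_right₀ one_le_two (by omega)).trans this
    have := mul_nonneg (hmono k) (sub_nonneg.2 (inv_anti₀ (by positivity) h1))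
    linarith [hstep k]

lemma twoSidedTruthful_mechanism : (mechanism α κ m).TwoSidedTruthful :=
  ⟨machineSideTruthful_mechanism hα hκ, jobSideTruthful_mechanism hα hκ⟩

end Truthful

/-! ## Mean completion times -/

lemma level_mono {α : ℝ} {a : ℕ → ℝ} {m : ℕ} {P : ℕ → ℝ} (hα : 0 < α)
    (ha : ∀ i < m, IsDyadic (a i)) (hP : ∀ k, IsDyadic (P k)) (hm : 0 < m) {n n' : ℕ}
    (hn : 0 < n) (hnn : n ≤ n') : level α a m P n ≤ level α a m P n' :=
  level_le hα ha (fun k _ => hP k) hm hn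
    (isDyadic_level hα ha (fun k _ => hP k) hm (hn.trans_le hnn))
    ((feasible_level hα ha (fun k _ => hP k) hm (hn.trans_le hnn)).mono_jobs
      (fun k _ => (hP k).pos.le) hnn)

/-- Total weight of the machines slower than the fastest one by a factor of at most `2 ^ d`. -/
noncomputable def fastWeight (α : ℝ) (a : ℕ → ℝ) (m d : ℕ) : ℝ :=
  ∑ i ∈ range m, if runMax a m ≤ 2 ^ d * a i then a i ^ α else 0

/-- Total weight of the machines at least as fast as machine `i`. -/
noncomputable def fasterWeight (α : ℝ) (a : ℕ → ℝ) (m i : ℕ) : ℝ :=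
  ∑ k ∈ range m, if a i ≤ a k then a k ^ α else 0

/-- Share of machine `i` in the weight of all machines at least as fast as itself; `0` for slow
machines. -/
noncomputable def relWeight (α : ℝ) (a : ℕ → ℝ) (m i : ℕ) : ℝ :=
  if runMax a m ≤ m * a i then a i ^ α / fasterWeight α a m i else 0

/-! ### Classes of jobs and their total volumes -/

section Classes

variable {α : ℝ} {a : ℕ → ℝ} {m : ℕ} {P : ℕ → ℝ}
  (hα : 1 ≤ α) (ha : ∀ i < m, IsDyadic (a i)) (hP : ∀ k, IsDyadic (P k)) (hm : 0 < m)

/-- The ratio y/x is a power of two, so the cutoff m may be rounded down to one as well. -/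
lemma le_pow_mul_iff_of_isDyadic {x y : ℝ} (hx : IsDyadic x) (hy : IsDyadic y) (hxy : x ≤ y)
    (hm : 0 < m) : y ≤ m * x ↔ y ≤ 2 ^ Nat.log 2 m * x := by
  obtain ⟨k, rfl⟩ := hx
  obtain ⟨l, rfl⟩ := hy
  have hkl : k ≤ l := (zpow_le_zpow_iff_right₀ one_lt_two).1 hxy
  obtain ⟨d, rfl⟩ := Int.le.dest hkl
  rw [zpow_add₀ two_ne_zero, mul_comm, zpow_natCast]
  have h0 : (0 : ℝ) < 2 ^ k := by positivity
  rw [mul_le_mul_iff_left₀ h0, mul_le_mul_iff_left₀ h0,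
    pow_le_pow_iff_right₀ (one_lt_two (α := ℝ)), Nat.le_log_iff_pow_le one_lt_two hm.ne']
  exact_mod_cast Iff.rfl

include ha hm

lemma rpow_max_le_fastWeight (d : ℕ) : runMax a m ^ α ≤ fastWeight α a m d := by
  obtain ⟨i, hi, e⟩ := exists_runMax_eq hm fun i hi => (ha i hi).pos
  refine le_trans (le_of_eq ?_) (single_le_sum
    (f := fun i => if runMax a m ≤ 2 ^ d * a i then a i ^ α else 0) (fun k hk => ?_)
    (mem_range.2 hi))
  · rw [if_pos]
    · rw [e]
    · rw [e]
      exact le_mul_of_one_le_left (ha i hi).pos.le (one_le_pow₀ one_le_two)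
  · split_ifs
    · exact Real.rpow_nonneg (ha k (mem_range.1 hk)).pos.le _
    · exact le_rfl

lemma fastWeight_pos (d : ℕ) : 0 < fastWeight α a m d :=
  (Real.rpow_pos_of_pos (isDyadic_runMax ha hm).pos _).trans_le (rpow_max_le_fastWeight ha hm d)

omit hm in
lemma rpow_le_fasterWeight {i : ℕ} (hi : i < m) : a i ^ α ≤ fasterWeight α a m i := by
  refine le_trans (le_of_eq ?_) (single_le_sum
    (f := fun k => if a i ≤ a k then a k ^ α else 0) (fun k hk => ?_) (mem_range.2 hi))
  · rw [if_pos le_rfl]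
  · split_ifs
    · exact Real.rpow_nonneg (ha k (mem_range.1 hk)).pos.le _
    · exact le_rfl

omit hm in
lemma fasterWeight_pos {i : ℕ} (hi : i < m) : 0 < fasterWeight α a m i :=
  (Real.rpow_pos_of_pos (ha i hi).pos _).trans_le (rpow_le_fasterWeight ha hi)

omit hm in
lemma fasterWeight_le_fastWeight {i d : ℕ} (h : runMax a m ≤ 2 ^ d * a i) :
    fasterWeight α a m i ≤ fastWeight α a m d := by
  refine sum_le_sum fun k hk => ?_
  split_ifs with h1 h2
  · exact le_rfl
  · exact absurd (h.trans (mul_le_mul_of_nonneg_left h1 (by positivity))) h2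
  · exact Real.rpow_nonneg (ha k (mem_range.1 hk)).pos.le _
  · exact le_rfl

omit hm in
lemma relWeight_nonneg {i : ℕ} (hi : i < m) : 0 ≤ relWeight α a m i := by
  unfold relWeight
  split_ifs
  · exact div_nonneg (Real.rpow_nonneg (ha i hi).pos.le _) (fasterWeight_pos ha hi).le
  · exact le_rfl

omit hm in
lemma relWeight_le_one {i : ℕ} (hi : i < m) : relWeight α a m i ≤ 1 := by
  unfold relWeight
  split_ifs
  · exact (div_le_one (fasterWeight_pos ha hi)).2 (rpow_le_fasterWeight ha hi)
  · exact zero_le_one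

/-- All machines of speed max/2^d share the denominator `fastWeight` at d, which contains their own
weights, so each of the log₂ m + 1 speed groups contributes at most 1. -/
lemma sum_relWeight_le : ∑ i ∈ range m, relWeight α a m i ≤ (Nat.log 2 m + 1 : ℕ) := by
  have key : ∀ i ∈ range m, relWeight α a m i ≤ ∑ d ∈ range (Nat.log 2 m + 1),
      if runMax a m = 2 ^ d * a i then a i ^ α / fastWeight α a m d else 0 := by
    intro i hi
    have hi := mem_range.1 hi
    have hnn : ∀ d ∈ range (Nat.log 2 m + 1),
        0 ≤ if runMax a m = 2 ^ d * a i then a i ^ α / fastWeight α a m d else 0 := by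
      intro d _
      split_ifs
      · exact div_nonneg (Real.rpow_nonneg (ha i hi).pos.le _) (fastWeight_pos ha hm d).le
      · exact le_rfl
    unfold relWeight
    split_ifs with h
    swap
    · exact sum_nonneg hnn
    have hle : a i ≤ runMax a m := le_runMax hi
    rw [le_pow_mul_iff_of_isDyadic (ha i hi) (isDyadic_runMax ha hm) hle hm] at h
    obtain ⟨d, hd⟩ : ∃ d : ℕ, runMax a m = 2 ^ d * a i := by
      obtain ⟨k, hk⟩ := ha i hi
      obtain ⟨l, hl⟩ := isDyadic_runMax ha hm
      rw [hk, hl] at hle ⊢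
      obtain ⟨d, rfl⟩ := Int.le.dest ((zpow_le_zpow_iff_right₀ one_lt_two).1 hle)
      exact ⟨d, by rw [zpow_add₀ two_ne_zero, mul_comm, zpow_natCast]⟩
    have hdL : d < Nat.log 2 m + 1 := by
      rw [hd] at h
      have := le_of_mul_le_mul_right h (ha i hi).pos
      exact Nat.lt_succ_of_le ((pow_le_pow_iff_right₀ one_lt_two).1 this)
    refine le_trans (le_of_eq ?_) (single_le_sum hnn (mem_range.2 hdL))
    rw [if_pos hd]
    congr 1
    refine sum_congr rfl fun k _ => ?_
    have : a i ≤ a k ↔ runMax a m ≤ 2 ^ d * a k := by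
      rw [hd, mul_le_mul_iff_right₀ (by positivity)]
    simp only [this]
  refine (sum_le_sum key).trans ?_
  rw [sum_comm]
  have : ∀ d ∈ range (Nat.log 2 m + 1), ∑ i ∈ range m,
      (if runMax a m = 2 ^ d * a i then a i ^ α / fastWeight α a m d else 0) ≤ 1 := by
    intro d _
    have e : ∀ i ∈ range m, (if runMax a m = 2 ^ d * a i then a i ^ α / fastWeight α a m d else 0)
        ≤ (if runMax a m ≤ 2 ^ d * a i then a i ^ α else 0) / fastWeight α a m d := by
      intro i hi
      have := Real.rpow_nonneg (ha i (mem_range.1 hi)).pos.le α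
      have hV := fastWeight_pos (α := α) ha hm d
      split_ifs with h1 h2
      · exact le_rfl
      · exact absurd h1.le h2
      · positivity
      · simp
    refine (sum_le_sum e).trans ?_
    rw [← sum_div]
    exact div_self_le_one _
  refine (sum_le_sum this).trans ?_
  simp

/-- Jensen's inequality for the concave power t^v, together with the bound on the sum. -/
lemma sum_relWeight_rpow_le {v : ℝ} (hv0 : 0 ≤ v) (hv1 : v ≤ 1) :
    ∑ i ∈ range m, relWeight α a m i ^ v
      ≤ (m : ℝ) ^ (1 - v) * ((Nat.log 2 m + 1 : ℕ) : ℝ) ^ v := by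
  have hm' : (0 : ℝ) < m := Nat.cast_pos.2 hm
  have h := (Real.concaveOn_rpow hv0 hv1).le_map_sum (t := range m) (w := fun _ => (m : ℝ)⁻¹)
    (p := fun i => relWeight α a m i) (fun _ _ => by positivity)
    (by simp [hm'.ne']) (fun i hi => relWeight_nonneg ha (mem_range.1 hi))
  simp only [smul_eq_mul] at h
  rw [← mul_sum, ← mul_sum, Real.mul_rpow (by positivity)
    (sum_nonneg fun i hi => relWeight_nonneg ha (mem_range.1 hi)), inv_mul_le_iff₀ hm'] at h
  refine h.trans ?_
  rw [← mul_assoc, Real.inv_rpow hm'.le, ← div_eq_mul_inv]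
  nth_rw 1 [← Real.rpow_one (m : ℝ)]
  rw [← Real.rpow_sub hm']
  gcongr
  · exact sum_nonneg fun i hi => relWeight_nonneg ha (mem_range.1 hi)
  · exact sum_relWeight_le ha hm

include hα hP

/-- The machines that may receive job `j` are those above a threshold, of which there are only
logarithmically many. -/
lemma exists_class (j : ℕ) : ∃ d ≤ Nat.log 2 m, ∀ i < m,
    (P j ≤ a i * level α a m P (j + 1) ∧ runMax a m ≤ m * a i) ↔ runMax a m ≤ 2 ^ d * a i := by
  have hα0 : 0 < α := by linarith
  have hn := Nat.succ_pos j
  have hT := isDyadic_level hα0 ha (fun k (_ : k < j + 1) => hP k) hm hn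
  have hM := isDyadic_runMax ha hm
  have hle := size_le_max_mul_level hα0 ha (fun k (_ : k < j + 1) => hP k) hm hn
    (Nat.lt_succ_self j)
  set T := level α a m P (j + 1)
  rw [← div_le_iff₀ hT.pos] at hle
  have hx := (hP j).div hT
  have h1 : ∀ i < m, (P j ≤ a i * T ∧ runMax a m ≤ m * a i)
      ↔ (P j / T ≤ a i ∧ runMax a m ≤ 2 ^ Nat.log 2 m * a i) := by
    intro i hi
    rw [div_le_iff₀ hT.pos,
      le_pow_mul_iff_of_isDyadic (ha i hi) hM (le_runMax hi) hm]
  obtain ⟨X, hX⟩ := hx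
  obtain ⟨M, hM⟩ := hM
  rw [hX, hM, zpow_le_zpow_iff_right₀ (one_lt_two (α := ℝ))] at hle
  -- Here 2^X is the least speed fast enough for the job and 2^M the maximal speed. The truncation
  -- loses nothing, since X ≤ M by feasibility of the level.
  refine ⟨min (M - X).toNat (Nat.log 2 m), min_le_right _ _, fun i hi => ?_⟩
  rw [h1 i hi, hX, hM]
  obtain ⟨A, hA⟩ := ha i hi
  rw [hA, ← zpow_natCast, ← zpow_natCast, ← zpow_add₀ two_ne_zero, ← zpow_add₀ two_ne_zero,
    zpow_le_zpow_iff_right₀ (one_lt_two (α := ℝ)), zpow_le_zpow_iff_right₀ (one_lt_two (α := ℝ)),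
    zpow_le_zpow_iff_right₀ (one_lt_two (α := ℝ))]
  omega

variable {D : ℕ → ℕ} (hD : ∀ j, ∀ i < m,
    (P j ≤ a i * level α a m P (j + 1) ∧ runMax a m ≤ m * a i) ↔ runMax a m ≤ 2 ^ D j * a i)

include hD

omit ha hP hm hα in
lemma share_eq_of_class {j i : ℕ} (hi : i < m) : share α m a m P j i
    = if runMax a m ≤ 2 ^ D j * a i then a i ^ α / fastWeight α a m (D j) else 0 := by
  have hw : ∀ i < m, weight α m a m P j i
      = if runMax a m ≤ 2 ^ D j * a i then a i ^ α else 0 := by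
    intro i hi
    unfold weight
    by_cases h : runMax a m ≤ 2 ^ D j * a i
    · rw [if_pos h, if_pos ((hD j i hi).2 h)]
    · rw [if_neg h, if_neg (mt (hD j i hi).1 h)]
  rw [share, totalWeight, sum_congr rfl fun i hi => hw i (mem_range.1 hi), hw i hi]
  split_ifs
  · rfl
  · exact zero_div _

omit hP in
-- Excluding machines slower than max/m costs only a factor two: as α ≥ 1, each of them weighs at
-- most max^α/m, so together they weigh no more than one fastest machine.
lemma capacity_le_of_class {j : ℕ} : capacity α a m (level α a m P (j + 1)) (P j)
    ≤ 2 * fastWeight α a m (D j) := by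
  have hm' : (0 : ℝ) < m := Nat.cast_pos.2 hm
  have hM := isDyadic_runMax ha hm
  have h1 : ∀ i ∈ range m,
      (if P j ≤ a i * level α a m P (j + 1) then a i ^ α else 0)
        ≤ (if runMax a m ≤ 2 ^ D j * a i then a i ^ α else 0) + runMax a m ^ α / m := by
    intro i hi
    have hi := mem_range.1 hi
    have h0 : 0 ≤ runMax a m ^ α / m := div_nonneg (Real.rpow_nonneg hM.pos.le _) hm'.le
    have h0' := Real.rpow_nonneg (ha i hi).pos.le α
    by_cases hfast : runMax a m ≤ m * a i
    · by_cases h : P j ≤ a i * level α a m P (j + 1)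
      · rw [if_pos h, if_pos ((hD j i hi).1 ⟨h, hfast⟩)]; linarith
      · rw [if_neg h]; split_ifs <;> linarith
    · have hslow : a i ^ α ≤ runMax a m ^ α / m := by
        push Not at hfast
        have h2 : a i ≤ runMax a m / m := by
          rw [le_div_iff₀ hm', mul_comm]; exact hfast.le
        calc a i ^ α ≤ (runMax a m / m) ^ α :=
              Real.rpow_le_rpow (ha i hi).pos.le h2 (by linarith)
          _ = runMax a m ^ α / (m : ℝ) ^ α := Real.div_rpow hM.pos.le hm'.le _
          _ ≤ runMax a m ^ α / m := by
              refine div_le_div_of_nonneg_left (Real.rpow_nonneg hM.pos.le _) hm' ?_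
              exact Real.self_le_rpow_of_one_le (by exact_mod_cast hm) hα
      split_ifs <;> linarith
  refine (sum_le_sum h1).trans ?_
  rw [sum_add_distrib, two_mul]
  refine add_le_add le_rfl ?_
  simp only [sum_const, card_range, nsmul_eq_mul]
  rw [mul_div_cancel₀ _ hm'.ne']
  exact rpow_max_le_fastWeight ha hm _

/-- Strong induction along the growth of the level. Jobs that arrived while the level was below its
final value T are covered by the induction hypothesis at a level of at most T/2; jobs that arrived
at level T are covered by feasibility of T. Each part is at most 2TV. -/
lemma sum_class_le (d : ℕ) (n : ℕ) (hn : 0 < n) :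
    ∑ j ∈ range n, (if D j = d then P j else 0)
      ≤ 4 * level α a m P n * fastWeight α a m d ^ α⁻¹ := by
  have hα0 : 0 < α := by linarith
  set V := fastWeight α a m d ^ α⁻¹ with hV
  have hVpos : 0 < V := Real.rpow_pos_of_pos (fastWeight_pos ha hm d) _
  induction n using Nat.strong_induction_on with
  | _ n ih =>
  set T := level α a m P n with hT
  have hTd : IsDyadic T := isDyadic_level hα0 ha (fun k _ => hP k) hm hn
  have hnn : ∀ j, 0 ≤ if D j = d then P j else 0 := fun j => by
    split_ifs
    · exact (hP j).pos.le
    · exact le_rfl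
  rw [← sum_filter_add_sum_filter_not (range n) fun j => level α a m P (j + 1) < T]
  have hearly : ∑ j ∈ (range n).filter (fun j => level α a m P (j + 1) < T),
      (if D j = d then P j else 0) ≤ 2 * T * V := by
    rcases ((range n).filter fun j => level α a m P (j + 1) < T).eq_empty_or_nonempty
      with he | hne
    · rw [he, sum_empty]
      have := hTd.pos
      positivity
    · obtain ⟨j₀, hj₀, hmax⟩ := exists_max_image _ id hne
      simp only [mem_filter, mem_range, id] at hj₀ hmax
      have hlt : j₀ + 1 < n := by
        refine lt_of_le_of_ne hj₀.1 fun e => ?_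
        have := hj₀.2
        rw [e] at this
        exact lt_irrefl _ this
      have h1 := ih (j₀ + 1) hlt (Nat.succ_pos _)
      have h2 := (isDyadic_level hα0 ha (fun k (_ : k < j₀ + 1) => hP k) hm
        (Nat.succ_pos _)).two_mul_le hTd hj₀.2
      have h3 : ∑ j ∈ (range n).filter (fun j => level α a m P (j + 1) < T),
          (if D j = d then P j else 0) ≤ ∑ j ∈ range (j₀ + 1), (if D j = d then P j else 0) := by
        refine sum_le_sum_of_subset_of_nonneg (fun j hj => ?_) fun j _ _ => hnn j
        simp only [mem_filter, mem_range] at hj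
        exact mem_range.2 (Nat.lt_succ_of_le (hmax j hj))
      have h4 := mul_le_mul_of_nonneg_right h2 hVpos.le
      linarith
  have hlate : ∑ j ∈ (range n).filter (fun j => ¬ level α a m P (j + 1) < T),
      (if D j = d then P j else 0) ≤ 2 * T * V := by
    rw [← sum_filter]
    set S := ((range n).filter fun j => ¬ level α a m P (j + 1) < T).filter fun j => D j = d
    rcases S.eq_empty_or_nonempty with he | hne
    · rw [he, sum_empty]
      have := hTd.pos
      positivity
    -- The volume test at the smallest job of the class bounds the volume of all its late jobs, and
    -- `capacity_le_of_class` identifies the capacity there with the weight of the class.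
    · obtain ⟨l, hl, hmin⟩ := exists_min_image _ P hne
      have hS : ∀ j ∈ S, j < n ∧ level α a m P (j + 1) = T ∧ D j = d := by
        intro j hj
        simp only [S, mem_filter, mem_range, not_lt] at hj
        exact ⟨hj.1.1, le_antisymm (level_mono hα0 ha hP hm (Nat.succ_pos _) hj.1.1) hj.1.2, hj.2⟩
      obtain ⟨hln, hlT, hld⟩ := hS l hl
      have hcap := capacity_le_of_class hα ha hm hD (j := l)
      rw [hlT, hld] at hcap
      have hpow : capacity α a m T (P l) ^ α⁻¹ ≤ 2 * V := by
        calc capacity α a m T (P l) ^ α⁻¹ ≤ (2 * fastWeight α a m d) ^ α⁻¹ :=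
              Real.rpow_le_rpow (capacity_nonneg (fun i hi => (ha i hi).pos.le) _ _) hcap
                (inv_nonneg.2 hα0.le)
          _ = 2 ^ α⁻¹ * V := Real.mul_rpow two_pos.le (fastWeight_pos ha hm d).le
          _ ≤ 2 * V := by
              refine mul_le_mul_of_nonneg_right ?_ hVpos.le
              exact Real.rpow_le_self_of_one_le one_le_two (inv_le_one_of_one_le₀ hα)
      calc ∑ j ∈ S, P j ≤ ∑ k ∈ range n, (if P l ≤ P k then P k else 0) := by
            rw [← sum_filter]
            refine sum_le_sum_of_subset_of_nonneg (fun j hj => ?_) fun j _ _ => (hP j).pos.le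
            exact mem_filter.2 ⟨mem_range.2 (hS j hj).1, hmin j hj⟩
        _ ≤ T * capacity α a m T (P l) ^ α⁻¹ :=
            feasible_level hα0 ha (fun k _ => hP k) hm hn l hln
        _ ≤ T * (2 * V) := mul_le_mul_of_nonneg_left hpow hTd.pos.le
        _ = 2 * T * V := by ring
  linarith

omit hD

/-- The expected completion time of machine `i`, up to rounding. -/
lemma sum_size_mul_share_le {n : ℕ} (hn : 0 < n) {i : ℕ} (hi : i < m) :
    (∑ j ∈ range n, P j * share α m a m P j i) / a i
      ≤ 4 * (Nat.log 2 m + 1 : ℕ) * level α a m P n * relWeight α a m i ^ (1 - α⁻¹) := by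
  have hα0 : 0 < α := by linarith
  choose D hDL hD using exists_class hα ha hP hm
  set L := Nat.log 2 m with hL
  set T := level α a m P n with hT
  have hTd : IsDyadic T := isDyadic_level hα0 ha (fun k _ => hP k) hm hn
  set U := fasterWeight α a m i with hU
  have hUpos : 0 < U := fasterWeight_pos ha hi
  have haipos := (ha i hi).pos
  have hv : 0 ≤ 1 - α⁻¹ := sub_nonneg.2 (inv_le_one_of_one_le₀ hα)
  have e1 : ∑ j ∈ range n, P j * share α m a m P j i
      = ∑ d ∈ range (L + 1), if runMax a m ≤ 2 ^ d * a i then a i ^ α / fastWeight α a m d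
          * ∑ j ∈ range n, (if D j = d then P j else 0) else 0 := by
    have : ∀ j ∈ range n, P j * share α m a m P j i = ∑ d ∈ range (L + 1),
        if D j = d then (if runMax a m ≤ 2 ^ d * a i then a i ^ α / fastWeight α a m d * P j else 0)
        else 0 := by
      intro j _
      rw [sum_ite_eq, if_pos (mem_range.2 (Nat.lt_succ_of_le (hDL j))),
        share_eq_of_class hD hi]
      split_ifs <;> ring
    rw [sum_congr rfl this, sum_comm]
    refine sum_congr rfl fun d _ => ?_
    split_ifs
    · rw [mul_sum]
      refine sum_congr rfl fun j _ => ?_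
      split_ifs <;> simp
    · simp
  by_cases hfast : runMax a m ≤ m * a i
  · have e2 : ∀ d ∈ range (L + 1), (if runMax a m ≤ 2 ^ d * a i then
        a i ^ α / fastWeight α a m d * ∑ j ∈ range n, (if D j = d then P j else 0) else 0)
        ≤ a i ^ α * (4 * T * U ^ (α⁻¹ - 1)) := by
      intro d _
      have hα' := Real.rpow_pos_of_pos haipos α
      have hTpos := hTd.pos
      split_ifs with h
      · have hVpos := fastWeight_pos (α := α) ha hm d
        rw [div_mul_eq_mul_div, mul_div_assoc]
        refine mul_le_mul_of_nonneg_left ?_ hα'.le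
        rw [div_le_iff₀ hVpos]
        refine (sum_class_le hα ha hP hm hD d n hn).trans ?_
        -- The exponent α⁻¹ − 1 is nonpositive, and every class open to machine i contains all
        -- machines at least as fast, so its weight is at least U.
        have h1 : fastWeight α a m d ^ (α⁻¹ - 1) ≤ U ^ (α⁻¹ - 1) :=
          Real.rpow_le_rpow_of_nonpos hUpos (fasterWeight_le_fastWeight ha h) (by linarith)
        have h2 : fastWeight α a m d ^ α⁻¹
            = fastWeight α a m d ^ (α⁻¹ - 1) * fastWeight α a m d := by
          rw [← Real.rpow_add_one hVpos.ne', sub_add_cancel]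
        rw [h2, ← mul_assoc]
        gcongr
      · have := Real.rpow_pos_of_pos hUpos (α⁻¹ - 1)
        positivity
    have e3 : relWeight α a m i ^ (1 - α⁻¹) = a i ^ α * U ^ (α⁻¹ - 1) / a i := by
      rw [relWeight, if_pos hfast, Real.div_rpow (Real.rpow_nonneg haipos.le _) hUpos.le,
        ← Real.rpow_mul haipos.le, mul_sub, mul_one, mul_inv_cancel₀ hα0.ne',
        Real.rpow_sub_one haipos.ne', ← neg_sub 1 α⁻¹, Real.rpow_neg hUpos.le]
      ring
    rw [e1, e3, div_le_iff₀ haipos]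
    refine (sum_le_sum e2).trans (le_of_eq ?_)
    simp only [sum_const, card_range, nsmul_eq_mul]
    field_simp
  · have : ∀ d ∈ range (L + 1), (if runMax a m ≤ 2 ^ d * a i then
        a i ^ α / fastWeight α a m d * ∑ j ∈ range n, (if D j = d then P j else 0) else 0)
        = 0 := by
      intro d hd
      refine if_neg fun h => hfast ?_
      rw [le_pow_mul_iff_of_isDyadic (ha i hi) (isDyadic_runMax ha hm) (le_runMax hi) hm]
      refine h.trans (mul_le_mul_of_nonneg_right ?_ haipos.le)
      exact pow_le_pow_right₀ one_le_two (Nat.lt_succ_iff.1 (mem_range.1 hd))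
    rw [e1, sum_eq_zero this, zero_div]
    have := Real.rpow_nonneg (relWeight_nonneg (α := α) ha hi) (1 - α⁻¹)
    have := hTd.pos
    positivity

end Classes

/-! ## Norms -/

section Norm

variable {m : ℕ} {q : ℝ≥0∞}

lemma norm_toLp_smul_const (hq : 1 ≤ q) {c : ℝ} (hc : 0 ≤ c) (x : Fin m → ℝ) :
    ‖WithLp.toLp q (fun i => c * x i)‖ = c * ‖WithLp.toLp q x‖ := by
  have : Fact (1 ≤ q) := ⟨hq⟩
  have : WithLp.toLp q (fun i => c * x i) = c • WithLp.toLp q x := by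
    ext i; simp
  rw [this, norm_smul, Real.norm_of_nonneg hc]

lemma le_norm_toLp (hq : 1 ≤ q) (x : Fin m → ℝ) (i : Fin m) : x i ≤ ‖WithLp.toLp q x‖ := by
  have : Fact (1 ≤ q) := ⟨hq⟩
  exact (le_abs_self _).trans (PiLp.norm_apply_le (WithLp.toLp q x) i)

lemma norm_toLp_eq (hq : 1 ≤ q) (hq' : q ≠ ∞) {x : Fin m → ℝ} (hx : ∀ i, 0 ≤ x i) :
    ‖WithLp.toLp q x‖ = (∑ i, x i ^ q.toReal) ^ (1 / q.toReal) := by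
  rw [PiLp.norm_eq_sum (ENNReal.toReal_pos (zero_lt_one.trans_le hq).ne' hq')]
  simp only [Real.norm_of_nonneg (hx _)]

/-- Interpolation between the maximum and the sum. -/
lemma norm_toLp_le (hq : 1 ≤ q) {x : Fin m → ℝ} (hx : ∀ i, 0 ≤ x i) {M S : ℝ} (hM0 : 0 < M)
    (hS0 : 0 < S) (hM : ∀ i, x i ≤ M) (hS : ∑ i, x i ≤ S) :
    ‖WithLp.toLp q x‖ ≤ M ^ (1 - (q⁻¹).toReal) * S ^ (q⁻¹).toReal := by
  rcases eq_or_ne q ∞ with rfl | hq'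
  · simp only [ENNReal.inv_top, ENNReal.toReal_zero, sub_zero, Real.rpow_one, Real.rpow_zero,
      mul_one]
    rw [PiLp.norm_eq_ciSup]
    refine Real.iSup_le (fun i => ?_) hM0.le
    rw [Real.norm_of_nonneg (hx i)]
    exact hM i
  · have hr : 1 ≤ q.toReal := by
      rw [← ENNReal.toReal_one]; exact ENNReal.toReal_mono hq' hq
    set r := q.toReal with hrdef
    have hr0 : 0 < r := by linarith
    rw [norm_toLp_eq hq hq' hx, ENNReal.toReal_inv, ← hrdef]
    have h1 : ∑ i, x i ^ r ≤ M ^ (r - 1) * S := by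
      calc ∑ i, x i ^ r ≤ ∑ i, M ^ (r - 1) * x i := by
            refine sum_le_sum fun i _ => ?_
            rcases (hx i).eq_or_lt with e | hpos
            · rw [← e, Real.zero_rpow hr0.ne', mul_zero]
            · have : x i ^ r = x i ^ (r - 1) * x i := by
                rw [← Real.rpow_add_one hpos.ne', sub_add_cancel]
              rw [this]
              exact mul_le_mul_of_nonneg_right
                (Real.rpow_le_rpow (hx i) (hM i) (by linarith)) (hx i)
        _ = M ^ (r - 1) * ∑ i, x i := (mul_sum _ _ _).symm
        _ ≤ M ^ (r - 1) * S := mul_le_mul_of_nonneg_left hS (Real.rpow_nonneg hM0.le _)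
    calc (∑ i, x i ^ r) ^ (1 / r) ≤ (M ^ (r - 1) * S) ^ (1 / r) :=
          Real.rpow_le_rpow (sum_nonneg fun i _ => Real.rpow_nonneg (hx i) _) h1 (by positivity)
      _ = M ^ (1 - r⁻¹) * S ^ r⁻¹ := by
          rw [Real.mul_rpow (Real.rpow_nonneg hM0.le _) hS0.le, ← Real.rpow_mul hM0.le, one_div]
          congr 2
          field_simp

/-- Hölder's inequality on a subset of the coordinates. -/
lemma sum_mul_le_norm_toLp_mul (hq : 1 < q) {x y : Fin m → ℝ} (hx : ∀ i, 0 ≤ x i)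
    (hy : ∀ i, 0 ≤ y i) (G : Finset (Fin m)) {α : ℝ} (hα : α⁻¹ = 1 - (q⁻¹).toReal) :
    ∑ i ∈ G, x i * y i ≤ ‖WithLp.toLp q x‖ * (∑ i ∈ G, y i ^ α) ^ α⁻¹ := by
  rcases eq_or_ne q ∞ with rfl | hq'
  · have : α = 1 := by simpa using hα
    subst this
    simp only [inv_one, Real.rpow_one]
    rw [mul_sum]
    exact sum_le_sum fun i _ => mul_le_mul_of_nonneg_right (le_norm_toLp hq.le x i) (hy i)
  · have hr : 1 < q.toReal := by
      rw [← ENNReal.toReal_one]; exact (ENNReal.toReal_lt_toReal ENNReal.one_ne_top hq').2 hq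
    have hconj : q.toReal.HolderConjugate α := by
      rw [Real.holderConjugate_iff]
      refine ⟨hr, ?_⟩
      rw [hα, ENNReal.toReal_inv]
      ring
    refine (Real.inner_le_Lp_mul_Lq_of_nonneg G hconj (fun i _ => hx i) (fun i _ => hy i)).trans ?_
    rw [one_div α, norm_toLp_eq hq.le hq' hx]
    refine mul_le_mul_of_nonneg_right ?_ (Real.rpow_nonneg
      (sum_nonneg fun i _ => Real.rpow_nonneg (hy i) _) _)
    refine Real.rpow_le_rpow (sum_nonneg fun i _ => Real.rpow_nonneg (hx i) _)
      (sum_le_sum_of_subset_of_nonneg (subset_univ G) fun i _ _ => Real.rpow_nonneg (hx i) _)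
      (by positivity)

end Norm

/-! ## Comparison with the optimum -/

lemma load_ofFn {m : ℕ} {l : List ℝ} (σ : Fin l.length → Fin m) (i : Fin m) :
    load (List.ofFn fun j => (l.get j, σ j)) i = ∑ j, if σ j = i then l.get j else 0 := by
  simp [load, List.map_ofFn, List.sum_ofFn]

lemma sizeArray_fin (l : List ℝ) (j : Fin l.length) : sizeArray l j = dyadicFloor (l.get j) := by
  simp [sizeArray]

section Opt

variable {m : ℕ} {q : ℝ≥0∞} {s : Fin m → ℝ} {l : List ℝ}

/-- The level is at most a constant times the objective value of any assignment. -/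
lemma level_le_objective [NeZero m] (hq : 1 < q) {α : ℝ} (hα : α⁻¹ = 1 - (q⁻¹).toReal)
    (hα0 : 0 < α) (hs : ∀ i, 0 < s i) (hl : ∀ p ∈ l, 0 < p) (hne : l ≠ [])
    (σ : Fin l.length → Fin m) :
    level α (speedArray s) m (sizeArray l) l.length
      ≤ 4 * objective q s (List.ofFn fun j => (l.get j, σ j)) := by
  set hist := List.ofFn fun j => (l.get j, σ j) with hhist
  have hlen : 0 < l.length := List.length_pos_iff.2 hne
  have hget : ∀ j, 0 < l.get j := fun j => hl _ (List.get_mem _ _)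
  have hload : ∀ i, 0 ≤ load hist i := fun i => by
    rw [hhist, load_ofFn]
    exact sum_nonneg fun j _ => by split_ifs; exacts [(hget j).le, le_rfl]
  have hjob : ∀ j, l.get j ≤ load hist (σ j) := fun j => by
    rw [hhist, load_ofFn]
    refine le_trans (by simp) (single_le_sum
      (f := fun k => if σ k = σ j then l.get k else 0) (fun k _ => ?_) (mem_univ j))
    split_ifs; exacts [(hget k).le, le_rfl]
  set x : Fin m → ℝ := fun i => load hist i / s i with hx
  have hx0 : ∀ i, 0 ≤ x i := fun i => div_nonneg (hload i) (hs i).le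
  set O := objective q s hist with hO
  have hxO : ∀ i, x i ≤ O := le_norm_toLp hq.le x
  have hxload : ∀ i, load hist i = x i * s i := fun i => (div_mul_cancel₀ _ (hs i).ne').symm
  have hOpos : 0 < O := by
    refine lt_of_lt_of_le ?_ (hxO (σ ⟨0, hlen⟩))
    exact div_pos ((hget ⟨0, hlen⟩).trans_le (hjob _)) (hs _)
  -- A power of two in (2O, 4O]: the lower bound pays for the factor two lost in rounding the
  -- speeds, the upper bound gives the constant 4.
  set T := 2 * dyadicFloor (2 * O) with hT
  have hTd : IsDyadic T := (isDyadic_dyadicFloor _).two_mul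
  have hT1 : 2 * O < T := lt_two_mul_dyadicFloor _
  have hT2 : T ≤ 4 * O := by
    have := dyadicFloor_le (x := 2 * O) (by linarith)
    linarith
  refine le_trans (level_le hα0 (fun i _ => isDyadic_speedArray s i)
    (fun k _ => isDyadic_sizeArray l k) (NeZero.pos m) hlen hTd ?_) hT2
  intro k hk
  set y := sizeArray l k with hy
  set G := univ.filter fun i : Fin m => y ≤ speedArray s i * T with hG
  have hspeed : ∀ i : Fin m, s i ≤ 2 * speedArray s i := fun i => by
    rw [speedArray_fin]; exact (lt_two_mul_dyadicFloor _).le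
  have hcap : capacity α (speedArray s) m T y = ∑ i ∈ G, speedArray s i ^ α := by
    rw [hG, sum_filter, capacity,
      ← Fin.sum_univ_eq_sum_range (fun i => if y ≤ speedArray s i * T then speedArray s i ^ α else 0)]
  -- The machine that holds job j in the given assignment finishes it by time O, hence it counts as
  -- fast enough at T > 2O even with rounded speed.
  have hmem : ∀ j : Fin l.length, y ≤ sizeArray l j → σ j ∈ G := by
    intro j hj
    refine mem_filter.2 ⟨mem_univ _, hj.trans ?_⟩
    rw [sizeArray_fin]
    refine (dyadicFloor_le (hget j)).trans ((hjob j).trans ?_)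
    rw [hxload]
    have h1 := mul_le_mul (hxO (σ j)) (hspeed (σ j)) (hs _).le hOpos.le
    have h2 := (isDyadic_speedArray s (σ j)).pos
    nlinarith
  calc ∑ k ∈ range l.length, (if y ≤ sizeArray l k then sizeArray l k else 0)
      = ∑ j : Fin l.length, (if y ≤ sizeArray l j then sizeArray l j else 0) :=
        (Fin.sum_univ_eq_sum_range
          (fun k => if y ≤ sizeArray l k then sizeArray l k else 0) _).symm
    _ ≤ ∑ j : Fin l.length, ∑ i ∈ G, if σ j = i then l.get j else 0 := by
        refine sum_le_sum fun j _ => ?_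
        split_ifs with h
        · rw [sum_ite_eq, if_pos (hmem j h), sizeArray_fin]
          exact dyadicFloor_le (hget j)
        · exact sum_nonneg fun i _ => by split_ifs; exacts [(hget j).le, le_rfl]
    _ = ∑ i ∈ G, load hist i := by
        rw [sum_comm]
        exact sum_congr rfl fun i _ => (load_ofFn σ i).symm
    _ ≤ ∑ i ∈ G, 2 * (x i * speedArray s i) := by
        refine sum_le_sum fun i _ => ?_
        rw [hxload]
        have := mul_le_mul_of_nonneg_left (hspeed i) (hx0 i)
        linarith
    _ = 2 * ∑ i ∈ G, x i * speedArray s i := (mul_sum _ _ _).symm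
    _ ≤ 2 * (O * (∑ i ∈ G, speedArray s i ^ α) ^ α⁻¹) := by
        refine mul_le_mul_of_nonneg_left ?_ two_pos.le
        exact sum_mul_le_norm_toLp_mul hq hx0 (fun i => (isDyadic_speedArray s i).pos.le) G hα
    _ ≤ T * capacity α (speedArray s) m T y ^ α⁻¹ := by
        rw [hcap, ← mul_assoc]
        refine mul_le_mul_of_nonneg_right hT1.le (Real.rpow_nonneg
          (sum_nonneg (f := fun i : Fin m => speedArray s i ^ α) fun i _ =>
            Real.rpow_nonneg (isDyadic_speedArray s i).pos.le α) _)

lemma level_le_opt [NeZero m] (hq : 1 < q) {α : ℝ} (hα : α⁻¹ = 1 - (q⁻¹).toReal)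
    (hα0 : 0 < α) (hs : ∀ i, 0 < s i) (hl : ∀ p ∈ l, 0 < p) (hne : l ≠ []) :
    level α (speedArray s) m (sizeArray l) l.length ≤ 4 * opt q s l := by
  have : level α (speedArray s) m (sizeArray l) l.length / 4 ≤ opt q s l :=
    le_ciInf fun σ => by
      have := level_le_objective hq hα hα0 hs hl hne σ
      linarith
  linarith

end Opt

/-! ## Exponential moments -/

lemma exp_le_one_add_two_mul {x : ℝ} (h0 : 0 ≤ x) (h1 : x ≤ 1) :
    Real.exp x ≤ 1 + 2 * x := by
  have h := Real.abs_exp_sub_one_sub_id_le (x := x) (by rwa [abs_of_nonneg h0])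
  have := (abs_le.1 h).2
  nlinarith

/-- Exponential moment of a linear functional of the loads with small increments. -/
lemma expect_exp_le {m : ℕ} [NeZero m] {α κ : ℝ} (hα : 0 < α) (hκ : 1 ≤ κ)
    (s : Fin m → ℝ) {c : Fin m → ℝ} (hc : ∀ i, 0 ≤ c i) {l : List ℝ} (hl : ∀ p ∈ l, 0 < p)
    (hinc : ∀ j < l.length, ∀ i : Fin m, 0 < share α κ (speedArray s) m (sizeArray l) j i →
      l.getD j 0 * c i ≤ 1)
    (ps : List ℝ) (h : History m) (hps : h.map Prod.fst ++ ps = l) :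
    (mechanism α κ m).expect s ps h (fun x => Real.exp (∑ i, c i * load x i))
      ≤ Real.exp (∑ i, c i * load h i + 2 * ∑ j ∈ Ico h.length l.length,
          l.getD j 0 * ∑ i : Fin m, share α κ (speedArray s) m (sizeArray l) j i * c i) := by
  induction ps generalizing h with
  | nil =>
    have : l.length = h.length := by simp [← hps]
    simp [Mechanism.expect, this]
  | cons p ps ih =>
    have hlen : h.length < l.length := by simp [← hps]
    have hp : l.getD h.length 0 = p := by
      rw [← hps, List.getD_append_right _ _ _ _ (by simp)]; simp
    have hp0 : 0 < p := hl p (by simp [← hps])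
    set S := ∑ i, c i * load h i with hS
    set R := ∑ j ∈ Ico (h.length + 1) l.length,
      l.getD j 0 * ∑ i : Fin m, share α κ (speedArray s) m (sizeArray l) j i * c i with hR
    set pr := (mechanism α κ m).prob s h p with hpr
    have hsh : ∀ i, pr i = share α κ (speedArray s) m (sizeArray l) h.length i :=
      prob_mechanism_of_append hα hκ s hps
    have e : ∀ i, pr i * (mechanism α κ m).expect s ps (h ++ [(p, i)])
        (fun x => Real.exp (∑ i, c i * load x i))
          ≤ Real.exp (S + 2 * R) * (pr i + 2 * (p * (pr i * c i))) := by
      intro i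
      rcases ((mechanism α κ m).prob_nonneg s h p i).eq_or_lt with h0 | h0
      · rw [← hpr] at h0; rw [← h0]; simp
      · have h1 := ih (h ++ [(p, i)]) (by simpa using hps)
        rw [sum_mul_load_append] at h1
        simp only [List.length_append, List.length_singleton] at h1
        have h2 : p * c i ≤ 1 := by
          have := hinc h.length hlen i (by rw [← hsh]; exact h0)
          rwa [hp] at this
        have h3 := exp_le_one_add_two_mul (mul_nonneg hp0.le (hc i)) h2
        have h4 : Real.exp (S + p * c i + 2 * R) = Real.exp (S + 2 * R) * Real.exp (p * c i) := by
          rw [← Real.exp_add]; ring_nf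
        rw [h4] at h1
        have h5 := h1.trans (mul_le_mul_of_nonneg_left h3 (Real.exp_pos (S + 2 * R)).le)
        have h6 := mul_le_mul_of_nonneg_left h5 h0.le
        refine h6.trans (le_of_eq ?_)
        rw [← hpr]
        ring
    have hsum : ∑ i, pr i = 1 := sum_prob_mechanism hα hκ s h p
    calc ∑ i, pr i * (mechanism α κ m).expect s ps (h ++ [(p, i)])
          (fun x => Real.exp (∑ i, c i * load x i))
        ≤ ∑ i, Real.exp (S + 2 * R) * (pr i + 2 * (p * (pr i * c i))) := sum_le_sum fun i _ => e i
      _ = Real.exp (S + 2 * R) * (2 * (p * ∑ i, pr i * c i) + 1) := by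
          rw [← mul_sum, sum_add_distrib, hsum, ← mul_sum, ← mul_sum, add_comm (1 : ℝ)]
      _ ≤ Real.exp (S + 2 * R) * Real.exp (2 * (p * ∑ i, pr i * c i)) :=
          mul_le_mul_of_nonneg_left (Real.add_one_le_exp _) (Real.exp_pos _).le
      _ = _ := by
          rw [← Real.exp_add, sum_eq_sum_Ico_succ_bot hlen, hp]
          simp only [hsh]
          congr 1
          ring

/-! ## Competitiveness -/

lemma load_nonneg {m : ℕ} {h : History m} (hh : ∀ p ∈ h.map Prod.fst, 0 < p) (i : Fin m) :
    0 ≤ load h i := by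
  refine List.sum_nonneg fun x hx => ?_
  obtain ⟨y, hy, rfl⟩ := List.mem_map.1 hx
  split_ifs
  · exact (hh _ (List.mem_map_of_mem hy)).le
  · exact le_rfl

lemma opt_nonneg {m : ℕ} {q : ℝ≥0∞} (hq : 1 ≤ q) (s : Fin m → ℝ) (l : List ℝ) :
    0 ≤ opt q s l :=
  have : Fact (1 ≤ q) := ⟨hq⟩
  Real.iInf_nonneg fun _ => norm_nonneg _

lemma ratio_nonneg (q : ℝ≥0∞) (m : ℕ) : 0 ≤ ratio q m :=
  mul_nonneg (Real.rpow_nonneg (Nat.cast_nonneg _) _)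
    (Real.rpow_nonneg (Real.log_natCast_nonneg _) _)

lemma objective_nil {m : ℕ} {q : ℝ≥0∞} (hq : 1 ≤ q) (s : Fin m → ℝ) : objective q s [] = 0 := by
  have : Fact (1 ≤ q) := ⟨hq⟩
  have : (fun i : Fin m => load [] i / s i) = 0 := by
    funext i; simp [load]
  rw [objective, this]
  exact norm_zero

/-- Since log₂ m ≥ 1 after rounding down, adding 1 at most doubles it, and 2/log 2 < 3. -/
lemma natLog_two_succ_le {m : ℕ} (hm : 2 ≤ m) :
    ((Nat.log 2 m + 1 : ℕ) : ℝ) ≤ 3 * Real.log m := by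
  have h1 : 1 ≤ Nat.log 2 m := Nat.le_log_of_pow_le one_lt_two (by simpa using hm)
  have h2 : ((2 ^ Nat.log 2 m : ℕ) : ℝ) ≤ m :=
    Nat.cast_le.2 (Nat.pow_log_le_self 2 (by omega))
  have h3 := Real.log_le_log (by positivity) h2
  push_cast at h3
  rw [Real.log_pow] at h3
  have h4 := Real.log_two_gt_d9
  have h5 : (1 : ℝ) ≤ Nat.log 2 m := by exact_mod_cast h1
  push_cast
  nlinarith

/-- This converts tail bounds exponential in Λ into inverse powers of m. -/
lemma le_exp_natLog_two_succ (m : ℕ) : (m : ℝ) ≤ Real.exp ((Nat.log 2 m + 1 : ℕ) : ℝ) := by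
  have h1 : (m : ℝ) ≤ 2 ^ (Nat.log 2 m + 1) := by
    exact_mod_cast (Nat.lt_pow_succ_log_self one_lt_two m).le
  refine h1.trans ?_
  rw [← Real.exp_one_pow]
  refine pow_le_pow_left₀ two_pos.le ?_ _
  have := Real.add_one_le_exp (1 : ℝ)
  linarith

/-! ### Moments of the normalised completion times -/

section Moments

variable {m : ℕ} [NeZero m] {α : ℝ} (hα : 1 ≤ α) {s : Fin m → ℝ} (hs : ∀ i, 0 < s i)
  {l : List ℝ} (hl : ∀ p ∈ l, 0 < p) (hne : l ≠ [])

include hα hs hne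

/-- Expected total of the normalised completion times, weighted by `e`. -/
lemma mean_completion_le {e : Fin m → ℝ} (he : ∀ i, 0 ≤ e i) :
    ∑ j ∈ Ico 0 l.length, l.getD j 0 * ∑ i : Fin m,
        share α m (speedArray s) m (sizeArray l) j i
          * (e i / (2 * level α (speedArray s) m (sizeArray l) l.length * s i))
      ≤ 4 * (Nat.log 2 m + 1 : ℕ) * ∑ i, e i * relWeight α (speedArray s) m i ^ (1 - α⁻¹) := by
  have hα0 : 0 < α := by linarith
  have hκ : (1 : ℝ) ≤ m := by exact_mod_cast NeZero.pos m
  have ha := fun i (_ : i < m) => isDyadic_speedArray s i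
  have hP := isDyadic_sizeArray l
  have hlen : 0 < l.length := List.length_pos_iff.2 hne
  set T := level α (speedArray s) m (sizeArray l) l.length with hT
  have hTpos : 0 < T := (isDyadic_level hα0 ha (fun k _ => hP k) (NeZero.pos m) hlen).pos
  have e1 : ∑ j ∈ Ico 0 l.length, l.getD j 0 * ∑ i : Fin m,
        share α m (speedArray s) m (sizeArray l) j i * (e i / (2 * T * s i))
      = ∑ i : Fin m, ∑ j ∈ range l.length, l.getD j 0 *
        (share α m (speedArray s) m (sizeArray l) j i * (e i / (2 * T * s i))) := by
    simp only [mul_sum]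
    rw [sum_comm, range_eq_Ico]
  rw [e1, mul_sum]
  refine sum_le_sum fun i _ => ?_
  have hai := (isDyadic_speedArray s i).pos
  have h1 : ∀ j ∈ range l.length, l.getD j 0 *
        (share α m (speedArray s) m (sizeArray l) j i * (e i / (2 * T * s i)))
      ≤ e i / T * (sizeArray l j * share α m (speedArray s) m (sizeArray l) j i
          / speedArray s i) := by
    intro j hj
    have hsh := share_nonneg hα0 hκ ha (fun k (_ : k < j + 1) => hP k) (NeZero.pos m) i.2
    -- Rounding a size loses at most a factor two, cancelled by the 2 in the normalisation; rounding
    -- a speed only increases the bound.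
    have h2 : l.getD j 0 ≤ 2 * sizeArray l j := (lt_two_mul_dyadicFloor _).le
    have h3 : speedArray s i ≤ s i := by rw [speedArray_fin]; exact dyadicFloor_le (hs i)
    calc l.getD j 0 * (share α m (speedArray s) m (sizeArray l) j i * (e i / (2 * T * s i)))
        ≤ 2 * sizeArray l j * (share α m (speedArray s) m (sizeArray l) j i
            * (e i / (2 * T * speedArray s i))) := by
          have h4 := (hP j).pos
          have h5 := he i
          gcongr
          exact mul_nonneg hsh (div_nonneg h5 (by have := hs i; positivity))
      _ = _ := by field_simp
  refine (sum_le_sum h1).trans ?_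
  rw [← mul_sum, ← sum_div]
  have h2 := sum_size_mul_share_le hα ha hP (NeZero.pos m) hlen i.2
  have h3 := mul_le_mul_of_nonneg_left h2 (div_nonneg (he i) hTpos.le)
  refine h3.trans (le_of_eq ?_)
  rw [← hT]
  field_simp

include hl in
-- Dividing by 2T s_i makes increments at most 1: a job placed on machine i has rounded size at most
-- a_i times the level at its arrival, which is at most s_i T. The 8 is the 4 of the mean bound
-- times the 2 of the exponential estimate.
lemma expect_exp_completion_le {e : Fin m → ℝ} (he : ∀ i, 0 ≤ e i) (he1 : ∀ i, e i ≤ 1) :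
    (mechanism α m m).expect s l [] (fun x => Real.exp (∑ i,
        e i / (2 * level α (speedArray s) m (sizeArray l) l.length * s i) * load x i))
      ≤ Real.exp (8 * (Nat.log 2 m + 1 : ℕ)
          * ∑ i, e i * relWeight α (speedArray s) m i ^ (1 - α⁻¹)) := by
  have hα0 : 0 < α := by linarith
  have hκ : (1 : ℝ) ≤ m := by exact_mod_cast NeZero.pos m
  have ha := fun i (_ : i < m) => isDyadic_speedArray s i
  have hP := isDyadic_sizeArray l
  have hlen : 0 < l.length := List.length_pos_iff.2 hne
  set T := level α (speedArray s) m (sizeArray l) l.length with hT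
  have hTpos : 0 < T := (isDyadic_level hα0 ha (fun k _ => hP k) (NeZero.pos m) hlen).pos
  have hden : ∀ i, 0 < 2 * T * s i := fun i => by have := hs i; positivity
  refine (expect_exp_le hα0 hκ s (c := fun i => e i / (2 * T * s i))
    (fun i => div_nonneg (he i) (hden i).le) hl ?_ l [] rfl).trans ?_
  · intro j hj i hsh
    rw [share_pos_iff hα0 hκ ha (fun k _ => hP k) (NeZero.pos m) i.2] at hsh
    have h1 : l.getD j 0 ≤ 2 * sizeArray l j := (lt_two_mul_dyadicFloor _).le
    have h2 : speedArray s i ≤ s i := by rw [speedArray_fin]; exact dyadicFloor_le (hs i)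
    have h3 : level α (speedArray s) m (sizeArray l) (j + 1) ≤ T :=
      level_mono hα0 ha hP (NeZero.pos m) (Nat.succ_pos j) hj
    have h4 : sizeArray l j ≤ s i * T :=
      hsh.1.trans (mul_le_mul h2 h3 (isDyadic_level hα0 ha (fun k _ => hP k) (NeZero.pos m)
        (Nat.succ_pos j)).pos.le (hs i).le)
    have h5 : 0 ≤ l.getD j 0 := by
      rw [List.getD_eq_getElem _ _ hj]; exact (hl _ (List.getElem_mem hj)).le
    rw [mul_div_assoc', div_le_one (hden i)]
    calc l.getD j 0 * e i ≤ l.getD j 0 * 1 := mul_le_mul_of_nonneg_left (he1 i) h5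
      _ ≤ 2 * T * s i := by linarith
  · refine Real.exp_le_exp.2 ?_
    have h1 := mean_completion_le hα hs hne he
    rw [← hT] at h1
    simp only [load, List.map_nil, List.sum_nil, mul_zero, sum_const_zero, zero_add,
      List.length_nil]
    linarith

end Moments

/-! ### Competitiveness for q > 1 -/

section Competitive

variable {m : ℕ} [NeZero m] {q : ℝ≥0∞} {α : ℝ}

/-- The exponents of the theorem appear here: Λ has exponent (1 − v) + (1 + v)v = 1 + v² and m has
(1 − v)v. The constant is 2 · 4 · 12 · 9, with 4 from level against optimum and 9 from replacing Λ
by log m. -/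
lemma bound_le (hm : 2 ≤ m) (hq : 1 < q) (hα : α⁻¹ = 1 - (q⁻¹).toReal) (hα1 : 1 ≤ α)
    {s : Fin m → ℝ} (hs : ∀ i, 0 < s i) {l : List ℝ} (hl : ∀ p ∈ l, 0 < p) (hne : l ≠ []) :
    2 * level α (speedArray s) m (sizeArray l) l.length *
      ((12 * (Nat.log 2 m + 1 : ℕ)) ^ (1 - (q⁻¹).toReal) *
        (12 * ((m : ℝ) ^ (1 - (q⁻¹).toReal) * ((Nat.log 2 m + 1 : ℕ) : ℝ) ^ (1 + (q⁻¹).toReal)))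
          ^ (q⁻¹).toReal) ≤ 864 * ratio q m * opt q s l := by
  have hα0 : 0 < α := by linarith
  set v := (q⁻¹).toReal with hv
  have hv0 : 0 ≤ v := ENNReal.toReal_nonneg
  have hv1 : v ≤ 1 := by
    have := inv_pos.2 hα0
    linarith
  have hopt := level_le_opt hq hα hα0 hs hl hne
  set T := level α (speedArray s) m (sizeArray l) l.length with hT
  have hlog := natLog_two_succ_le hm
  set Λ : ℝ := ((Nat.log 2 m + 1 : ℕ) : ℝ) with hΛ
  have hΛpos : 0 < Λ := by rw [hΛ]; positivity
  have hm0 : (0 : ℝ) < m := by exact_mod_cast NeZero.pos m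
  have hlm : 0 ≤ Real.log m := Real.log_natCast_nonneg _
  have e1 : (12 * Λ) ^ (1 - v) * (12 * ((m : ℝ) ^ (1 - v) * Λ ^ (1 + v))) ^ v
      = 12 * ((m : ℝ) ^ (v * (1 - v)) * Λ ^ (1 + v ^ 2)) := by
    rw [Real.mul_rpow (by norm_num) hΛpos.le, Real.mul_rpow (by norm_num) (by positivity),
      Real.mul_rpow (by positivity) (by positivity), ← Real.rpow_mul hm0.le,
      ← Real.rpow_mul hΛpos.le]
    have e2 : (12 : ℝ) ^ (1 - v) * 12 ^ v = 12 := by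
      rw [← Real.rpow_add (by norm_num)]; simp
    have e3 : Λ ^ (1 - v) * Λ ^ ((1 + v) * v) = Λ ^ (1 + v ^ 2) := by
      rw [← Real.rpow_add hΛpos]; congr 1; ring
    rw [mul_comm v (1 - v)]
    calc _ = ((12 : ℝ) ^ (1 - v) * 12 ^ v) * ((m : ℝ) ^ ((1 - v) * v)
          * (Λ ^ (1 - v) * Λ ^ ((1 + v) * v))) := by ring
      _ = _ := by rw [e2, e3]
  have h9 : Λ ^ (1 + v ^ 2) ≤ 9 * Real.log m ^ (1 + v ^ 2) := by
    calc Λ ^ (1 + v ^ 2) ≤ (3 * Real.log m) ^ (1 + v ^ 2) :=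
          Real.rpow_le_rpow hΛpos.le hlog (by positivity)
      _ = 3 ^ (1 + v ^ 2) * Real.log m ^ (1 + v ^ 2) := Real.mul_rpow (by norm_num) hlm
      _ ≤ 9 * Real.log m ^ (1 + v ^ 2) := by
          refine mul_le_mul_of_nonneg_right ?_ (Real.rpow_nonneg hlm _)
          calc (3 : ℝ) ^ (1 + v ^ 2) ≤ 3 ^ (2 : ℝ) :=
                Real.rpow_le_rpow_of_exponent_le (by norm_num) (by nlinarith)
            _ = 9 := by norm_num
  rw [e1]
  have hopt0 := opt_nonneg hq.le s l
  calc 2 * T * (12 * ((m : ℝ) ^ (v * (1 - v)) * Λ ^ (1 + v ^ 2)))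
      ≤ 2 * (4 * opt q s l) * (12 * ((m : ℝ) ^ (v * (1 - v))
          * (9 * Real.log m ^ (1 + v ^ 2)))) := by gcongr
    _ = 864 * ratio q m * opt q s l := by rw [ratio, ← hv]; ring

/-- The two competitiveness properties for `1 < q`. -/
lemma competitive_mechanism (hm : 2 ≤ m) (hq : 1 < q) (hα : α⁻¹ = 1 - (q⁻¹).toReal)
    (hα1 : 1 ≤ α) {s : Fin m → ℝ} (hs : ∀ i, 0 < s i) {l : List ℝ} (hl : ∀ p ∈ l, 0 < p)
    (hne : l ≠ []) :
    (mechanism α m m).expect s l [] (objective q s) ≤ 2000 * ratio q m * opt q s l ∧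
    1 - 1 / (m : ℝ) ^ 2 ≤ (mechanism α m m).probability s l
      {h | objective q s h ≤ 2000 * ratio q m * opt q s l} := by
  have hα0 : 0 < α := by linarith
  have hκ : (1 : ℝ) ≤ m := by exact_mod_cast NeZero.pos m
  have hm0 : (0 : ℝ) < m := by linarith
  have ha := fun i (_ : i < m) => isDyadic_speedArray s i
  have hP := isDyadic_sizeArray l
  have hlen : 0 < l.length := List.length_pos_iff.2 hne
  have hbound := bound_le hm hq hα hα1 hs hl hne
  have hmean := mean_completion_le hα1 hs hne (e := fun _ => 1) fun _ => zero_le_one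
  have hexp := fun (e : Fin m → ℝ) => expect_exp_completion_le hα1 hs hl hne (e := e)
  have hrel : ∑ i : Fin m, relWeight α (speedArray s) m i ^ (1 - α⁻¹)
      ≤ (m : ℝ) ^ (1 - (q⁻¹).toReal) * ((Nat.log 2 m + 1 : ℕ) : ℝ) ^ (q⁻¹).toReal := by
    rw [Fin.sum_univ_eq_sum_range (fun i => relWeight α (speedArray s) m i ^ (1 - α⁻¹))]
    have := sum_relWeight_rpow_le (α := α) ha (NeZero.pos m) (v := 1 - α⁻¹)
      (sub_nonneg.2 (inv_le_one_of_one_le₀ hα1)) (sub_le_self _ (inv_nonneg.2 hα0.le))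
    have e : 1 - α⁻¹ = (q⁻¹).toReal := by rw [hα]; ring
    rw [e] at this ⊢
    exact this
  have hΛm := le_exp_natLog_two_succ m
  set v := (q⁻¹).toReal with hv
  set T := level α (speedArray s) m (sizeArray l) l.length with hT
  set Λ : ℝ := ((Nat.log 2 m + 1 : ℕ) : ℝ) with hΛ
  have hv0 : 0 ≤ v := ENNReal.toReal_nonneg
  have hv1 : v ≤ 1 := by
    have := inv_pos.2 hα0
    linarith
  have hTpos : 0 < T := (isDyadic_level hα0 ha (fun k _ => hP k) (NeZero.pos m) hlen).pos
  have hΛ1 : 1 ≤ Λ := by rw [hΛ]; exact_mod_cast Nat.succ_le_succ (Nat.zero_le _)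
  have hΛpos : 0 < Λ := by linarith
  -- The moments are at most e^(8Λ) and e^(8W); thresholds with 12 in place of 8 leave a factor
  -- e^(-4Λ) ≤ m^(-4) in each tail.
  set A := 12 * Λ with hA
  set W := (m : ℝ) ^ (1 - v) * Λ ^ (1 + v) with hW
  set B := 12 * W with hB
  have hApos : 0 < A := by positivity
  have hWpos : 0 < W := by positivity
  have hBpos : 0 < B := by positivity
  have hWrel : Λ * ((m : ℝ) ^ (1 - v) * Λ ^ v) = W := by
    rw [hW, Real.rpow_add hΛpos, Real.rpow_one]; ring
  have hΛW : Λ ≤ W := by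
    have h1 : 1 ≤ (m : ℝ) ^ (1 - v) := Real.one_le_rpow hκ (by linarith)
    have h2 : 1 ≤ Λ ^ v := Real.one_le_rpow hΛ1 hv0
    rw [← hWrel]
    exact le_mul_of_one_le_right hΛpos.le (one_le_mul_of_one_le_of_one_le h1 h2)
  set M := mechanism α m m with hM
  have hprob := sum_prob_mechanism (m := m) hα0 hκ s
  set X : History m → Fin m → ℝ := fun h i => load h i / (2 * T * s i) with hX
  have hden : ∀ i, 0 < 2 * T * s i := fun i => by have := hs i; positivity
  -- moments
  have hE1 : ∀ i, M.expect s l [] (fun h => Real.exp (X h i)) ≤ Real.exp (8 * Λ) := by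
    intro i
    have h1 := hexp (Pi.single i 1)
      (fun k => by by_cases h : k = i <;> simp [h])
      (fun k => by by_cases h : k = i <;> simp [h])
    have e1 : ∀ h : History m, ∑ k, (Pi.single i 1 : Fin m → ℝ) k / (2 * T * s k) * load h k
        = X h i := by
      intro h
      rw [sum_eq_single i (fun k _ hk => by simp [hk]) (by simp)]
      simp [hX]
      ring
    simp only [e1] at h1
    refine h1.trans (Real.exp_le_exp.2 ?_)
    rw [sum_eq_single i (fun k _ hk => by simp [hk]) (by simp), Pi.single_eq_same, one_mul]
    have h2 : relWeight α (speedArray s) m i ^ (1 - α⁻¹) ≤ 1 :=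
      Real.rpow_le_one (relWeight_nonneg ha i.2) (relWeight_le_one ha i.2)
        (sub_nonneg.2 (inv_le_one_of_one_le₀ hα1))
    exact mul_le_of_le_one_right (by positivity) h2
  have e2 : ∀ h : History m, ∑ k, 1 / (2 * T * s k) * load h k = ∑ k, X h k := fun h =>
    sum_congr rfl fun k _ => by rw [hX]; ring
  have hE2 : M.expect s l [] (fun h => Real.exp (∑ k, X h k)) ≤ Real.exp (8 * W) := by
    have h1 := hexp (fun _ => 1) (fun _ => zero_le_one) (fun _ => le_rfl)
    simp only [e2, one_mul] at h1
    refine h1.trans (Real.exp_le_exp.2 ?_)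
    rw [← hWrel, mul_assoc]
    gcongr
  have hE3 : M.expect s l [] (fun h => ∑ k, X h k) ≤ 4 * W := by
    have h1 := expect_sum_mul_load hα0 hκ s (fun k => 1 / (2 * T * s k)) l [] (l := l) rfl
    simp only [e2] at h1
    rw [h1]
    simp only [one_mul] at hmean
    simp only [load, List.map_nil, List.sum_nil, sum_const_zero, zero_add, List.length_nil, hX,
      zero_div]
    refine hmean.trans ?_
    rw [← hWrel, mul_assoc]
    gcongr
  -- tails
  set Z : History m → ℝ := fun h => ∑ i, Real.exp (-A) * Real.exp (X h i) with hZ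
  set Z' : History m → ℝ := fun h => Real.exp (-B) * Real.exp (∑ k, X h k) with hZ'
  have hEZ : M.expect s l [] Z ≤ m * Real.exp (-(4 * Λ)) := by
    rw [hZ, M.expect_sum s univ hprob]
    calc ∑ i, M.expect s l [] (fun h => Real.exp (-A) * Real.exp (X h i))
        ≤ ∑ i : Fin m, Real.exp (-(4 * Λ)) := by
          refine sum_le_sum fun i _ => ?_
          rw [M.expect_const_mul]
          calc _ ≤ Real.exp (-A) * Real.exp (8 * Λ) :=
                mul_le_mul_of_nonneg_left (hE1 i) (Real.exp_pos _).le
            _ = Real.exp (-(4 * Λ)) := by rw [← Real.exp_add, hA]; ring_nf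
      _ = m * Real.exp (-(4 * Λ)) := by simp
  have hEZ' : M.expect s l [] Z' ≤ Real.exp (-(4 * Λ)) := by
    rw [hZ', M.expect_const_mul]
    calc _ ≤ Real.exp (-B) * Real.exp (8 * W) :=
          mul_le_mul_of_nonneg_left hE2 (Real.exp_pos _).le
      _ ≤ Real.exp (-(4 * Λ)) := by
          rw [← Real.exp_add, hB]
          exact Real.exp_le_exp.2 (by linarith)
  have hexpm : Real.exp (-(4 * Λ)) ≤ 1 / (m : ℝ) ^ 4 := by
    rw [Real.exp_neg, ← one_div]
    refine one_div_le_one_div_of_le (by positivity) ?_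
    have e : Real.exp (4 * Λ) = Real.exp Λ ^ 4 := by
      rw [← Real.exp_nat_mul]; norm_num
    rw [e]
    exact pow_le_pow_left₀ hm0.le hΛm 4
  -- pointwise bounds
  have hobj : ∀ h : History m, objective q s h = 2 * T * ‖WithLp.toLp q (X h)‖ := by
    intro h
    rw [← norm_toLp_smul_const hq.le (by positivity), objective]
    have : (fun i => load h i / s i) = fun i => 2 * T * X h i := by
      funext i
      have := (hs i).ne'
      simp only [hX]
      field_simp
    rw [this]
  have hX0 : ∀ h : History m, h.map Prod.fst = l → ∀ i, 0 ≤ X h i := fun h hh i =>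
    div_nonneg (load_nonneg (by rwa [hh]) i) (hden i).le
  have hterm : ∀ (h : History m) i, Real.exp (X h i - A) ≤ Z h := by
    intro h i
    rw [sub_eq_neg_add, Real.exp_add]
    exact single_le_sum (f := fun i => Real.exp (-A) * Real.exp (X h i))
      (fun k _ => by positivity) (mem_univ i)
  have hratio0 := mul_nonneg (ratio_nonneg q m) (opt_nonneg hq.le s l)
  constructor
  -- On every history the maximum is at most A + Z. Weighted AM–GM then linearises the interpolation
  -- bound in Z and in the sum, so that expectations can be taken termwise.
  · have hpt : ∀ h : History m, h.map Prod.fst = l → objective q s h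
        ≤ 2 * T * (A ^ (1 - v) * B ^ v) * (1 - v)
          + (2 * T * (A ^ (1 - v) * B ^ v) * (1 - v) / A * Z h
            + 2 * T * (A ^ (1 - v) * B ^ v) * (v / B) * (1 * ∑ k, X h k + 1)) := by
      intro h hh
      have hZ0 : 0 ≤ Z h := sum_nonneg fun i _ => by positivity
      have hS0 : 0 ≤ ∑ k, X h k := sum_nonneg fun k _ => hX0 h hh k
      have h1 : ∀ i, X h i ≤ A + Z h := fun i => by
        have := Real.add_one_le_exp (X h i - A)
        linarith [hterm h i]
      -- The summand 1 keeps the bound on the sum positive, as the interpolation lemma requires.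
      have h2 := norm_toLp_le hq.le (hX0 h hh) (M := A + Z h) (S := 1 * ∑ k, X h k + 1)
        (by linarith) (by linarith) h1 (by linarith)
      rw [← hv] at h2
      have h3 := Real.geom_mean_le_arith_mean2_weighted (sub_nonneg.2 hv1) hv0
        (p₁ := (A + Z h) / A) (p₂ := (1 * ∑ k, X h k + 1) / B) (by positivity) (by positivity)
        (by ring)
      rw [Real.div_rpow (by linarith) hApos.le, Real.div_rpow (by linarith) hBpos.le,
        div_mul_div_comm, div_le_iff₀ (by positivity)] at h3
      rw [hobj]
      have h4 := mul_le_mul_of_nonneg_left (h2.trans h3) (by positivity : 0 ≤ 2 * T)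
      refine h4.trans (le_of_eq ?_)
      field_simp
      ring
    refine (M.expect_le_of_sizes s l hpt).trans ?_
    rw [M.expect_add, M.expect_add, M.expect_const s hprob, M.expect_const_mul,
      M.expect_const_mul, M.expect_add, M.expect_const s hprob, M.expect_const_mul]
    -- The three terms add up to at most 2G, and G is bounded by 864 times ratio times optimum;
    -- hence the constant 2000.
    set G := 2 * T * (A ^ (1 - v) * B ^ v) with hG
    have hG0 : 0 ≤ G := by positivity
    have h1 : m * Real.exp (-(4 * Λ)) ≤ 1 := by
      calc m * Real.exp (-(4 * Λ)) ≤ m * (1 / (m : ℝ) ^ 4) :=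
            mul_le_mul_of_nonneg_left hexpm hm0.le
        _ = 1 / (m : ℝ) ^ 3 := by field_simp
        _ ≤ 1 := (div_le_one (by positivity)).2 (one_le_pow₀ hκ)
    have h2 : G * (1 - v) / A * M.expect s l [] Z ≤ G * (1 - v) := by
      rw [div_mul_eq_mul_div, mul_div_assoc]
      refine mul_le_of_le_one_right (mul_nonneg hG0 (by linarith)) ?_
      rw [div_le_one hApos]
      linarith
    have h3 : G * (v / B) * (1 * M.expect s l [] (fun h => ∑ k, X h k) + 1) ≤ G * v := by
      rw [mul_assoc, div_mul_eq_mul_div]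
      refine mul_le_mul_of_nonneg_left ?_ hG0
      rw [mul_div_assoc]
      refine mul_le_of_le_one_right hv0 ?_
      rw [div_le_one hBpos]
      linarith
    have h4 : G * (1 - v) ≤ G := mul_le_of_le_one_right hG0 (by linarith)
    linarith
  · have hpt : ∀ h : History m, h.map Prod.fst = l → 1 + (-1) * (Z h + Z' h)
        ≤ ({h | objective q s h ≤ 2000 * ratio q m * opt q s l} : Set (History m)).indicator
            1 h := by
      intro h hh
      have hZ0 : 0 ≤ Z h := sum_nonneg fun i _ => by positivity
      have hZ'0 : 0 ≤ Z' h := by positivity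
      by_cases hgood : (∀ i, X h i ≤ A) ∧ ∑ k, X h k ≤ B
      · rw [Set.indicator_of_mem]
        · simp only [Pi.one_apply]; linarith
        · have h2 := norm_toLp_le hq.le (hX0 h hh) hApos hBpos hgood.1 hgood.2
          rw [Set.mem_ofPred_eq, hobj]
          have h3 := mul_le_mul_of_nonneg_left h2 (by positivity : 0 ≤ 2 * T)
          rw [← hv] at h3
          linarith
      · have h1 : 1 ≤ Z h + Z' h := by
          rw [not_and_or] at hgood
          rcases hgood with hbad | hbad
          · push Not at hbad
            obtain ⟨i, hi⟩ := hbad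
            have := Real.one_le_exp (x := X h i - A) (by linarith)
            linarith [hterm h i]
          · have h2 := Real.one_le_exp (x := -B + ∑ k, X h k) (by linarith)
            rw [Real.exp_add] at h2
            linarith
        refine le_trans (by linarith) (Set.indicator_nonneg (fun _ _ => zero_le_one) h)
    refine le_trans ?_ (M.expect_le_of_sizes s l hpt)
    rw [M.expect_add, M.expect_const s hprob, M.expect_const_mul, M.expect_add]
    -- Union bound over m machines and the sum: m + 1 tails of m^(-4) each, and m + 1 ≤ m² for m ≥
    -- 2.
    have h1 : ((m : ℝ) + 1) * (1 / (m : ℝ) ^ 4) ≤ 1 / (m : ℝ) ^ 2 := by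
      have hm2 : (2 : ℝ) ≤ m := by exact_mod_cast hm
      rw [mul_one_div, div_le_div_iff₀ (by positivity) (by positivity)]
      have hm3 : (m : ℝ) + 1 ≤ (m : ℝ) ^ 2 := by nlinarith
      have := mul_le_mul_of_nonneg_right hm3 (pow_pos hm0 2).le
      nlinarith
    have h2 := mul_le_mul_of_nonneg_left hexpm (by linarith : (0 : ℝ) ≤ m + 1)
    linarith

end Competitive

/-! ## The sum of completion times -/

/-- For `q = 1` only machines of maximal rounded speed are used. -/
lemma objective_one_le {m : ℕ} [NeZero m] {s : Fin m → ℝ} (hs : ∀ i, 0 < s i) {l : List ℝ}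
    (hl : ∀ p ∈ l, 0 < p) {h : History m} (hh : h.map Prod.fst = l)
    (hfast : ∀ x ∈ h, runMax (speedArray s) m ≤ speedArray s x.2) :
    objective 1 s h ≤ 2 * opt 1 s l := by
  have ha := fun i (_ : i < m) => isDyadic_speedArray s i
  have hA := (isDyadic_runMax ha (NeZero.pos m)).pos
  set A := runMax (speedArray s) m
  have hobj : ∀ g : History m, (∀ p ∈ g.map Prod.fst, 0 < p) →
      objective 1 s g = ∑ i, load g i / s i := by
    intro g hg
    rw [objective, norm_toLp_eq le_rfl ENNReal.one_ne_top
      fun i => div_nonneg (load_nonneg hg i) (hs i).le]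
    simp
  -- For q = 1 the objective is additive over jobs, so each job can be compared with the fastest
  -- machine separately.
  have hjobs : ∀ g : History m, ∑ i, load g i / s i = (g.map fun x => x.1 / s x.2).sum := by
    intro g
    induction g using List.reverseRecOn with
    | nil => simp [load]
    | append_singleton g x ih =>
      obtain ⟨p, i⟩ := x
      simp only [load_append, add_div, sum_add_distrib, ih, List.map_append, List.map_cons,
        List.map_nil, List.sum_append, List.sum_singleton]
      rw [sum_eq_single i (fun k _ hk => by simp [Ne.symm hk]) (by simp)]
      simp
  have h1 : objective 1 s h ≤ l.sum / A := by
    rw [hobj h (by rwa [hh]), hjobs, ← hh, div_eq_mul_inv, ← List.sum_map_mul_right]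
    refine List.sum_le_sum fun x hx => ?_
    have hx0 : 0 < x.1 := hl _ (hh ▸ List.mem_map_of_mem hx)
    have h2 : A ≤ s x.2 := (hfast x hx).trans (by
      rw [speedArray_fin]; exact dyadicFloor_le (hs _))
    rw [← div_eq_mul_inv]
    exact div_le_div_of_nonneg_left hx0.le hA h2
  have h2 : l.sum / A / 2 ≤ opt 1 s l := by
    refine le_ciInf fun σ => ?_
    set g : History m := List.ofFn fun j => (l.get j, σ j) with hg
    have hgl : g.map Prod.fst = l := by
      rw [hg, List.map_ofFn]
      exact List.ofFn_get l
    rw [hobj g (by rwa [hgl]), hjobs, div_div, ← hgl, div_eq_mul_inv, ← List.sum_map_mul_right]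
    refine List.sum_le_sum fun x hx => ?_
    have hx0 : 0 < x.1 := hl _ (hgl ▸ List.mem_map_of_mem hx)
    have h3 : s x.2 ≤ A * 2 := by
      have h4 : speedArray s x.2 ≤ A := le_runMax x.2.2
      rw [speedArray_fin] at h4
      have := lt_two_mul_dyadicFloor (s x.2)
      linarith
    rw [← div_eq_mul_inv]
    exact div_le_div_of_nonneg_left hx0.le (hs _) h3
  linarith

/-- With κ = 1 only machines of maximal rounded speed have positive probability. The factor 2 thus
holds on every reachable history, and both claims follow because 2000 log² m exceeds 2. -/
lemma competitive_one {m : ℕ} [NeZero m] (hm : 2 ≤ m) {s : Fin m → ℝ} (hs : ∀ i, 0 < s i)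
    {l : List ℝ} (hl : ∀ p ∈ l, 0 < p) :
    (mechanism 1 1 m).expect s l [] (objective 1 s) ≤ 2000 * ratio 1 m * opt 1 s l ∧
    1 - 1 / (m : ℝ) ^ 2 ≤ (mechanism 1 1 m).probability s l
      {h | objective 1 s h ≤ 2000 * ratio 1 m * opt 1 s l} := by
  have ha := fun i (_ : i < m) => isDyadic_speedArray s i
  set M := mechanism 1 1 m
  have hprob := sum_prob_mechanism (m := m) one_pos le_rfl s
  have hr : 2 ≤ 2000 * ratio 1 m := by
    have h1 := natLog_two_succ_le hm
    have h2 : 1 ≤ Nat.log 2 m := Nat.le_log_of_pow_le one_lt_two (by simpa using hm)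
    have h3 : (1 : ℝ) ≤ Nat.log 2 m := by exact_mod_cast h2
    have h4 : ratio 1 m = Real.log m ^ 2 := by
      simp only [ratio, inv_one, ENNReal.toReal_one, sub_self, mul_zero, Real.rpow_zero, one_mul,
        one_pow]
      norm_num
    push_cast at h1
    rw [h4]
    nlinarith
  have hopt := opt_nonneg le_rfl s l
  have hle : 2 * opt 1 s l ≤ 2000 * ratio 1 m * opt 1 s l := mul_le_mul_of_nonneg_right hr hopt
  have key : ∀ f g : History m → ℝ, (∀ h : History m, objective 1 s h ≤ 2 * opt 1 s l →
      f h ≤ g h) → M.expect s l [] f ≤ M.expect s l [] g := by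
    intro f g hfg
    refine M.expect_le_of_invariant s (fun qs h => h.map Prod.fst ++ qs = l ∧
      ∀ x ∈ h, runMax (speedArray s) m ≤ speedArray s x.2) ?_ ?_ l [] ⟨rfl, by simp⟩
    · rintro p ps h i ⟨h1, h2⟩ hpos
      refine ⟨by simpa using h1, fun x hx => ?_⟩
      rcases List.mem_append.1 hx with hx | hx
      · exact h2 x hx
      · rw [List.mem_singleton.1 hx]
        rw [prob_mechanism_of_append one_pos le_rfl s h1, share_pos_iff one_pos le_rfl ha
          (fun k _ => isDyadic_sizeArray l k) (NeZero.pos m) i.2, one_mul] at hpos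
        exact hpos.2
    · rintro h ⟨h1, h2⟩
      exact hfg h (objective_one_le hs hl (by simpa using h1) h2)
  constructor
  · refine (key _ (fun _ => 2000 * ratio 1 m * opt 1 s l) fun h hh => hh.trans hle).trans ?_
    rw [M.expect_const s hprob]
  · have h1 := key (fun _ => 1) (({h | objective 1 s h ≤ 2000 * ratio 1 m * opt 1 s l} :
      Set (History m)).indicator 1) fun h hh => by
        rw [Set.indicator_of_mem (show h ∈ {h | objective 1 s h ≤ _} from hh.trans hle)]
        exact le_rfl
    rw [M.expect_const s hprob] at h1
    refine le_trans ?_ h1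
    have : 0 ≤ 1 / (m : ℝ) ^ 2 := by positivity
    linarith

/-- Without jobs the level is 0 and cannot be used for normalisation, so this case stands apart. -/
lemma competitive_nil {m : ℕ} {q : ℝ≥0∞} (hq : 1 ≤ q) (M : Mechanism m) (s : Fin m → ℝ) :
    M.expect s [] [] (objective q s) ≤ 2000 * ratio q m * opt q s [] ∧
    1 - 1 / (m : ℝ) ^ 2 ≤ M.probability s []
      {h | objective q s h ≤ 2000 * ratio q m * opt q s []} := by
  have h0 : 0 ≤ 2000 * ratio q m * opt q s [] :=
    mul_nonneg (mul_nonneg (by norm_num) (ratio_nonneg q m)) (opt_nonneg hq s [])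
  constructor
  · rw [Mechanism.expect, objective_nil hq]
    exact h0
  · rw [Mechanism.probability, Mechanism.expect, Set.indicator_of_mem]
    · simp
    · rw [Set.mem_ofPred_eq, objective_nil hq]
      exact h0

/-- The exponent conjugate to `q`, or `1` if `q = 1`. -/
noncomputable def weightExponent (q : ℝ≥0∞) : ℝ :=
  if q = 1 then 1 else (1 - (q⁻¹).toReal)⁻¹

/-- The admissible speed ratio: `1` if `q = 1`, and the number of machines otherwise. -/
noncomputable def speedRatio (q : ℝ≥0∞) (m : ℕ) : ℕ := if q = 1 then 1 else m

lemma one_le_weightExponent {q : ℝ≥0∞} (hq : 1 ≤ q) : 1 ≤ weightExponent q := by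
  unfold weightExponent
  split_ifs with h
  · exact le_rfl
  · have h1 : (q⁻¹).toReal < 1 := by
      rw [← ENNReal.toReal_one]
      exact (ENNReal.toReal_lt_toReal (ENNReal.inv_ne_top.2 (zero_lt_one.trans_le hq).ne')
        ENNReal.one_ne_top).2 (ENNReal.inv_lt_one.2 (lt_of_le_of_ne hq (Ne.symm h)))
    refine (one_le_inv₀ (by linarith)).2 ?_
    linarith [ENNReal.toReal_nonneg (a := q⁻¹)]

lemma one_le_speedRatio (q : ℝ≥0∞) (m : ℕ) [NeZero m] : (1 : ℝ) ≤ speedRatio q m := by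
  unfold speedRatio
  split_ifs
  · simp
  · exact_mod_cast NeZero.pos m

lemma competitive {m : ℕ} [NeZero m] (hm : 2 ≤ m) {q : ℝ≥0∞} (hq : 1 ≤ q) {s : Fin m → ℝ}
    (hs : ∀ i, 0 < s i) {l : List ℝ} (hl : ∀ p ∈ l, 0 < p) :
    (mechanism (weightExponent q) (speedRatio q m) m).expect s l [] (objective q s)
      ≤ 2000 * ratio q m * opt q s l ∧
    1 - 1 / (m : ℝ) ^ 2 ≤ (mechanism (weightExponent q) (speedRatio q m) m).probability s l
      {h | objective q s h ≤ 2000 * ratio q m * opt q s l} := by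
  rcases eq_or_ne q 1 with rfl | hq1
  · rw [weightExponent, speedRatio, if_pos rfl, if_pos rfl, Nat.cast_one]
    exact competitive_one hm hs hl
  · rcases eq_or_ne l [] with rfl | hne
    · exact competitive_nil hq _ s
    · have h1 := one_le_weightExponent hq
      have h2 : (weightExponent q)⁻¹ = 1 - (q⁻¹).toReal := by
        rw [weightExponent, if_neg hq1, inv_inv]
      rw [speedRatio, if_neg hq1]
      exact competitive_mechanism hm (lt_of_le_of_ne hq (Ne.symm hq1)) h2 h1 hs hl hne

end Scheduling

/-! ### Correctness and step counts of real RAM programs -/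

namespace RealRAM

/-! ## Program logic -/

/-- Number of steps of a program whose loops make at most `N` iterations each. -/
def Prog.cost (N : ℕ) : Prog → ℕ
  | .setNat _ _ _ => 1
  | .setReal _ _ _ => 1
  | .seq c d => c.cost N + d.cost N
  | .cond _ c d => c.cost N + d.cost N + 1
  | .loop _ c => N * (c.cost N + 1) + 1

/-- Structural induction: nesting loops multiplies the cost by N, so the degree depends on the
program alone. Using one number as both coefficient and degree keeps the induction hypothesis
closed. -/
lemma Prog.exists_cost_le (c : Prog) : ∃ d : ℕ, ∀ N, 1 ≤ N → c.cost N ≤ d * N ^ d := by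
  have key : ∀ d e N : ℕ, 1 ≤ N → d ≤ e → d * N ^ d ≤ e * N ^ e := fun d e N hN h =>
    Nat.mul_le_mul h (Nat.pow_le_pow_right hN h)
  induction c with
  | setNat a i e => exact ⟨1, fun N hN => by simpa [cost] using hN⟩
  | setReal a i e => exact ⟨1, fun N hN => by simpa [cost] using hN⟩
  | seq c d hc hd =>
    obtain ⟨k, hk⟩ := hc
    obtain ⟨l, hl⟩ := hd
    refine ⟨k + l, fun N hN => ?_⟩
    have h1 := Nat.pow_le_pow_right hN (Nat.le_add_right k l)
    have h2 := Nat.pow_le_pow_right hN (Nat.le_add_left l k)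
    calc _ ≤ k * N ^ k + l * N ^ l := Nat.add_le_add (hk N hN) (hl N hN)
      _ ≤ k * N ^ (k + l) + l * N ^ (k + l) :=
          Nat.add_le_add (Nat.mul_le_mul_left _ h1) (Nat.mul_le_mul_left _ h2)
      _ = _ := by ring
  | cond b c d hc hd =>
    obtain ⟨k, hk⟩ := hc
    obtain ⟨l, hl⟩ := hd
    refine ⟨k + l + 1, fun N hN => ?_⟩
    have h1 := Nat.pow_le_pow_right hN (by omega : k ≤ k + l + 1)
    have h2 := Nat.pow_le_pow_right hN (by omega : l ≤ k + l + 1)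
    have h3 := Nat.one_le_pow (k + l + 1) N hN
    calc _ ≤ k * N ^ k + l * N ^ l + 1 :=
          Nat.add_le_add_right (Nat.add_le_add (hk N hN) (hl N hN)) 1
      _ ≤ k * N ^ (k + l + 1) + l * N ^ (k + l + 1) + N ^ (k + l + 1) :=
          Nat.add_le_add (Nat.add_le_add (Nat.mul_le_mul_left _ h1) (Nat.mul_le_mul_left _ h2)) h3
      _ = _ := by ring
  | loop b c hc =>
    obtain ⟨k, hk⟩ := hc
    refine ⟨k + 2, fun N hN => ?_⟩
    have h1 := Nat.pow_le_pow_right hN (by omega : k + 1 ≤ k + 2)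
    have h2 := Nat.pow_le_pow_right hN (by omega : 1 ≤ k + 2)
    have h3 := Nat.one_le_pow (k + 2) N hN
    calc N * (c.cost N + 1) + 1 ≤ N * (k * N ^ k + 1) + 1 := by
          have := hk N hN
          gcongr
      _ = k * N ^ (k + 1) + N ^ 1 + 1 := by ring
      _ ≤ k * N ^ (k + 2) + N ^ (k + 2) + N ^ (k + 2) :=
          Nat.add_le_add (Nat.add_le_add (Nat.mul_le_mul_left _ h1) h2) h3
      _ = _ := by ring

/-- Started in `σ`, the program halts within its cost in a state that satisfies `Q`. -/
def Spec (N : ℕ) (c : Prog) (σ : State) (Q : State → Prop) : Prop :=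
  ∃ t τ, Runs c σ t τ ∧ t ≤ c.cost N ∧ Q τ

namespace Spec

variable {N : ℕ} {c d : Prog} {σ : State} {Q Q' : State → Prop} {b : Test}

lemma mono (h : Spec N c σ Q) (hQ : ∀ τ, Q τ → Q' τ) : Spec N c σ Q' := by
  obtain ⟨t, τ, h1, h2, h3⟩ := h
  exact ⟨t, τ, h1, h2, hQ τ h3⟩

lemma seq (h : Spec N c σ Q') (hd : ∀ τ, Q' τ → Spec N d τ Q) : Spec N (.seq c d) σ Q := by
  obtain ⟨t, τ, h1, h2, h3⟩ := h
  obtain ⟨u, υ, h4, h5, h6⟩ := hd τ h3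
  exact ⟨t + u, υ, .seq h1 h4, Nat.add_le_add h2 h5, h6⟩

lemma setNat {a : ℕ} {i e : NExpr} (h : Q (σ.writeNat a (i.eval σ) (e.eval σ))) :
    Spec N (.setNat a i e) σ Q :=
  ⟨1, _, .setNat a i e σ, le_rfl, h⟩

lemma setReal {a : ℕ} {i : NExpr} {e : RExpr} (h : Q (σ.writeReal a (i.eval σ) (e.eval σ))) :
    Spec N (.setReal a i e) σ Q :=
  ⟨1, _, .setReal a i e σ, le_rfl, h⟩

lemma setNat_seq {a : ℕ} {i e : NExpr}
    (h : Spec N d (σ.writeNat a (i.eval σ) (e.eval σ)) Q) :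
    Spec N (.seq (.setNat a i e) d) σ Q :=
  (setNat (Q := fun τ => τ = σ.writeNat a (i.eval σ) (e.eval σ)) rfl).seq
    fun _ hτ => hτ ▸ h

lemma setReal_seq {a : ℕ} {i : NExpr} {e : RExpr}
    (h : Spec N d (σ.writeReal a (i.eval σ) (e.eval σ)) Q) :
    Spec N (.seq (.setReal a i e) d) σ Q :=
  (setReal (Q := fun τ => τ = σ.writeReal a (i.eval σ) (e.eval σ)) rfl).seq
    fun _ hτ => hτ ▸ h

lemma cond (h1 : b.Holds σ → Spec N c σ Q) (h2 : ¬ b.Holds σ → Spec N d σ Q) :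
    Spec N (.cond b c d) σ Q := by
  by_cases hb : b.Holds σ
  · obtain ⟨t, τ, h3, h4, h5⟩ := h1 hb
    exact ⟨t + 1, τ, .condTrue hb h3, by simp only [Prog.cost]; omega, h5⟩
  · obtain ⟨t, τ, h3, h4, h5⟩ := h2 hb
    exact ⟨t + 1, τ, .condFalse hb h3, by simp only [Prog.cost]; omega, h5⟩

/-- The invariant is indexed by the number of completed iterations, which forces exactly n of them;
the proof runs by induction on the remaining ones. -/
lemma loop {n : ℕ} (hn : n ≤ N) (I : ℕ → State → Prop) (h0 : I 0 σ)
    (hstep : ∀ k < n, ∀ τ, I k τ → b.Holds τ ∧ Spec N c τ (I (k + 1)))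
    (hend : ∀ τ, I n τ → ¬ b.Holds τ) : Spec N (.loop b c) σ (I n) := by
  have key : ∀ k ≤ n, ∀ τ, I (n - k) τ →
      ∃ t υ, Runs (.loop b c) τ t υ ∧ t ≤ k * (c.cost N + 1) + 1 ∧ I n υ := by
    intro k
    induction k with
    | zero => exact fun _ τ hτ => ⟨1, τ, .loopEnd (hend τ hτ), by omega, hτ⟩
    | succ k ih =>
      intro hk τ hτ
      obtain ⟨hb, t, υ, h1, h2, h3⟩ := hstep (n - (k + 1)) (by omega) τ hτ
      have e : n - (k + 1) + 1 = n - k := by omega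
      rw [e] at h3
      obtain ⟨u, ω, h4, h5, h6⟩ := ih (by omega) υ h3
      refine ⟨t + u + 1, ω, .loopStep hb h1 h4, ?_, h6⟩
      rw [Nat.succ_mul]
      omega
  obtain ⟨t, υ, h1, h2, h3⟩ := key n le_rfl σ (by simpa using h0)
  exact ⟨t, υ, h1, h2.trans (Nat.succ_le_succ (Nat.mul_le_mul_right _ hn)), h3⟩

end Spec

namespace State

variable (σ : State) (a b i v : ℕ) (x : ℝ)

@[simp] lemma nat_writeNat : (σ.writeNat a i v).nat a = Function.update (σ.nat a) i v := by
  simp [writeNat]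

@[simp] lemma nat_writeNat_of_ne {a b : ℕ} (h : b ≠ a) : (σ.writeNat a i v).nat b = σ.nat b := by
  simp [writeNat, h]

@[simp] lemma real_writeNat : (σ.writeNat a i v).real = σ.real := rfl

@[simp] lemma real_writeReal : (σ.writeReal a i x).real a = Function.update (σ.real a) i x := by
  simp [writeReal]

@[simp] lemma real_writeReal_of_ne {a b : ℕ} (h : b ≠ a) :
    (σ.writeReal a i x).real b = σ.real b := by
  simp [writeReal, h]

@[simp] lemma nat_writeReal : (σ.writeReal a i x).nat = σ.nat := rfl

end State

/-- The arrays with numbers below `k` are the same in both states. -/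
def Frame (k : ℕ) (σ τ : State) : Prop := ∀ a < k, τ.nat a = σ.nat a ∧ τ.real a = σ.real a

namespace Frame

variable {k l : ℕ} {σ τ υ : State}

lemma refl (k : ℕ) (σ : State) : Frame k σ σ := fun _ _ => ⟨rfl, rfl⟩

lemma trans (h1 : Frame k σ τ) (h2 : Frame k τ υ) : Frame k σ υ := fun a ha =>
  ⟨(h2 a ha).1.trans (h1 a ha).1, (h2 a ha).2.trans (h1 a ha).2⟩

lemma mono (h : Frame k σ τ) (hl : l ≤ k) : Frame l σ τ := fun a ha => h a (ha.trans_le hl)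

lemma nat (h : Frame k σ τ) {a : ℕ} (ha : a < k) : τ.nat a = σ.nat a := (h a ha).1

lemma real (h : Frame k σ τ) {a : ℕ} (ha : a < k) : τ.real a = σ.real a := (h a ha).2

lemma writeNat (h : Frame k σ τ) {a : ℕ} (ha : k ≤ a) (i v : ℕ) :
    Frame k σ (τ.writeNat a i v) := fun b hb => by
  have := h b hb
  rwa [State.nat_writeNat_of_ne _ _ _ (by omega), State.real_writeNat]

lemma writeReal (h : Frame k σ τ) {a : ℕ} (ha : k ≤ a) (i : ℕ) (x : ℝ) :
    Frame k σ (τ.writeReal a i x) := fun b hb => by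
  have := h b hb
  rwa [State.real_writeReal_of_ne _ _ _ (by omega), State.nat_writeReal]

end Frame

/-! ## Loops -/

/-- The integer scalar `a`. -/
abbrev nv (a : ℕ) : NExpr := .get a (.const 0)

/-- The real scalar `a`. -/
abbrev rv (a : ℕ) : RExpr := .get a (.const 0)

/-- Assignment to the integer scalar `a`. -/
abbrev nset (a : ℕ) (e : NExpr) : Prog := .setNat a (.const 0) e

/-- Assignment to the real scalar `a`. -/
abbrev rset (a : ℕ) (e : RExpr) : Prog := .setReal a (.const 0) e

/-- The test `x ≤ y`. -/
abbrev leTest (x y : RExpr) : Test := .not (.realLt y x)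

/-- `for v < bound do c`. -/
def forLoop (v : ℕ) (bound : NExpr) (c : Prog) : Prog :=
  .seq (nset v (.const 0)) (.loop (.natLt (nv v) bound) (.seq c (nset v (.add (nv v) (.const 1)))))

/-- The body must leave the counter unchanged, and `J (k + 1)` is demanded of the state after the
increment, since the counter shares its integer array with nothing that `J` may rely on being fixed.
-/
lemma Spec.forLoop {N n v : ℕ} {bound : NExpr} {c : Prog} {σ : State} (hn : n ≤ N)
    (J : ℕ → State → Prop) (h0 : J 0 (σ.writeNat v 0 0))
    (hbound : ∀ k τ, J k τ → bound.eval τ = n)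
    (hbody : ∀ k < n, ∀ τ, J k τ → τ.nat v 0 = k →
      Spec N c τ (fun τ' => τ'.nat v 0 = k ∧ J (k + 1) (τ'.writeNat v 0 (k + 1)))) :
    Spec N (forLoop v bound c) σ (J n) := by
  refine Spec.setNat_seq ?_
  refine (Spec.loop hn (fun k τ => J k τ ∧ τ.nat v 0 = k) ⟨h0, by simp⟩ ?_ ?_).mono
    fun τ h => h.1
  · rintro k hk τ ⟨h1, h2⟩
    refine ⟨?_, ?_⟩
    · simp only [Test.Holds, NExpr.eval, h2, hbound k τ h1]
      exact hk
    · refine (hbody k hk τ h1 h2).seq ?_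
      rintro υ ⟨h3, h4⟩
      refine Spec.setNat ?_
      simp only [NExpr.eval, h3]
      exact ⟨h4, by simp⟩
  · rintro τ ⟨h1, h2⟩
    simp only [Test.Holds, NExpr.eval, h2, hbound n τ h1]
    exact lt_irrefl _

/-- `r := ∑ v < bound with test, e`. -/
def sumLoop (v : ℕ) (bound : NExpr) (b : Test) (e : RExpr) : Prog :=
  .seq (rset v (.const 0))
    (forLoop v bound (.cond b (rset v (.add (rv v) e)) (rset v (rv v))))

/-- One number v names both the integer counter and the real accumulator, so a single frame
condition covers both. The summand may depend only on lower-numbered arrays and the counter. -/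
lemma Spec.sumLoop {N n v : ℕ} {bound : NExpr} {b : Test} {e : RExpr} {σ : State} (hn : n ≤ N)
    (hbound : ∀ τ, Frame v σ τ → bound.eval τ = n) (f : ℕ → ℝ)
    (hf : ∀ k < n, ∀ τ, Frame v σ τ → τ.nat v 0 = k →
      (b.Holds τ → e.eval τ = f k) ∧ (¬ b.Holds τ → f k = 0)) :
    Spec N (sumLoop v bound b e) σ
      (fun τ => Frame v σ τ ∧ τ.real v 0 = ∑ k ∈ Finset.range n, f k) := by
  refine Spec.setReal_seq ?_
  refine Spec.forLoop hn (fun j τ => Frame v σ τ ∧ τ.real v 0 = ∑ k ∈ Finset.range j, f k)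
    ⟨((Frame.refl v σ).writeReal le_rfl _ _).writeNat le_rfl _ _, by simp [RExpr.eval, NExpr.eval]⟩
    (fun _ τ h => hbound τ h.1) ?_
  rintro k hk τ ⟨h1, h2⟩ h3
  obtain ⟨h4, h5⟩ := hf k hk τ h1 h3
  refine Spec.cond (fun hb => Spec.setReal ?_) (fun hb => Spec.setReal ?_)
  · refine ⟨by simpa using h3, (h1.writeReal le_rfl _ _).writeNat le_rfl _ _, ?_⟩
    simp [RExpr.eval, NExpr.eval, h2, h4 hb, Finset.sum_range_succ]
  · refine ⟨by simpa using h3, (h1.writeReal le_rfl _ _).writeNat le_rfl _ _, ?_⟩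
    simp [RExpr.eval, NExpr.eval, h2, h5 hb, Finset.sum_range_succ]

/-- `r := max (0, e for v < bound)`. -/
def maxLoop (v : ℕ) (bound : NExpr) (e : RExpr) : Prog :=
  .seq (rset v (.const 0))
    (forLoop v bound (.cond (.realLt (rv v) e) (rset v e) (rset v (rv v))))

lemma Spec.maxLoop {N n v : ℕ} {bound : NExpr} {e : RExpr} {σ : State} (hn : n ≤ N)
    (hbound : ∀ τ, Frame v σ τ → bound.eval τ = n) (f : ℕ → ℝ)
    (hf : ∀ k < n, ∀ τ, Frame v σ τ → τ.nat v 0 = k → e.eval τ = f k) :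
    Spec N (maxLoop v bound e) σ
      (fun τ => Frame v σ τ ∧ τ.real v 0 = Scheduling.runMax f n) := by
  refine Spec.setReal_seq ?_
  refine Spec.forLoop hn (fun j τ => Frame v σ τ ∧ τ.real v 0 = Scheduling.runMax f j)
    ⟨((Frame.refl v σ).writeReal le_rfl _ _).writeNat le_rfl _ _,
      by simp [RExpr.eval, NExpr.eval, Scheduling.runMax]⟩
    (fun _ τ h => hbound τ h.1) ?_
  rintro k hk τ ⟨h1, h2⟩ h3
  have h4 := hf k hk τ h1 h3
  refine Spec.cond (fun hb => Spec.setReal ?_) (fun hb => Spec.setReal ?_)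
  · refine ⟨by simpa using h3, (h1.writeReal le_rfl _ _).writeNat le_rfl _ _, ?_⟩
    simp only [Test.Holds, RExpr.eval, NExpr.eval, h2, h4] at hb
    simp [NExpr.eval, h4, Scheduling.runMax, max_eq_right hb.le]
  · refine ⟨by simpa using h3, (h1.writeReal le_rfl _ _).writeNat le_rfl _ _, ?_⟩
    simp only [Test.Holds, RExpr.eval, NExpr.eval, h2, h4, not_lt] at hb
    simp [NExpr.eval, RExpr.eval, h2, Scheduling.runMax, max_eq_left hb]

end RealRAM

namespace RealRAM

open Scheduling Finset

/-! ## Subroutines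

Memory layout: the rounded speeds are in real array `16`, the rounded sizes in real array `17`,
the index of the current job in integer scalar `18`. -/

/-- Sets integer scalar `23` to a positive value if the level in real scalar `22` is feasible, and
to `0` otherwise. -/
noncomputable def feasibleProg (α : ℝ) : Prog :=
  .seq (nset 23 (.const 1))
    (forLoop 24 (.add (nv 18) (.const 1))
      (.seq (sumLoop 25 (.add (nv 18) (.const 1))
          (leTest (.get 17 (nv 24)) (.get 17 (nv 25))) (.get 17 (nv 25)))
        (.seq (sumLoop 26 (nv 0)
            (leTest (.get 17 (nv 24)) (.mul (.get 16 (nv 26)) (rv 22)))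
            (.pow (.get 16 (nv 26)) (.const α)))
          (.cond (leTest (rv 25) (.mul (rv 22) (.pow (rv 26) (.const α⁻¹))))
            (nset 23 (nv 23)) (nset 23 (.const 0))))))

/-- The flag starts positive and is cleared by any failed test, never to be set again. So after j
rounds it records the conjunction of the first j volume tests. -/
lemma feasibleProg_spec {N : ℕ} (α : ℝ) (σ : State) (hm : σ.nat 0 0 ≤ N)
    (hj : σ.nat 18 0 + 1 ≤ N) :
    Spec N (feasibleProg α) σ (fun τ => Frame 23 σ τ ∧ (0 < τ.nat 23 0 ↔
      Feasible α (σ.real 16) (σ.nat 0 0) (σ.real 17) (σ.nat 18 0 + 1) (σ.real 22 0))) := by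
  set m := σ.nat 0 0 with hmdef
  set n := σ.nat 18 0 + 1 with hn
  set a := σ.real 16 with ha
  set P := σ.real 17 with hP
  set T := σ.real 22 0 with hT
  refine Spec.setNat_seq ?_
  refine (Spec.forLoop hj (fun j τ => Frame 23 σ τ ∧ (0 < τ.nat 23 0 ↔ ∀ l < j,
    ∑ k ∈ range n, (if P l ≤ P k then P k else 0) ≤ T * capacity α a m T (P l) ^ α⁻¹))
    ⟨((Frame.refl 23 σ).writeNat le_rfl _ _).writeNat (by norm_num) _ _, ?_⟩ ?_ ?_).mono
    fun τ h => h
  · simp [NExpr.eval]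
  · rintro k τ ⟨h1, -⟩
    simp [NExpr.eval, h1.nat]
    rfl
  rintro l hl τ ⟨h1, h2⟩ h3
  refine (Spec.sumLoop (f := fun k => if P l ≤ P k then P k else 0) hj ?_ ?_).seq ?_
  · intro υ hυ
    simp [NExpr.eval, hυ.nat, h1.nat]
    rfl
  · intro k _ υ hυ hk
    simp only [Test.Holds, RExpr.eval, NExpr.eval, hυ.nat (show 24 < 25 by norm_num), h3, hk,
      hυ.real (show 17 < 25 by norm_num), h1.real (show 17 < 23 by norm_num), ← hP, not_lt]
    exact ⟨fun h => (if_pos h).symm, fun h => if_neg h⟩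
  rintro τ₁ ⟨h4, h5⟩
  refine (Spec.sumLoop (f := fun i => if P l ≤ a i * T then a i ^ α else 0) hm ?_ ?_).seq ?_
  · intro υ hυ
    simp [NExpr.eval, hυ.nat, h4.nat, h1.nat]
    rfl
  · intro k _ υ hυ hk
    simp only [Test.Holds, RExpr.eval, NExpr.eval, hυ.nat (show 24 < 26 by norm_num),
      h4.nat (show 24 < 25 by norm_num), h3, hk,
      hυ.real (show 17 < 26 by norm_num), h4.real (show 17 < 25 by norm_num),
      h1.real (show 17 < 23 by norm_num), hυ.real (show 16 < 26 by norm_num),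
      h4.real (show 16 < 25 by norm_num), h1.real (show 16 < 23 by norm_num),
      hυ.real (show 22 < 26 by norm_num), h4.real (show 22 < 25 by norm_num),
      h1.real (show 22 < 23 by norm_num), ← hP, ← ha, ← hT, not_lt]
    exact ⟨fun h => (if_pos h).symm, fun h => if_neg h⟩
  rintro τ₂ ⟨h6, h7⟩
  have h8 : Frame 23 σ τ₂ := (h1.trans (h4.mono (by norm_num))).trans (h6.mono (by norm_num))
  have h9 : τ₂.nat 24 0 = l := by rw [h6.nat (by norm_num), h4.nat (by norm_num), h3]
  have h10 : τ₂.nat 23 0 = τ.nat 23 0 := by rw [h6.nat (by norm_num), h4.nat (by norm_num)]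
  have h11 : τ₂.real 25 0 = ∑ k ∈ range n, if P l ≤ P k then P k else 0 := by
    rw [h6.real (by norm_num), h5]
  have h12 : τ₂.real 22 0 = T := by rw [h8.real (by norm_num)]
  have hsucc : (∀ l' < l + 1, ∑ k ∈ range n, (if P l' ≤ P k then P k else 0)
        ≤ T * capacity α a m T (P l') ^ α⁻¹) ↔ (∀ l' < l,
      ∑ k ∈ range n, (if P l' ≤ P k then P k else 0) ≤ T * capacity α a m T (P l') ^ α⁻¹) ∧
      ∑ k ∈ range n, (if P l ≤ P k then P k else 0) ≤ T * capacity α a m T (P l) ^ α⁻¹ :=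
    Nat.forall_lt_succ_right
  rw [hsucc]
  have h13 : capacity α a m T (P l) = τ₂.real 26 0 := h7.symm
  refine Spec.cond (fun hb => Spec.setNat ?_) (fun hb => Spec.setNat ?_)
  · simp only [Test.Holds, RExpr.eval, NExpr.eval, not_lt, h11, h12, ← h13] at hb
    refine ⟨by simpa using h9, (h8.writeNat le_rfl _ _).writeNat (by norm_num) _ _, ?_⟩
    simp [NExpr.eval, h10, h2, hb]
  · simp only [Test.Holds, RExpr.eval, NExpr.eval, not_lt, h11, h12, ← h13] at hb
    refine ⟨by simpa using h9, (h8.writeNat le_rfl _ _).writeNat (by norm_num) _ _, ?_⟩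
    simp [NExpr.eval, hb]

/-- Computes the level of the jobs up to the current one in real scalar `22`, and the maximal
speed in real scalar `20`. -/
noncomputable def levelProg (α : ℝ) : Prog :=
  .seq (maxLoop 20 (nv 0) (.get 16 (nv 20)))
    (.seq (maxLoop 21 (.add (nv 18) (.const 1)) (.get 17 (nv 21)))
      (.seq (rset 22 (.div (rv 21) (rv 20)))
        (forLoop 22 (.add (nv 18) (.const 1))
          (.seq (feasibleProg α)
            (.cond (.natLt (.const 0) (nv 23)) (rset 22 (rv 22))
              (rset 22 (.mul (.const 2) (rv 22))))))))

/-- One pass of the loop performs one application of `raise`, so the n passes mirror the definition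
of `level` exactly. -/
lemma levelProg_spec {N : ℕ} (α : ℝ) (σ : State) (hm : σ.nat 0 0 ≤ N)
    (hj : σ.nat 18 0 + 1 ≤ N) :
    Spec N (levelProg α) σ (fun τ => Frame 20 σ τ ∧
      τ.real 20 0 = runMax (σ.real 16) (σ.nat 0 0) ∧
      τ.real 22 0 = level α (σ.real 16) (σ.nat 0 0) (σ.real 17) (σ.nat 18 0 + 1)) := by
  set m := σ.nat 0 0 with hmdef
  set n := σ.nat 18 0 + 1 with hn
  set a := σ.real 16 with ha
  set P := σ.real 17 with hP
  refine (Spec.maxLoop (f := a) hm ?_ ?_).seq ?_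
  · intro υ hυ
    simp [NExpr.eval, hυ.nat, hmdef]
  · intro k _ υ hυ hk
    simp [RExpr.eval, NExpr.eval, hυ.real, hk, ha]
  rintro τ₁ ⟨h1, h2⟩
  refine (Spec.maxLoop (f := P) hj ?_ ?_).seq ?_
  · intro υ hυ
    simp [NExpr.eval, hυ.nat, h1.nat]
    rfl
  · intro k _ υ hυ hk
    simp [RExpr.eval, NExpr.eval, hυ.real, h1.real, hk, hP]
  rintro τ₂ ⟨h3, h4⟩
  refine Spec.setReal_seq ?_
  have h5 : Frame 20 σ τ₂ := h1.trans (h3.mono (by norm_num))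
  refine (Spec.forLoop hj (fun j τ => Frame 20 σ τ ∧ τ.real 20 0 = runMax a m ∧
    τ.real 22 0 = (raise α a m P n)^[j] (runMax P n / runMax a m)) ⟨?_, ?_, ?_⟩ ?_ ?_).mono
    fun τ h => h
  · exact (h5.writeReal (by norm_num) _ _).writeNat (by norm_num) _ _
  · simp [h3.real, h2]
  · simp [RExpr.eval, NExpr.eval, h3.real, h2, h4]
  · rintro k τ ⟨h6, -⟩
    simp [NExpr.eval, h6.nat]
    rfl
  rintro k _ τ ⟨h6, h7, h8⟩ h9
  have e1 : τ.nat 0 0 = m := by rw [h6.nat (by norm_num)]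
  have e2 : τ.nat 18 0 + 1 = n := by rw [h6.nat (by norm_num)]
  refine (feasibleProg_spec α τ (e1 ▸ hm) (e2 ▸ hj)).seq ?_
  rintro υ ⟨h10, h11⟩
  rw [e1, e2, h6.real (by norm_num), h6.real (by norm_num), ← ha, ← hP] at h11
  have h12 : Frame 20 σ υ := h6.trans (h10.mono (by norm_num))
  have h13 : υ.nat 22 0 = k := by rw [h10.nat (by norm_num), h9]
  have h14 : υ.real 20 0 = runMax a m := by rw [h10.real (by norm_num), h7]
  have h15 : υ.real 22 0 = τ.real 22 0 := by rw [h10.real (by norm_num)]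
  refine Spec.cond (fun hb => Spec.setReal ?_) (fun hb => Spec.setReal ?_)
  · simp only [Test.Holds, NExpr.eval, h11] at hb
    refine ⟨by simpa using h13, (h12.writeReal (by norm_num) _ _).writeNat (by norm_num) _ _,
      by simpa using h14, ?_⟩
    rw [Function.iterate_succ_apply', ← h8, raise, if_pos hb]
    simp [RExpr.eval, NExpr.eval, h15]
  · simp only [Test.Holds, NExpr.eval, h11] at hb
    refine ⟨by simpa using h13, (h12.writeReal (by norm_num) _ _).writeNat (by norm_num) _ _,
      by simpa using h14, ?_⟩
    rw [Function.iterate_succ_apply', ← h8, raise, if_neg hb]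
    simp [RExpr.eval, NExpr.eval, h15]

/-- Computes the weights of all machines for the current job in real array `30`, and their sum in
real scalar `23`. -/
noncomputable def weightProg (α : ℝ) (κ : NExpr) : Prog :=
  .seq (levelProg α)
    (.seq (rset 23 (.const 0))
      (forLoop 27 (nv 0)
        (.seq (.cond (.and (leTest (.get 17 (nv 18)) (.mul (.get 16 (nv 27)) (rv 22)))
              (leTest (rv 20) (.mul (.ofNat κ) (.get 16 (nv 27)))))
            (.setReal 30 (nv 27) (.pow (.get 16 (nv 27)) (.const α)))
            (.setReal 30 (nv 27) (.const 0)))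
          (rset 23 (.add (rv 23) (.get 30 (nv 27)))))))

lemma weightProg_spec {N K : ℕ} (α : ℝ) (κ : NExpr) (σ : State) (hm : σ.nat 0 0 ≤ N)
    (hj : σ.nat 18 0 + 1 ≤ N) (hκ : ∀ τ, Frame 20 σ τ → κ.eval τ = K) :
    Spec N (weightProg α κ) σ (fun τ => Frame 20 σ τ ∧
      (∀ i < σ.nat 0 0, τ.real 30 i
        = weight α K (σ.real 16) (σ.nat 0 0) (σ.real 17) (σ.nat 18 0) i) ∧
      τ.real 23 0 = totalWeight α K (σ.real 16) (σ.nat 0 0) (σ.real 17) (σ.nat 18 0)) := by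
  refine (levelProg_spec α σ hm hj).seq ?_
  set m := σ.nat 0 0 with hmdef
  set n := σ.nat 18 0 with hn
  set a := σ.real 16 with ha
  set P := σ.real 17 with hP
  rintro τ₁ ⟨h1, h2, h3⟩
  refine Spec.setReal_seq ?_
  refine (Spec.forLoop hm (fun j τ => Frame 20 σ τ ∧ τ.real 20 0 = runMax a m ∧
    τ.real 22 0 = level α a m P (n + 1) ∧ (∀ i < j, τ.real 30 i = weight α K a m P n i) ∧
    τ.real 23 0 = ∑ i ∈ range j, weight α K a m P n i) ⟨?_, ?_, ?_, ?_, ?_⟩ ?_ ?_).mono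
    fun τ h => ⟨h.1, h.2.2.2⟩
  · exact (h1.writeReal (by norm_num) _ _).writeNat (by norm_num) _ _
  · simp [h2]
  · simp [h3]
  · intro i hi; omega
  · simp [RExpr.eval, NExpr.eval]
  · rintro k τ ⟨h4, -⟩
    simp [NExpr.eval, h4.nat, hmdef]
  rintro k _ τ ⟨h4, h5, h6, h7, h8⟩ h9
  have e1 : τ.nat 18 0 = n := by rw [h4.nat (by norm_num)]
  have e2 : τ.real 16 = a := h4.real (by norm_num)
  have e3 : τ.real 17 = P := h4.real (by norm_num)
  have e4 := hκ τ h4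
  refine Spec.seq (Q' := fun υ => υ = τ.writeReal 30 k (weight α K a m P n k)) ?_ ?_
  · refine Spec.cond (fun hb => Spec.setReal ?_) (fun hb => Spec.setReal ?_)
    · simp only [Test.Holds, RExpr.eval, NExpr.eval, not_lt, e1, e2, e3, e4, h5, h6, h9] at hb
      simp only [RExpr.eval, NExpr.eval, e2, h9]
      rw [weight, if_pos hb]
    · simp only [Test.Holds, RExpr.eval, NExpr.eval, not_lt, e1, e2, e3, e4, h5, h6, h9] at hb
      simp only [RExpr.eval, NExpr.eval, h9]
      rw [weight, if_neg hb]
  rintro υ rfl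
  refine Spec.setReal ⟨by simpa using h9, ?_, by simpa using h5, by simpa using h6, ?_, ?_⟩
  · exact ((h4.writeReal (by norm_num) _ _).writeReal (by norm_num) _ _).writeNat (by norm_num) _ _
  · intro i hi
    rcases Nat.lt_succ_iff_lt_or_eq.1 hi with hi | rfl
    · simp [hi.ne, h7 i hi]
    · simp
  · simp [RExpr.eval, NExpr.eval, h9, h8, sum_range_succ]

/-- Rounds real scalar `40` down to a power of two, in real scalar `41`. -/
noncomputable def roundProg : Prog :=
  .seq (rset 41 (.const 1))
    (.seq (.loop (.realLt (rv 40) (rv 41)) (rset 41 (.div (rv 41) (.const 2))))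
      (.loop (leTest (.mul (.const 2) (rv 41)) (rv 40)) (rset 41 (.mul (.const 2) (rv 41)))))

/-- Starting from 1, the first loop halves (−k)⁺ times and the second doubles k⁺ times, for k the
exponent of the result. At least one loop is empty, and both counts are at most |k|. -/
lemma roundProg_spec {N : ℕ} (σ : State) (hx : 0 < σ.real 40 0)
    (hN : (Int.log 2 (σ.real 40 0)).natAbs ≤ N) :
    Spec N roundProg σ (fun τ => Frame 41 σ τ ∧ τ.real 41 0 = dyadicFloor (σ.real 40 0)) := by
  set x := σ.real 40 0 with hxdef
  set k := Int.log 2 x with hk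
  have hlt : ∀ l : ℤ, x < 2 ^ l ↔ k < l := fun l => by
    have := Int.lt_zpow_iff_log_lt (b := 2) one_lt_two (x := l) hx
    simpa using this
  refine Spec.setReal_seq ?_
  have hz : (2 : ℝ) ≠ 0 := two_ne_zero
  refine (Spec.loop (n := (-k).toNat) (by omega)
    (fun i τ => Frame 41 σ τ ∧ τ.real 41 0 = 2 ^ (-(i : ℤ))) ?_ ?_ ?_).seq ?_
  · exact ⟨(Frame.refl 41 σ).writeReal le_rfl _ _, by simp [RExpr.eval, NExpr.eval]⟩
  · rintro i hi τ ⟨h1, h2⟩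
    have e : τ.real 40 0 = x := by rw [h1.real (by norm_num)]
    refine ⟨?_, Spec.setReal ⟨h1.writeReal le_rfl _ _, ?_⟩⟩
    · simp only [Test.Holds, RExpr.eval, NExpr.eval, e, h2, hlt]
      omega
    · simp only [RExpr.eval, NExpr.eval, State.real_writeReal, Function.update_self, h2]
      rw [Nat.cast_succ, neg_add, ← sub_eq_add_neg, zpow_sub_one₀ hz, div_eq_mul_inv]
  · rintro τ ⟨h1, h2⟩
    have e : τ.real 40 0 = x := by rw [h1.real (by norm_num)]
    simp only [Test.Holds, RExpr.eval, NExpr.eval, e, h2, hlt]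
    omega
  rintro τ ⟨h1, h2⟩
  refine (Spec.loop (n := k.toNat) (by omega)
    (fun i τ => Frame 41 σ τ ∧ τ.real 41 0 = 2 ^ (-((-k).toNat : ℤ) + i)) ?_ ?_ ?_).mono ?_
  · exact ⟨h1, by simpa using h2⟩
  · rintro i hi τ ⟨h1, h2⟩
    have e : τ.real 40 0 = x := by rw [h1.real (by norm_num)]
    refine ⟨?_, Spec.setReal ⟨h1.writeReal le_rfl _ _, ?_⟩⟩
    · simp only [Test.Holds, RExpr.eval, NExpr.eval, e, h2, ← zpow_one_add₀ hz, hlt]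
      omega
    · simp only [RExpr.eval, NExpr.eval, State.real_writeReal, Function.update_self, h2,
        ← zpow_one_add₀ hz]
      congr 1
      push_cast
      ring
  · rintro τ ⟨h1, h2⟩
    have e : τ.real 40 0 = x := by rw [h1.real (by norm_num)]
    simp only [Test.Holds, RExpr.eval, NExpr.eval, e, h2, ← zpow_one_add₀ hz, hlt, not_not]
    omega
  · rintro τ ⟨h1, h2⟩
    refine ⟨h1, ?_⟩
    rw [h2, dyadicFloor, ← hk]
    congr 1
    omega

/-- Rounds the first entries of real array `src` and stores them in real array `dst`. -/
noncomputable def fillProg (dst src : ℕ) (bound : NExpr) : Prog :=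
  forLoop 38 bound
    (.seq (rset 40 (.get src (nv 38)))
      (.seq roundProg (.setReal dst (nv 38) (rv 41))))

lemma fillProg_spec {N n dst src : ℕ} {bound : NExpr} (σ : State) (hn : n ≤ N) (hd : dst < 38)
    (hsd : src < dst) (hbound : ∀ τ, Frame dst σ τ → bound.eval τ = n)
    (hpos : ∀ k < n, 0 < σ.real src k) (hlog : ∀ k < n, (Int.log 2 (σ.real src k)).natAbs ≤ N) :
    Spec N (fillProg dst src bound) σ (fun τ => Frame dst σ τ ∧
      ∀ k < n, τ.real dst k = dyadicFloor (σ.real src k)) := by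
  refine Spec.forLoop hn (fun j τ => Frame dst σ τ ∧
    ∀ k < j, τ.real dst k = dyadicFloor (σ.real src k)) ⟨?_, ?_⟩ ?_ ?_
  · exact (Frame.refl dst σ).writeNat hd.le _ _
  · intro k hk; omega
  · exact fun k τ h => hbound τ h.1
  rintro k hk τ ⟨h1, h2⟩ h3
  have e : τ.real src = σ.real src := h1.real hsd
  refine Spec.setReal_seq ?_
  refine (roundProg_spec _ ?_ ?_).seq ?_
  · simp [RExpr.eval, NExpr.eval, h3, e, hpos k hk]
  · simp [RExpr.eval, NExpr.eval, h3, e, hlog k hk]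
  rintro υ ⟨h4, h5⟩
  have h6 : υ.nat 38 0 = k := by rw [h4.nat (by norm_num)]; simpa using h3
  have h7 : υ.real dst = τ.real dst := by
    rw [h4.real (by omega), State.real_writeReal_of_ne _ _ _ (by omega)]
  refine Spec.setReal ⟨by simpa using h6, ?_, ?_⟩
  · refine Frame.writeNat (Frame.writeReal ?_ le_rfl _ _) hd.le _ _
    exact (h1.writeReal (by omega) _ _).trans (h4.mono (by omega))
  · simp only [NExpr.eval, RExpr.eval, h6, State.real_writeNat, State.real_writeReal, h5, h3, e,
      Function.update_self]
    intro i hi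
    rcases Nat.lt_succ_iff_lt_or_eq.1 hi with hi | rfl
    · rw [Function.update_of_ne hi.ne, h7, h2 i hi]
    · rw [Function.update_self]

/-- Evaluates `signedSum (fun y => e₁ y (f y)) k + e₂ (2 ^ k) (f (2 ^ k))` in real scalar `11`, where
`2 ^ k` is in real scalar `10`, and `body` computes `f` of real scalar `7` in real scalar `12`. -/
noncomputable def dyadicProg (body : Prog) (e₁ e₂ : RExpr) : Prog :=
  .seq (.cond (.realLt (rv 10) (.const 1))
      (.seq (rset 7 (rv 10)) (.seq (rset 8 (.const 1)) (rset 9 (.const (-1)))))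
      (.seq (rset 7 (.const 1)) (.seq (rset 8 (rv 10)) (rset 9 (.const 1)))))
    (.seq (rset 11 (.const 0))
      (.seq (.loop (.realLt (rv 7) (rv 8))
          (.seq body (.seq (rset 11 (.add (rv 11) e₁)) (rset 7 (.mul (.const 2) (rv 7))))))
        (.seq (rset 7 (rv 10))
          (.seq body (rset 11 (.add (.mul (rv 9) (rv 11)) e₂))))))

/-- The summation runs from min(1, 2^k) up to max(1, 2^k) by doubling, which takes exactly |k|
rounds. The predicate `G` holds whatever `body` needs beyond the arrays it leaves untouched; it must
be insensitive to the scalars 7 to 11 that the loop itself writes. -/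
lemma dyadicProg_spec {N : ℕ} {body : Prog} {e₁ e₂ : RExpr} {σ : State} {k : ℤ}
    (hk : σ.real 10 0 = 2 ^ k) (hN : k.natAbs ≤ N) (G : State → Prop) (f : ℝ → ℝ)
    (F₁ F₂ : ℝ → ℝ → ℝ) (hG0 : G σ)
    (hG : ∀ τ, G τ → ∀ a, 7 ≤ a → a < 12 → ∀ v, G (τ.writeReal a 0 v))
    (hbody : ∀ τ, G τ → Spec N body τ
      (fun υ => G υ ∧ Frame 12 τ υ ∧ υ.real 12 0 = f (τ.real 7 0)))
    (he₁ : ∀ τ, e₁.eval τ = F₁ (τ.real 7 0) (τ.real 12 0))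
    (he₂ : ∀ τ, e₂.eval τ = F₂ (τ.real 7 0) (τ.real 12 0)) :
    Spec N (dyadicProg body e₁ e₂) σ (fun τ => G τ ∧ Frame 7 σ τ ∧ τ.real 10 0 = 2 ^ k ∧
      τ.real 11 0 = signedSum (fun y => F₁ y (f y)) k + F₂ (2 ^ k) (f (2 ^ k))) := by
  set lo : ℝ := min 1 (2 ^ k) with hlo
  set hi : ℝ := max 1 (2 ^ k) with hhi
  set sgn : ℝ := if (2 : ℝ) ^ k < 1 then -1 else 1 with hsgn
  have hz : (2 : ℝ) ≠ 0 := two_ne_zero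
  have hrange : hi = lo * 2 ^ k.natAbs := by
    rcases le_total 0 k with h | h
    · have h1 : (1 : ℝ) ≤ 2 ^ k := one_le_zpow₀ one_le_two h
      rw [hhi, hlo, max_eq_right h1, min_eq_left h1, one_mul, ← zpow_natCast,
        Int.natAbs_of_nonneg h]
    · have h1 : (2 : ℝ) ^ k ≤ 1 := zpow_le_one_of_nonpos₀ one_le_two h
      rw [hhi, hlo, max_eq_left h1, min_eq_right h1, ← zpow_natCast, ← zpow_add₀ hz]
      have : k + (k.natAbs : ℤ) = 0 := by omega
      rw [this, zpow_zero]
  have hlopos : 0 < lo := lt_min one_pos (by positivity)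
  refine Spec.seq (Q' := fun τ => G τ ∧ Frame 7 σ τ ∧ τ.real 10 0 = 2 ^ k ∧ τ.real 7 0 = lo ∧
    τ.real 8 0 = hi ∧ τ.real 9 0 = sgn) ?_ ?_
  · refine Spec.cond (fun hb => ?_) (fun hb => ?_)
    · refine Spec.setReal_seq (Spec.setReal_seq (Spec.setReal ?_))
      simp only [Test.Holds, RExpr.eval, NExpr.eval, hk] at hb
      refine ⟨hG _ (hG _ (hG _ hG0 7 le_rfl (by norm_num) _) 8 (by norm_num) (by norm_num) _) 9
        (by norm_num) (by norm_num) _, ?_, ?_, ?_, ?_, ?_⟩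
      · exact (((Frame.refl 7 σ).writeReal le_rfl _ _).writeReal (by norm_num) _ _).writeReal
          (by norm_num) _ _
      · simp [hk]
      · simp [RExpr.eval, NExpr.eval, hk, hlo, min_eq_right hb.le]
      · simp [RExpr.eval, NExpr.eval, hhi, max_eq_left hb.le]
      · simp [RExpr.eval, NExpr.eval, hsgn, hb]
    · refine Spec.setReal_seq (Spec.setReal_seq (Spec.setReal ?_))
      simp only [Test.Holds, RExpr.eval, NExpr.eval, hk, not_lt] at hb
      refine ⟨hG _ (hG _ (hG _ hG0 7 le_rfl (by norm_num) _) 8 (by norm_num) (by norm_num) _) 9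
        (by norm_num) (by norm_num) _, ?_, ?_, ?_, ?_, ?_⟩
      · exact (((Frame.refl 7 σ).writeReal le_rfl _ _).writeReal (by norm_num) _ _).writeReal
          (by norm_num) _ _
      · simp [hk]
      · simp [RExpr.eval, NExpr.eval, hlo, min_eq_left hb]
      · simp [RExpr.eval, NExpr.eval, hk, hhi, max_eq_right hb]
      · simp [RExpr.eval, NExpr.eval, hsgn, not_lt.2 hb]
  rintro τ ⟨g1, g2, g3, g4, g5, g6⟩
  refine Spec.setReal_seq ?_
  refine (Spec.loop hN (fun i τ => G τ ∧ Frame 7 σ τ ∧ τ.real 10 0 = 2 ^ k ∧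
    τ.real 7 0 = lo * 2 ^ i ∧ τ.real 8 0 = hi ∧ τ.real 9 0 = sgn ∧
    τ.real 11 0 = ∑ j ∈ range i, F₁ (lo * 2 ^ j) (f (lo * 2 ^ j))) ?_ ?_ ?_).seq ?_
  · exact ⟨hG _ g1 11 (by norm_num) (by norm_num) _, g2.writeReal (by norm_num) _ _,
      by simp [g3], by simp [g4], by simp [g5], by simp [g6], by simp [RExpr.eval, NExpr.eval]⟩
  · rintro i hik τ ⟨g1, g2, g3, g4, g5, g6, g7⟩
    refine ⟨?_, (hbody τ g1).seq ?_⟩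
    · simp only [Test.Holds, RExpr.eval, NExpr.eval, g4, g5, hrange]
      exact mul_lt_mul_of_pos_left (pow_lt_pow_right₀ one_lt_two hik) hlopos
    rintro υ ⟨w1, w2, w3⟩
    have r7 : υ.real 7 0 = lo * 2 ^ i := by rw [w2.real (by norm_num), g4]
    refine Spec.setReal_seq (Spec.setReal ?_)
    refine ⟨hG _ (hG _ w1 11 (by norm_num) (by norm_num) _) 7 le_rfl (by norm_num) _,
      ((g2.trans (w2.mono (by norm_num))).writeReal (by norm_num) _ _).writeReal le_rfl _ _,
      ?_, ?_, ?_, ?_, ?_⟩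
    · simp [w2.real, g3]
    · simp [RExpr.eval, NExpr.eval, r7, pow_succ]; ring
    · simp [w2.real, g5]
    · simp [w2.real, g6]
    · rw [g4] at w3
      have r11 : υ.real 11 0 = ∑ j ∈ range i, F₁ (lo * 2 ^ j) (f (lo * 2 ^ j)) := by
        rw [w2.real (by norm_num), g7]
      simp [RExpr.eval, NExpr.eval, he₁, r7, w3, r11, sum_range_succ]
  · rintro τ ⟨g1, g2, g3, g4, g5, g6, g7⟩
    simp only [Test.Holds, RExpr.eval, NExpr.eval, g4, g5, hrange]
    exact lt_irrefl _
  rintro τ ⟨g1, g2, g3, g4, g5, g6, g7⟩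
  refine Spec.setReal_seq ?_
  refine (hbody _ (hG _ g1 7 le_rfl (by norm_num) _)).seq ?_
  rintro υ ⟨w1, w2, w3⟩
  have r7 : υ.real 7 0 = 2 ^ k := by
    rw [w2.real (by norm_num)]; simp [RExpr.eval, NExpr.eval, g3]
  have r9 : υ.real 9 0 = sgn := by rw [w2.real (by norm_num)]; simp [g6]
  have r10 : υ.real 10 0 = 2 ^ k := by rw [w2.real (by norm_num)]; simp [g3]
  have r11 : υ.real 11 0 = ∑ j ∈ range k.natAbs, F₁ (lo * 2 ^ j) (f (lo * 2 ^ j)) := by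
    rw [w2.real (by norm_num)]; simp [g7]
  have r12 : υ.real 12 0 = f (2 ^ k) := by
    rw [w3]; simp [RExpr.eval, NExpr.eval, g3]
  refine Spec.setReal ⟨hG _ w1 11 (by norm_num) (by norm_num) _, ?_, by simp [r10], ?_⟩
  · exact ((g2.writeReal le_rfl _ _).trans (w2.mono (by norm_num))).writeReal (by norm_num) _ _
  · simp only [RExpr.eval, NExpr.eval, State.real_writeReal, Function.update_self, r9, r11, he₂,
      r7, r12]
    rfl

end RealRAM

namespace RealRAM

open Scheduling Finset

/-! ## The programs of the mechanism -/

section Input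

variable {m : ℕ} (s : Fin m → ℝ) (h : History m) (k : ℕ) (x y : ℝ)

@[simp] lemma input_machines : (input s h k x y).nat 0 0 = m := rfl

@[simp] lemma input_jobs : (input s h k x y).nat 0 1 = h.length := rfl

@[simp] lemma input_index : (input s h k x y).nat 0 2 = k := rfl

@[simp] lemma input_fst : (input s h k x y).real 2 0 = x := rfl

@[simp] lemma input_snd : (input s h k x y).real 2 1 = y := rfl

lemma input_speed {i : ℕ} (hi : i < m) : (input s h k x y).real 0 i = s ⟨i, hi⟩ :=
  dif_pos hi

lemma input_size {j : ℕ} (hj : j < h.length) : (input s h k x y).real 1 j = h[j].1 :=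
  dif_pos hj

lemma input_machine {j : ℕ} (hj : j < h.length) : (input s h k x y).nat 1 j = h[j].2 :=
  dif_pos hj

end Input

/-- Rounds all speeds and the sizes of all past jobs. -/
noncomputable def prepareProg : Prog :=
  .seq (fillProg 16 0 (nv 0)) (fillProg 17 1 (.get 0 (.const 1)))

section Prepare

variable {m : ℕ} {s : Fin m → ℝ} {h : History m} {N : ℕ}
  (hs : ∀ i, 0 < s i) (hh : ∀ x ∈ h, 0 < x.1) (hm : m ≤ N) (hn : h.length ≤ N)
  (hslog : ∀ i, (Int.log 2 (s i)).natAbs ≤ N) (hhlog : ∀ x ∈ h, (Int.log 2 x.1).natAbs ≤ N)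

lemma sizeArray_map {j : ℕ} (hj : j < h.length) :
    sizeArray (h.map Prod.fst) j = dyadicFloor h[j].1 := by
  rw [sizeArray, List.getD_eq_getElem _ _ (by simpa using hj), List.getElem_map]

include hs hh hm hn hslog hhlog

lemma prepareProg_spec (k : ℕ) (x y : ℝ) :
    Spec N prepareProg (input s h k x y) (fun τ => Frame 16 (input s h k x y) τ ∧
      (∀ i < m, τ.real 16 i = speedArray s i) ∧
      ∀ j < h.length, τ.real 17 j = sizeArray (h.map Prod.fst) j) := by
  refine (fillProg_spec (n := m) _ hm (by norm_num) (by norm_num) ?_ ?_ ?_).seq ?_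
  · intro τ hτ
    simp [NExpr.eval, hτ.nat]
  · intro i hi
    rw [input_speed _ _ _ _ _ hi]
    exact hs _
  · intro i hi
    rw [input_speed _ _ _ _ _ hi]
    exact hslog _
  rintro τ ⟨h1, h2⟩
  have e : τ.real 1 = (input s h k x y).real 1 := h1.real (by norm_num)
  refine (fillProg_spec (n := h.length) _ hn (by norm_num) (by norm_num) ?_ ?_ ?_).mono ?_
  · intro υ hυ
    simp [NExpr.eval, hυ.nat, h1.nat]
  · intro j hj
    rw [e, input_size _ _ _ _ _ hj]
    exact hh _ (List.getElem_mem hj)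
  · intro j hj
    rw [e, input_size _ _ _ _ _ hj]
    exact hhlog _ (List.getElem_mem hj)
  rintro υ ⟨h3, h4⟩
  refine ⟨h1.trans (h3.mono (by norm_num)), fun i hi => ?_, fun j hj => ?_⟩
  · rw [h3.real (by norm_num), h2 i hi, input_speed _ _ _ _ _ hi, speedArray, dif_pos hi]
  · rw [h4 j hj, e, input_size _ _ _ _ _ hj, sizeArray_map hj]

end Prepare

/-- Inverts the distribution function of the weights in real array `30`. -/
noncomputable def sampleProg : Prog :=
  .seq (rset 31 (.const 0))
    (.seq (nset 32 (.const 0))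
      (.seq (forLoop 33 (.sub (nv 0) (.const 1))
          (.seq (rset 31 (.add (rv 31) (.get 30 (nv 33))))
            (.cond (leTest (rv 31) (.mul (.get 2 (.const 1)) (rv 23)))
              (nset 32 (.add (nv 32) (.const 1))) (nset 32 (nv 32)))))
        (nset 0 (nv 32))))

lemma sampleProg_spec {N m : ℕ} {w : ℕ → ℝ} {u : ℝ} {σ : State} (hσm : σ.nat 0 0 = m)
    (hm : m ≤ N) (hu : σ.real 2 1 = u) (hw : ∀ i < m, σ.real 30 i = w i)
    (hW : σ.real 23 0 = ∑ i ∈ range m, w i) :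
    Spec N sampleProg σ (fun τ => τ.nat 0 0 = sampleIndex w m u) := by
  refine Spec.setReal_seq (Spec.setNat_seq ?_)
  refine (Spec.forLoop (n := m - 1) (by omega) (fun j τ => Frame 31 σ τ ∧
    τ.real 31 0 = ∑ k ∈ range j, w k ∧ τ.nat 32 0 = ∑ i ∈ range j,
      if ∑ k ∈ range (i + 1), w k ≤ u * ∑ k ∈ range m, w k then 1 else 0) ⟨?_, ?_, ?_⟩ ?_ ?_).seq ?_
  · exact (((Frame.refl 31 σ).writeReal le_rfl _ _).writeNat (by norm_num) _ _).writeNat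
      (by norm_num) _ _
  · simp [RExpr.eval, NExpr.eval]
  · simp [NExpr.eval]
  · rintro k τ ⟨h1, -⟩
    simp [NExpr.eval, h1.nat, hσm]
  · rintro k hk τ ⟨h1, h2, h3⟩ h4
    have e30 : τ.real 30 k = w k := by rw [h1.real (by norm_num), hw k (by omega)]
    have e23 : τ.real 23 0 = ∑ i ∈ range m, w i := by rw [h1.real (by norm_num), hW]
    have e2 : τ.real 2 1 = u := by rw [h1.real (by norm_num), hu]
    have hF : Frame 31 σ (τ.writeReal 31 0 (∑ k ∈ range (k + 1), w k)) :=
      h1.writeReal le_rfl _ _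
    refine Spec.setReal_seq ?_
    simp only [RExpr.eval, NExpr.eval, h4, h2, e30, ← sum_range_succ]
    refine Spec.cond (fun hb => Spec.setNat ?_) (fun hb => Spec.setNat ?_)
    · simp [Test.Holds, RExpr.eval, NExpr.eval, e23, e2] at hb
      refine ⟨by simpa using h4, (hF.writeNat (by norm_num) _ _).writeNat (by norm_num) _ _,
        by simp, ?_⟩
      have e := sum_range_succ
        (fun i => if ∑ k ∈ range (i + 1), w k ≤ u * ∑ k ∈ range m, w k then 1 else 0) k
      rw [if_pos hb] at e
      rw [e]
      simp [NExpr.eval, h3]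
    · simp [Test.Holds, RExpr.eval, NExpr.eval, e23, e2] at hb
      refine ⟨by simpa using h4, (hF.writeNat (by norm_num) _ _).writeNat (by norm_num) _ _,
        by simp, ?_⟩
      have e := sum_range_succ
        (fun i => if ∑ k ∈ range (i + 1), w k ≤ u * ∑ k ∈ range m, w k then 1 else 0) k
      rw [if_neg (not_le.2 hb)] at e
      rw [e]
      simp [NExpr.eval, h3]
  · rintro τ ⟨-, -, h3⟩
    refine Spec.setNat ?_
    simp [NExpr.eval, h3, sampleIndex]

/-- Computes the machine of the current job. -/
noncomputable def assignProg (α : ℝ) (κ : NExpr) : Prog :=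
  .seq prepareProg
    (.seq (rset 40 (rv 2))
      (.seq roundProg
        (.seq (.setReal 17 (.get 0 (.const 1)) (rv 41))
          (.seq (nset 18 (.get 0 (.const 1)))
            (.seq (weightProg α κ) sampleProg)))))

/-- Computes the expected reciprocal speed for a job of rounded size in real scalar `7`. -/
noncomputable def slownessProg (α : ℝ) (κ : NExpr) : Prog :=
  .seq (.setReal 17 (.get 0 (.const 1)) (rv 7))
    (.seq (nset 18 (.get 0 (.const 1)))
      (.seq (weightProg α κ)
        (.seq (sumLoop 31 (nv 0) (leTest (.const 0) (.const 0))
            (.mul (.div (.get 30 (nv 31)) (rv 23)) (.div (.const 1) (.get 0 (nv 31)))))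
          (rset 12 (rv 31)))))

/-- Computes the fee of the current job. -/
noncomputable def feeProg (α : ℝ) (κ : NExpr) : Prog :=
  .seq prepareProg
    (.seq (rset 40 (rv 2))
      (.seq roundProg
        (.seq (rset 10 (rv 41))
          (.seq (dyadicProg (slownessProg α κ) (.mul (rv 7) (rv 12))
              (.sub (.const 0) (.mul (rv 7) (rv 12))))
            (.seq (sumLoop 31 (.get 0 (.const 1))
                (.and (.not (.natLt (.get 1 (nv 31)) (.get 0 (.const 2))))
                  (.not (.natLt (.get 0 (.const 2)) (.get 1 (nv 31)))))
                (.get 1 (nv 31)))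
              (rset 0 (.sub (rv 11) (.div (rv 31) (.get 0 (.get 0 (.const 2)))))))))))

/-- Computes the expected load of the machine in integer scalar `6` for the rounded speed in real
scalar `7`. -/
noncomputable def meanLoadProg (α : ℝ) (κ : NExpr) : Prog :=
  .seq (.setReal 16 (nv 6) (rv 7))
    (.seq (rset 12 (.const 0))
      (forLoop 13 (.get 0 (.const 1))
        (.seq (nset 18 (nv 13))
          (.seq (weightProg α κ)
            (rset 12 (.add (rv 12)
              (.mul (.get 1 (nv 13)) (.div (.get 30 (nv 6)) (rv 23)))))))))

/-- Computes the payments to all machines. -/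
noncomputable def payProg (α : ℝ) (κ : NExpr) : Prog :=
  .seq prepareProg
    (forLoop 6 (nv 0)
      (.seq (rset 10 (.get 16 (nv 6)))
        (.seq (dyadicProg (meanLoadProg α κ) (.div (rv 12) (.mul (.const 2) (rv 7)))
            (.div (rv 12) (rv 7)))
          (.seq (.setReal 16 (nv 6) (rv 10)) (.setReal 0 (nv 6) (rv 11))))))

lemma load_eq_sum {m : ℕ} (s : Fin m → ℝ) (h : History m) (i : Fin m) (k : ℕ) (x y : ℝ) :
    load h i = ∑ j ∈ range h.length, if (input s h k x y).nat 1 j = i then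
      (input s h k x y).real 1 j else 0 := by
  rw [load, ← Fin.sum_univ_fun_getElem, ← Fin.sum_univ_eq_sum_range (fun j =>
    if (input s h k x y).nat 1 j = i then (input s h k x y).real 1 j else 0)]
  refine sum_congr rfl fun j _ => ?_
  rw [input_machine _ _ _ _ _ j.2, input_size _ _ _ _ _ j.2]
  simp only [Fin.ext_iff]

section Programs

variable {m : ℕ} [NeZero m] {s : Fin m → ℝ} {h : History m} {N K : ℕ} {α : ℝ} {κ : NExpr}
  (hκ : ∀ τ : State, τ.nat 0 0 = m → κ.eval τ = K)
  (hs : ∀ i, 0 < s i) (hh : ∀ x ∈ h, 0 < x.1) (hm : m ≤ N) (hn : h.length + 1 ≤ N)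
  (hslog : ∀ i, (Int.log 2 (s i)).natAbs ≤ N) (hhlog : ∀ x ∈ h, (Int.log 2 x.1).natAbs ≤ N)

include hκ hm hn

lemma assignProg_spec (hs : ∀ i, 0 < s i) (hh : ∀ x ∈ h, 0 < x.1)
    (hslog : ∀ i, (Int.log 2 (s i)).natAbs ≤ N) (hhlog : ∀ x ∈ h, (Int.log 2 x.1).natAbs ≤ N)
    {p : ℝ} (hp : 0 < p) (hplog : (Int.log 2 p).natAbs ≤ N) (u : ℝ) :
    Spec N (assignProg α κ) (input s h 0 p u)
      (fun τ => τ.nat 0 0 = ((mechanism α K m).assign s h p u : ℕ)) := by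
  refine (prepareProg_spec hs hh hm (by omega) hslog hhlog 0 p u).seq ?_
  rintro τ ⟨h1, h2, h3⟩
  refine Spec.setReal_seq ?_
  have e : τ.real 2 0 = p := by rw [h1.real (by norm_num), input_fst]
  refine (roundProg_spec _ ?_ ?_).seq ?_
  · simpa [RExpr.eval, NExpr.eval, e] using hp
  · simpa [RExpr.eval, NExpr.eval, e] using hplog
  rintro τ₂ ⟨h4, h5⟩
  simp only [RExpr.eval, NExpr.eval, e, State.real_writeReal, Function.update_self] at h5
  have h6 : Frame 16 (input s h 0 p u) τ₂ :=
    (h1.writeReal (by norm_num) _ _).trans (h4.mono (by norm_num))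
  refine Spec.setReal_seq (Spec.setNat_seq ?_)
  have e1 : τ₂.nat 0 1 = h.length := by rw [h6.nat (by norm_num), input_jobs]
  have e2 : τ₂.nat 0 0 = m := by rw [h6.nat (by norm_num), input_machines]
  simp only [RExpr.eval, NExpr.eval, e1, h5, State.nat_writeReal]
  set σ := (τ₂.writeReal 17 h.length (dyadicFloor p)).writeNat 18 0 h.length with hσ
  have f0 : σ.nat 0 0 = m := by simp [hσ, e2]
  have f18 : σ.nat 18 0 = h.length := by simp [hσ]
  refine (weightProg_spec (K := K) α κ σ (f0 ▸ hm) (f18 ▸ hn)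
    fun υ hυ => hκ υ (by rw [hυ.nat (by norm_num), f0])).seq ?_
  rintro υ ⟨h7, h8, h9⟩
  have hA : ∀ i < m, σ.real 16 i = speedArray s i := by
    intro i hi
    have : σ.real 16 = τ.real 16 := by simp [hσ, h4.real]
    rw [this, h2 i hi]
  have hP : ∀ j < h.length + 1, σ.real 17 j
      = Function.update (sizeArray (h.map Prod.fst)) h.length (dyadicFloor p) j := by
    intro j hj
    have : σ.real 17 = Function.update (τ.real 17) h.length (dyadicFloor p) := by
      simp [hσ, h4.real]
    rw [this]
    rcases Nat.lt_succ_iff_lt_or_eq.1 hj with hj | rfl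
    · rw [Function.update_of_ne hj.ne, Function.update_of_ne hj.ne, h3 j hj]
    · simp
  rw [f0, f18] at h8 h9
  refine sampleProg_spec (m := m) ?_ hm ?_ ?_ ?_
  · rw [h7.nat (by norm_num), f0]
  · rw [h7.real (by norm_num)]
    simp [hσ, h6.real]
  · intro i hi
    rw [h8 i hi]
    exact weight_congr hA hP hi
  · rw [h9]
    exact totalWeight_congr hA hP

omit [NeZero m] in
-- The hypothesis on σ₀ says that it is some input memory, with its parameters read off from σ₀
-- itself. The trial size is written only at index `h.length`, so the past sizes remain valid for
-- the next call.
lemma slownessProg_spec {σ₀ : State} (hσ₀ : σ₀ = input s h (σ₀.nat 0 2) (σ₀.real 2 0) (σ₀.real 2 1))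
    {τ : State} (h1 : Frame 3 σ₀ τ) (h2 : ∀ i < m, τ.real 16 i = speedArray s i)
    (h3 : ∀ j < h.length, τ.real 17 j = sizeArray (h.map Prod.fst) j) :
    Spec N (slownessProg α κ) τ (fun υ => (Frame 3 σ₀ υ ∧
      (∀ i < m, υ.real 16 i = speedArray s i) ∧
      ∀ j < h.length, υ.real 17 j = sizeArray (h.map Prod.fst) j) ∧
      Frame 12 τ υ ∧ υ.real 12 0 = slowness α K s h (τ.real 7 0)) := by
  have e1 : τ.nat 0 1 = h.length := by rw [h1.nat (by norm_num), hσ₀, input_jobs]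
  have e2 : τ.nat 0 0 = m := by rw [h1.nat (by norm_num), hσ₀, input_machines]
  refine Spec.setReal_seq (Spec.setNat_seq ?_)
  simp only [RExpr.eval, NExpr.eval, e1, State.nat_writeReal]
  set y := τ.real 7 0 with hy
  set σ := (τ.writeReal 17 h.length y).writeNat 18 0 h.length with hσ
  have f0 : σ.nat 0 0 = m := by simp [hσ, e2]
  have f18 : σ.nat 18 0 = h.length := by simp [hσ]
  have hF : Frame 16 τ σ :=
    ((Frame.refl 16 τ).writeReal (by norm_num) _ _).writeNat (by norm_num) _ _
  refine (weightProg_spec (K := K) α κ σ (f0 ▸ hm) (f18 ▸ hn)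
    fun υ hυ => hκ υ (by rw [hυ.nat (by norm_num), f0])).seq ?_
  rintro υ ⟨h7, h8, h9⟩
  have hA : ∀ i < m, σ.real 16 i = speedArray s i := by
    intro i hi
    have : σ.real 16 = τ.real 16 := by simp [hσ]
    rw [this, h2 i hi]
  have h17 : σ.real 17 = Function.update (τ.real 17) h.length y := by simp [hσ]
  have hP : ∀ j < h.length + 1, σ.real 17 j
      = Function.update (sizeArray (h.map Prod.fst)) h.length y j := by
    intro j hj
    rw [h17]
    rcases Nat.lt_succ_iff_lt_or_eq.1 hj with hj | rfl
    · rw [Function.update_of_ne hj.ne, Function.update_of_ne hj.ne, h3 j hj]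
    · simp
  rw [f0, f18] at h8 h9
  have hFυ : Frame 16 τ υ := hF.trans (h7.mono (by norm_num))
  set b : ℕ → ℝ := fun i => if hi : i < m then (s ⟨i, hi⟩)⁻¹ else 0 with hb
  refine (Spec.sumLoop (n := m) (f := fun i => share α K (speedArray s) m
    (Function.update (sizeArray (h.map Prod.fst)) h.length y) h.length i * b i) hm ?_ ?_).seq ?_
  · intro ω hω
    simp [NExpr.eval, hω.nat, hFυ.nat, e2]
  · intro i hi ω hω hωi
    have e3 : ω.real 0 i = s ⟨i, hi⟩ := by
      rw [hω.real (by norm_num), hFυ.real (by norm_num), h1.real (by norm_num), hσ₀,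
        input_speed _ _ _ _ _ hi]
    refine ⟨fun _ => ?_, fun hb => absurd (by simp [Test.Holds, RExpr.eval]) hb⟩
    simp only [RExpr.eval, NExpr.eval, hωi, e3, hω.real (show 30 < 31 by norm_num),
      hω.real (show 23 < 31 by norm_num), h8 i hi, h9]
    rw [share, weight_congr hA hP hi, totalWeight_congr hA hP]
    simp only [hb, hi, dite_true, one_div]
  rintro ω ⟨h10, h11⟩
  have hFω : Frame 16 τ ω := hFυ.trans (h10.mono (by norm_num))
  have hFω' : Frame 20 σ ω := h7.trans (h10.mono (by norm_num))
  refine Spec.setReal ⟨⟨?_, ?_, ?_⟩, ?_, ?_⟩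
  · exact (h1.trans (hFω.mono (by norm_num))).writeReal (by norm_num) _ _
  · intro i hi
    simp [hFω'.real, hA i hi]
  · intro j hj
    simp [hFω'.real, h17, hj.ne, h3 j hj]
  · exact (hFω.mono (by norm_num)).writeReal le_rfl _ _
  · simp only [RExpr.eval, NExpr.eval, h11, State.real_writeReal, Function.update_self]
    rw [slowness, ← Fin.sum_univ_eq_sum_range (fun i => share α K (speedArray s) m
      (Function.update (sizeArray (h.map Prod.fst)) h.length y) h.length i * b i)]
    exact sum_congr rfl fun i _ => by simp [hb]

lemma feeProg_spec (hs : ∀ i, 0 < s i) (hh : ∀ x ∈ h, 0 < x.1)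
    (hslog : ∀ i, (Int.log 2 (s i)).natAbs ≤ N) (hhlog : ∀ x ∈ h, (Int.log 2 x.1).natAbs ≤ N)
    {p : ℝ} (hp : 0 < p) (hplog : (Int.log 2 p).natAbs ≤ N) (i : Fin m) :
    Spec N (feeProg α κ) (input s h i p 0)
      (fun τ => τ.real 0 0 = (mechanism α K m).fee s h p i) := by
  refine (prepareProg_spec hs hh hm (by omega) hslog hhlog i p 0).seq ?_
  rintro τ ⟨h1, h2, h3⟩
  refine Spec.setReal_seq ?_
  have e : τ.real 2 0 = p := by rw [h1.real (by norm_num), input_fst]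
  refine (roundProg_spec _ ?_ ?_).seq ?_
  · simpa [RExpr.eval, NExpr.eval, e] using hp
  · simpa [RExpr.eval, NExpr.eval, e] using hplog
  rintro τ₂ ⟨h4, h5⟩
  simp only [RExpr.eval, NExpr.eval, e, State.real_writeReal, Function.update_self] at h5
  have h6 : Frame 16 (input s h i p 0) τ₂ :=
    (h1.writeReal (by norm_num) _ _).trans (h4.mono (by norm_num))
  refine Spec.setReal_seq ?_
  simp only [RExpr.eval, NExpr.eval, h5]
  refine (dyadicProg_spec (k := Int.log 2 p) ?_ hplog (fun τ => Frame 3 (input s h i p 0) τ ∧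
    (∀ i < m, τ.real 16 i = speedArray s i) ∧
      ∀ j < h.length, τ.real 17 j = sizeArray (h.map Prod.fst) j) (slowness α K s h)
    (fun y a => y * a) (fun y a => 0 - y * a) ⟨?_, ?_, ?_⟩ ?_ ?_ ?_ ?_).seq ?_
  · simp [dyadicFloor]
  · exact (h6.mono (by norm_num)).writeReal (by norm_num) _ _
  · intro i hi
    simp [h4.real, h2 i hi]
  · intro j hj
    simp [h4.real, h3 j hj]
  · rintro υ ⟨g1, g2, g3⟩ a ha ha' v
    refine ⟨g1.writeReal (by omega) _ _, ?_, ?_⟩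
    · rwa [State.real_writeReal_of_ne _ _ _ (by omega)]
    · rwa [State.real_writeReal_of_ne _ _ _ (by omega)]
  · rintro υ ⟨g1, g2, g3⟩
    exact slownessProg_spec hκ hm hn rfl g1 g2 g3
  · intro υ; rfl
  · intro υ; rfl
  rintro υ ⟨⟨g1, -, -⟩, -, -, g5⟩
  refine (Spec.sumLoop (n := h.length) (f := fun j => if (input s h i p 0).nat 1 j = i then
      (input s h i p 0).real 1 j else 0) (by omega) ?_ ?_).seq ?_
  · intro ω hω
    simp [NExpr.eval, hω.nat, g1.nat]
  · intro j hj ω hω hωj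
    have e3 : ω.nat 1 j = (input s h i p 0).nat 1 j := by
      rw [hω.nat (by norm_num), g1.nat (by norm_num)]
    have e4 : ω.real 1 j = (input s h i p 0).real 1 j := by
      rw [hω.real (by norm_num), g1.real (by norm_num)]
    have e5 : ω.nat 0 2 = i := by
      rw [hω.nat (by norm_num), g1.nat (by norm_num), input_index]
    simp only [Test.Holds, RExpr.eval, NExpr.eval, hωj, e3, e4, e5]
    refine ⟨fun hb => (if_pos ?_).symm, fun hb => if_neg ?_⟩ <;> omega
  rintro ω ⟨h7, h8⟩
  refine Spec.setReal ?_
  have e6 : ω.nat 0 2 = i := by rw [h7.nat (by norm_num), g1.nat (by norm_num), input_index]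
  have e7 : ω.real 0 i = s i := by
    rw [h7.real (by norm_num), g1.real (by norm_num), input_speed _ _ _ _ _ i.2]
  have e8 : ω.real 11 0 = υ.real 11 0 := by rw [h7.real (by norm_num)]
  simp only [RExpr.eval, NExpr.eval, State.real_writeReal, Function.update_self, e6, e7, e8, h8,
    ← load_eq_sum, g5, mechanism, dyadicFloor]
  ring

omit [NeZero m] in
-- The trial speed overwrites entry i of the rounded speeds, so the invariant leaves out that entry;
-- every call sets it anew.
lemma meanLoadProg_spec {i : Fin m} {τ : State} (h1 : τ.nat 0 0 = m) (h1' : τ.nat 0 1 = h.length)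
    (h2 : τ.nat 6 0 = i) (h3 : ∀ j < h.length, τ.real 1 j = (h.map Prod.fst).getD j 0)
    (h4 : ∀ k < m, k ≠ i → τ.real 16 k = speedArray s k)
    (h5 : ∀ j < h.length, τ.real 17 j = sizeArray (h.map Prod.fst) j) :
    Spec N (meanLoadProg α κ) τ (fun υ => (υ.nat 0 0 = m ∧ υ.nat 0 1 = h.length ∧ υ.nat 6 0 = i ∧
      (∀ j < h.length, υ.real 1 j = (h.map Prod.fst).getD j 0) ∧
      (∀ k < m, k ≠ i → υ.real 16 k = speedArray s k) ∧
      ∀ j < h.length, υ.real 17 j = sizeArray (h.map Prod.fst) j) ∧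
      Frame 12 τ υ ∧ υ.real 12 0 = meanLoad α K s (h.map Prod.fst) i (τ.real 7 0)) := by
  set y := τ.real 7 0 with hy
  set l := h.map Prod.fst with hl
  refine Spec.setReal_seq (Spec.setReal_seq ?_)
  refine (Spec.forLoop (n := h.length) (by omega) (fun j υ => Frame 12 τ υ ∧
    υ.real 16 = Function.update (τ.real 16) i y ∧ υ.real 17 = τ.real 17 ∧
    υ.real 12 0 = ∑ j ∈ range j, l.getD j 0 * share α K (Function.update (speedArray s) i y) m
      (sizeArray l) j i) ⟨?_, ?_, ?_, ?_⟩ ?_ ?_).mono ?_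
  · exact (((Frame.refl 12 τ).writeReal (by norm_num) _ _).writeReal le_rfl _ _).writeNat
      (by norm_num) _ _
  · simp [NExpr.eval, RExpr.eval, h2, hy]
  · simp
  · simp [NExpr.eval, RExpr.eval]
  · rintro k υ ⟨g1, -⟩
    simp [NExpr.eval, g1.nat, h1']
  · rintro j hj υ ⟨g1, g2, g3, g4⟩ g5
    refine Spec.setNat_seq ?_
    simp only [NExpr.eval, g5]
    set σ := υ.writeNat 18 0 j with hσ
    have f0 : σ.nat 0 0 = m := by simp [hσ, g1.nat, h1]
    have f18 : σ.nat 18 0 = j := by simp [hσ]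
    have hA : ∀ k < m, σ.real 16 k = Function.update (speedArray s) i y k := by
      intro k hk
      have : σ.real 16 = υ.real 16 := rfl
      rw [this, g2]
      by_cases hki : k = i
      · subst hki; simp
      · rw [Function.update_of_ne hki, Function.update_of_ne hki, h4 k hk hki]
    have hP : ∀ k < j + 1, σ.real 17 k = sizeArray l k := by
      intro k hk
      have : σ.real 17 = υ.real 17 := rfl
      rw [this, g3, h5 k (by omega)]
    refine (weightProg_spec (K := K) α κ σ (f0 ▸ hm) (by omega)
      fun υ hυ => hκ υ (by rw [hυ.nat (by norm_num), f0])).seq ?_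
    rintro ω ⟨w1, w2, w3⟩
    rw [f0, f18] at w2 w3
    have w4 : Frame 18 υ ω :=
      ((Frame.refl 18 υ).writeNat le_rfl _ _).trans (w1.mono (by norm_num))
    have w5 : Frame 12 τ ω := g1.trans (w4.mono (by norm_num))
    have e6 : ω.nat 6 0 = i := by rw [w5.nat (by norm_num), h2]
    have e13 : ω.nat 13 0 = j := by rw [w4.nat (by norm_num), g5]
    have e1 : ω.real 1 j = l.getD j 0 := by rw [w5.real (by norm_num), h3 j hj]
    refine Spec.setReal ⟨?_, ?_, ?_, ?_, ?_⟩
    · simpa using e13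
    · exact (w5.writeReal le_rfl _ _).writeNat (by norm_num) _ _
    · simp [w4.real, g2]
    · simp [w4.real, g3]
    · simp only [RExpr.eval, NExpr.eval, State.real_writeNat, State.real_writeReal,
        Function.update_self, e13, e6, e1, w2 i i.2, w3, w4.real (show 12 < 18 by norm_num), g4]
      rw [sum_range_succ, share, weight_congr hA hP i.2, totalWeight_congr hA hP]
  · rintro υ ⟨g1, g2, g3, g4⟩
    refine ⟨⟨?_, ?_, ?_, ?_, ?_, ?_⟩, g1, ?_⟩
    · rw [g1.nat (by norm_num), h1]
    · rw [g1.nat (by norm_num), h1']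
    · rw [g1.nat (by norm_num), h2]
    · rw [g1.real (by norm_num)]; exact h3
    · intro k hk hki
      rw [g2, Function.update_of_ne hki, h4 k hk hki]
    · rw [g3]; exact h5
    · rw [g4, meanLoad, hl, List.length_map]

/-- The payments overwrite the input speeds in real array 0. This is safe because after the rounding
phase only array 16 is consulted, and its entry i is restored from scalar 10 before the next
machine. -/
lemma payProg_spec (hs : ∀ i, 0 < s i) (hh : ∀ x ∈ h, 0 < x.1)
    (hslog : ∀ i, (Int.log 2 (s i)).natAbs ≤ N) (hhlog : ∀ x ∈ h, (Int.log 2 x.1).natAbs ≤ N) :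
    Spec N (payProg α κ) (input s h 0 0 0)
      (fun τ => ∀ i : Fin m, τ.real 0 i = (mechanism α K m).pay s h i) := by
  refine (prepareProg_spec hs hh hm (by omega) hslog hhlog 0 0 0).seq ?_
  rintro τ ⟨h1, h2, h3⟩
  refine (Spec.forLoop (n := m) hm (fun k τ => τ.nat 0 0 = m ∧ τ.nat 0 1 = h.length ∧
    (∀ j < h.length, τ.real 1 j = (h.map Prod.fst).getD j 0) ∧
    (∀ k < m, τ.real 16 k = speedArray s k) ∧
    (∀ j < h.length, τ.real 17 j = sizeArray (h.map Prod.fst) j) ∧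
    ∀ i : Fin m, (i : ℕ) < k → τ.real 0 i = (mechanism α K m).pay s h i) ?_ ?_ ?_).mono
    fun τ hτ i => hτ.2.2.2.2.2 i i.2
  · refine ⟨by simp [h1.nat], by simp [h1.nat], ?_, by simpa using h2, by simpa using h3,
      fun i hi => by omega⟩
    intro j hj
    rw [State.real_writeNat, h1.real (by norm_num), input_size _ _ _ _ _ hj,
      List.getD_eq_getElem _ _ (by simpa using hj), List.getElem_map]
  · rintro k τ ⟨g1, -⟩
    simpa [NExpr.eval] using g1
  rintro k hk τ ⟨g0, g1, g2, g3, g4, g5⟩ g6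
  set i : Fin m := ⟨k, hk⟩ with hi
  refine Spec.setReal_seq ?_
  have e16 : τ.real 16 k = 2 ^ Int.log 2 (s i) := by
    rw [g3 k hk, speedArray, dif_pos hk, dyadicFloor]
  simp only [RExpr.eval, NExpr.eval, g6, e16]
  refine (dyadicProg_spec (k := Int.log 2 (s i)) ?_ (hslog i) (fun υ => υ.nat 0 0 = m ∧
      υ.nat 0 1 = h.length ∧ υ.nat 6 0 = i ∧
      (∀ j < h.length, υ.real 1 j = (h.map Prod.fst).getD j 0) ∧
      (∀ k < m, k ≠ i → υ.real 16 k = speedArray s k) ∧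
      ∀ j < h.length, υ.real 17 j = sizeArray (h.map Prod.fst) j)
    (meanLoad α K s (h.map Prod.fst) i)
    (fun y a => a / (2 * y)) (fun y a => a / y) ⟨?_, ?_, ?_, ?_, ?_, ?_⟩ ?_ ?_ ?_ ?_).seq ?_
  · simp
  · simpa using g0
  · simpa using g1
  · simpa using g6
  · simpa using g2
  · intro k' hk' _
    simp [g3 k' hk']
  · simpa using g4
  · rintro υ ⟨w1, w2, w3, w4, w5, w6⟩ a ha ha' v
    refine ⟨w1, w2, w3, ?_, ?_, ?_⟩
    · rwa [State.real_writeReal_of_ne _ _ _ (by omega)]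
    · rwa [State.real_writeReal_of_ne _ _ _ (by omega)]
    · rwa [State.real_writeReal_of_ne _ _ _ (by omega)]
  · rintro υ ⟨w1, w2, w3, w4, w5, w6⟩
    exact meanLoadProg_spec hκ hm hn w1 w2 w3 w4 w5 w6
  · intro υ; rfl
  · intro υ; rfl
  rintro υ ⟨⟨w1, w2, w3, w4, w5, w6⟩, w7, w8, w9⟩
  refine Spec.setReal_seq (Spec.setReal ?_)
  have w3' : υ.nat 6 0 = k := w3
  simp only [RExpr.eval, NExpr.eval, w3', w8, State.nat_writeReal]
  refine ⟨trivial, by simpa using w1, by simpa using w2, by simpa using w4, ?_, by simpa using w6, ?_⟩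
  · intro k' hk'
    by_cases hkk : k' = k
    · subst hkk
      simp [← e16, g3 k' hk]
    · simp [hkk, w5 k' hk' hkk]
  · intro i' hi'
    rcases Nat.lt_succ_iff_lt_or_eq.1 hi' with hlt | heq
    · simp [hlt.ne, w7.real, g5 i' hlt]
    · have : i' = i := Fin.ext heq
      subst this
      simp only [State.real_writeNat, State.real_writeReal, hi, Function.update_self]
      rw [State.real_writeReal_of_ne _ _ _ (show 11 ≠ 16 by norm_num), w9]
      rfl

end Programs

end RealRAM

/-! ### Polynomial running time of the mechanism -/

namespace Scheduling

open RealRAM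

lemma natAbs_log_le (x : ℝ) (hx : 0 < x) : ((Int.log 2 x).natAbs : ℝ) ≤ 1 + |Real.logb 2 x| := by
  have h1 : Int.log 2 x = ⌊Real.logb 2 x⌋ := by
    have := Real.floor_logb_natCast (b := 2) (r := x) hx.le
    simpa using this.symm
  rw [h1, Nat.cast_natAbs, Int.cast_abs]
  have h2 := Int.floor_le (Real.logb 2 x)
  have h3 := Int.lt_floor_add_one (Real.logb 2 x)
  have h4 := neg_abs_le (Real.logb 2 x)
  have h5 := le_abs_self (Real.logb 2 x)
  rw [abs_le]
  constructor <;> linarith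

lemma one_add_abs_logb_speed_le {m : ℕ} (s : Fin m → ℝ) (ps : List ℝ) (i : Fin m) :
    1 + |Real.logb 2 (s i)| ≤ inputSize s ps := by
  have h1 : |Real.logb 2 (s i)| ≤ ∑ i, |Real.logb 2 (s i)| :=
    Finset.single_le_sum (f := fun i => |Real.logb 2 (s i)|) (fun _ _ => abs_nonneg _)
      (Finset.mem_univ i)
  have h2 : 0 ≤ (ps.map fun p => |Real.logb 2 p|).sum :=
    List.sum_nonneg fun x hx => by
      obtain ⟨y, -, rfl⟩ := List.mem_map.1 hx
      exact abs_nonneg _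
  unfold inputSize
  have h3 : (0 : ℝ) ≤ m := Nat.cast_nonneg _
  have h4 : (0 : ℝ) ≤ ps.length := Nat.cast_nonneg _
  linarith

lemma one_add_abs_logb_size_le {m : ℕ} (s : Fin m → ℝ) {ps : List ℝ} {p : ℝ} (hp : p ∈ ps) :
    1 + |Real.logb 2 p| ≤ inputSize s ps := by
  have h1 : 0 ≤ ∑ i, |Real.logb 2 (s i)| := Finset.sum_nonneg fun _ _ => abs_nonneg _
  have h2 : |Real.logb 2 p| ≤ (ps.map fun p => |Real.logb 2 p|).sum := by
    refine List.single_le_sum (fun x hx => ?_) _ (List.mem_map_of_mem hp)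
    obtain ⟨y, -, rfl⟩ := List.mem_map.1 hx
    exact abs_nonneg _
  unfold inputSize
  have h3 : (0 : ℝ) ≤ m := Nat.cast_nonneg _
  have h4 : (0 : ℝ) ≤ ps.length := Nat.cast_nonneg _
  linarith

lemma one_add_card_le {m : ℕ} (s : Fin m → ℝ) (ps : List ℝ) :
    1 + (m : ℝ) + ps.length ≤ inputSize s ps := by
  have h1 : 0 ≤ ∑ i, |Real.logb 2 (s i)| := Finset.sum_nonneg fun _ _ => abs_nonneg _
  have h2 : 0 ≤ (ps.map fun p => |Real.logb 2 p|).sum :=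
    List.sum_nonneg fun x hx => by
      obtain ⟨y, -, rfl⟩ := List.mem_map.1 hx
      exact abs_nonneg _
  unfold inputSize
  linarith

/-- Valid for every larger exponent as well, so that one exponent can serve all three programs. -/
lemma exists_cost_ceil_le (c : Prog) : ∃ d : ℕ, ∀ e : ℕ, d ≤ e → ∀ X : ℝ, 1 ≤ X →
    (c.cost ⌈X⌉₊ : ℝ) ≤ e * X ^ e := by
  obtain ⟨d, hd⟩ := c.exists_cost_le
  refine ⟨d * 2 ^ d, fun e he X hX => ?_⟩
  have h1 : 1 ≤ ⌈X⌉₊ := Nat.one_le_ceil_iff.2 (by linarith)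
  have h2 : (⌈X⌉₊ : ℝ) ≤ 2 * X := by
    have := Nat.ceil_lt_add_one (show 0 ≤ X by linarith)
    linarith
  have hde : d ≤ e := (Nat.le_mul_of_pos_right d (by positivity)).trans he
  calc (c.cost ⌈X⌉₊ : ℝ) ≤ ((d * ⌈X⌉₊ ^ d : ℕ) : ℝ) := Nat.cast_le.2 (hd _ h1)
    _ = d * (⌈X⌉₊ : ℝ) ^ d := by push_cast; ring
    _ ≤ d * (2 * X) ^ d := by gcongr
    _ = ((d * 2 ^ d : ℕ) : ℝ) * X ^ d := by rw [mul_pow]; push_cast; ring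
    _ ≤ e * X ^ e := by
        refine mul_le_mul (Nat.cast_le.2 he) (pow_le_pow_right₀ hX hde) (by positivity)
          (Nat.cast_nonneg _)

/-- The speed ratio may depend on m but the programs may not, so it enters as an expression
evaluated in memory. All loops are bounded by the rounded-up input size, which dominates m, the
number of jobs and all exponents. -/
lemma polynomialTime_mechanism (α : ℝ) (κ : NExpr) (K : ℕ → ℕ)
    (hκ : ∀ τ : State, κ.eval τ = K (τ.nat 0 0)) :
    PolynomialTime fun m _ => mechanism α (K m) m := by
  obtain ⟨d₁, h₁⟩ := exists_cost_ceil_le (assignProg α κ)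
  obtain ⟨d₂, h₂⟩ := exists_cost_ceil_le (feeProg α κ)
  obtain ⟨d₃, h₃⟩ := exists_cost_ceil_le (payProg α κ)
  refine ⟨assignProg α κ, feeProg α κ, payProg α κ, d₁ + d₂ + d₃, fun m _ s hs h hh => ?_⟩
  have hκm : ∀ τ : State, τ.nat 0 0 = m → κ.eval τ = K m := fun τ hτ => by rw [hκ, hτ]
  have hceil : ∀ {k : ℕ} {X : ℝ}, (k : ℝ) ≤ X → k ≤ ⌈X⌉₊ := fun hk =>
    Nat.cast_le.1 (hk.trans (Nat.le_ceil _))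
  have hmnn : (0 : ℝ) ≤ m := Nat.cast_nonneg _
  have hjob : ∀ p : ℝ, 0 < p → ∀ N, N = ⌈inputSize s (p :: h.map Prod.fst)⌉₊ →
      m ≤ N ∧ h.length + 1 ≤ N ∧ (∀ i, (Int.log 2 (s i)).natAbs ≤ N) ∧
      (∀ x ∈ h, (Int.log 2 x.1).natAbs ≤ N) ∧ (Int.log 2 p).natAbs ≤ N ∧
      1 ≤ inputSize s (p :: h.map Prod.fst) := by
    rintro p hp N rfl
    have hc := one_add_card_le s (p :: h.map Prod.fst)
    simp only [List.length_cons, List.length_map, Nat.cast_add, Nat.cast_one] at hc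
    have hlen : (0 : ℝ) ≤ h.length := Nat.cast_nonneg _
    refine ⟨hceil (by linarith), hceil (by push_cast; linarith), fun i => hceil ?_,
      fun x hx => hceil ?_, hceil ?_, by linarith⟩
    · exact (natAbs_log_le _ (hs i)).trans (one_add_abs_logb_speed_le _ _ _)
    · exact (natAbs_log_le _ (hh x hx)).trans (one_add_abs_logb_size_le _
        (List.mem_cons_of_mem _ (List.mem_map_of_mem hx)))
    · exact (natAbs_log_le _ hp).trans (one_add_abs_logb_size_le _ List.mem_cons_self)
  refine ⟨fun p hp u _ => ?_, fun p hp i => ?_, ?_⟩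
  · obtain ⟨a1, a2, a3, a4, a5, a6⟩ := hjob p hp _ rfl
    obtain ⟨t, τ, r1, r2, r3⟩ := assignProg_spec (α := α) hκm a1 a2 hs hh a3 a4 hp a5 u
    exact ⟨t, τ, r1, r3, (Nat.cast_le.2 r2).trans (h₁ _ (by omega) _ a6)⟩
  · obtain ⟨a1, a2, a3, a4, a5, a6⟩ := hjob p hp _ rfl
    obtain ⟨t, τ, r1, r2, r3⟩ := feeProg_spec (α := α) hκm a1 a2 hs hh a3 a4 hp a5 i
    exact ⟨t, τ, r1, r3, (Nat.cast_le.2 r2).trans (h₂ _ (by omega) _ a6)⟩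
  · have hc := one_add_card_le s (h.map Prod.fst)
    simp only [List.length_map] at hc
    have hlen : (0 : ℝ) ≤ h.length := Nat.cast_nonneg _
    obtain ⟨t, τ, r1, r2, r3⟩ := payProg_spec (N := ⌈inputSize s (h.map Prod.fst)⌉₊) (α := α) hκm
      (hceil (by linarith)) (hceil (by push_cast; linarith)) hs hh
      (fun i => hceil ((natAbs_log_le _ (hs i)).trans (one_add_abs_logb_speed_le _ _ _)))
      (fun x hx => hceil ((natAbs_log_le _ (hh x hx)).trans (one_add_abs_logb_size_le _
        (List.mem_map_of_mem hx))))
    exact ⟨t, τ, r1, r3, (Nat.cast_le.2 r2).trans (h₃ _ (by omega) _ (by linarith))⟩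

end Scheduling

theorem theorem2 :
    ∃ C : ℝ, 0 < C ∧ ∀ q : ℝ≥0∞, 1 ≤ q →
      ∃ M : ∀ (m : ℕ) [NeZero m], Scheduling.Mechanism m,
        Scheduling.PolynomialTime M ∧
        (∀ (m : ℕ) [NeZero m], (M m).TwoSidedTruthful) ∧
        (∀ (m : ℕ) [NeZero m], 2 ≤ m →
          (M m).CompetitiveInExpectation q (C * Scheduling.ratio q m) ∧
          (M m).CompetitiveWithHighProbability q (C * Scheduling.ratio q m)) := by
  refine ⟨2000, by norm_num, fun q hq => ⟨fun m _ => Scheduling.mechanism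
    (Scheduling.weightExponent q) (Scheduling.speedRatio q m) m, ?_, fun m _ => ?_,
    fun m _ hm => ⟨fun s hs ps hps => (Scheduling.competitive hm hq hs hps).1,
      fun s hs ps hps => (Scheduling.competitive hm hq hs hps).2⟩⟩⟩
  · refine Scheduling.polynomialTime_mechanism _
      (if q = 1 then .const 1 else .get 0 (.const 0)) (Scheduling.speedRatio q) fun τ => ?_
    unfold Scheduling.speedRatio
    split_ifs <;> rfl
  · exact Scheduling.twoSidedTruthful_mechanism
      (zero_lt_one.trans_le (Scheduling.one_le_weightExponent hq))
      (Scheduling.one_le_speedRatio q m)
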